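/- Let $0\le k\le n$ and $u>0$. On $\mathbb C^n$, with coordinates $z_j=x_j+iy_j$, take the standard symplectic form $\omega=\sum_j dx_j\wedge dy_j=d\lambda$, $\lambda=\frac12\sum_j(x_j\,dy_j-y_j\,dx_j)$, and the function $h(z)=\sum_{j=1}^n z_j^2$. For $w\in\mathbb C$ let $F_w=h^{-1}(w)$; let $M_k=\{x_1=\dots=x_k=0,\ y_{k+1}=\dots=y_n=0\}$, and for $s\in\mathbb R$ let $Q_{k,s}=F_s\cap M_k$. Let $Z_u=F_u\cap\mathbb R^n$ be the vanishing cycle. Let $\tau_\pi\colon F_{-u}\to F_u$ be the parallel transport, for the connection $(\ker dh)^{\perp_\omega}$, along the half circle $t\mapsto -e^{it}u$, $t\in[0,\pi]$. Then $\tau_\pi$ is well defined (every point of $F_{-u}$ has a horizontal lift of the half circle starting from it, with a unique endpoint), $\tau_\pi(Q_{k,-u})$ is an exact Lagrangian submanifold of $(F_u,\lambda|_{F_u})$, and it is isotopic in $F_u$ to the submanifold obtained from $Q_{k,u}$ and $Z_u$ by right-handed Morse–Bott Lagrangian surgery along their clean intersection $D=Q_{k,u}\cap Z_u$. Here the surgery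 is defined as follows. For some $\varepsilon>0$, take a symplectic chart $\Phi$ from the neighborhood $N_\varepsilon=\{(v,q,p): |v|<\varepsilon,\ |p|<\varepsilon\}$ of $\{0\}\times D$ in $(\mathbb C^k\times T^*D,\ \sum_j dx_j\wedge dy_j+\sum_j dp_j\wedge dq_j)$ onto a neighborhood of $D$ in $F_u$, such that $\Phi(0,q,0)=q$ on $D$, $\Phi^{-1}(Q_{k,u})=(\mathbb R^k\times D)\cap N_\varepsilon$ and $\Phi^{-1}(Z_u)=(i\mathbb R^k\times D)\cap N_\varepsilon$. Take a smooth immersed curve $\gamma\colon\mathbb R\to\mathbb C$ and $0<\delta<\varepsilon$ with $\gamma(s)=s$ for $s\ge\delta$, $\gamma(s)=-is$ for $s\le-\delta$, and, for $|s|<\delta$, $\gamma(s)$ in the open first quadrant, $|\gamma(s)|<\varepsilon$, $\operatorname{Re}\gamma'(s)\ge0$ and $\operatorname{Im}\gamma'(s)\le0$. Inside the image of $\Phi$, replace $Q_{k,u}\cup Z_u$ by the image of the handle $\{\gamma(s)v: s\in\mathbb R,\ v\in\mathbb R^k,\ |v|=1\}\times D$. The claim is that there is such a chart $\Phi$ for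 which the submanifold obtained with every such $\gamma$ (and such curves exist) is isotopic to $\tau_\pi(Q_{k,-u})$, through a smooth proper isotopy of Lagrangian embeddings in $F_u$. -/

import Mathlib

open scoped ContDiff

noncomputable section

/-- The complex Euclidean space of dimension `n`. -/
abbrev CSpace (n : ℕ) : Type := EuclideanSpace ℂ (Fin n)

/-! ### The local model -/

/-- The standard symplectic form `∑ dxⱼ ∧ dyⱼ`, where `zⱼ = xⱼ + i yⱼ`. -/
def stdOmega {n : ℕ} (v w : CSpace n) : ℝ :=
  ∑ j, ((v j).re * (w j).im - (v j).im * (w j).re)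

/-- The Liouville form `½ ∑ (xⱼ dyⱼ - yⱼ dxⱼ)`, a primitive of the standard symplectic form,
at the point `z`, evaluated on the vector `v`. -/
def stdLambda {n : ℕ} (z v : CSpace n) : ℝ :=
  (1 / 2) * ∑ j, ((z j).re * (v j).im - (z j).im * (v j).re)

/-- The quadratic function `h(z) = ∑ zⱼ²`. -/
def quadH {n : ℕ} (z : CSpace n) : ℂ := ∑ j, z j ^ 2

/-- The fiber `F_w` of `h` over `w`. -/
def quadFiber (n : ℕ) (w : ℂ) : Set (CSpace n) := {z | quadH z = w}

/-- The Lagrangian plane `M_k` spanned by the coordinates `y₁, …, y_k, x_{k+1}, …, x_n`. -/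
def realPlane (n k : ℕ) : Set (CSpace n) :=
  {z | ∀ j : Fin n, ((j : ℕ) < k → (z j).re = 0) ∧ (k ≤ (j : ℕ) → (z j).im = 0)}

/-- The real level set `Q_{k,u}`. -/
def realLevel (n k : ℕ) (u : ℝ) : Set (CSpace n) := quadFiber n (u : ℂ) ∩ realPlane n k

/-- The vanishing cycle `Z_u` of the fiber over a positive real number `u`. -/
def vanishingCycle (n : ℕ) (u : ℝ) : Set (CSpace n) :=
  {z | quadH z = (u : ℂ) ∧ ∀ j, (z j).im = 0}

/-! ### Parallel transport -/

/-- The curve `c`, on the time interval `[0, α]`, lies over the arc `t ↦ e^{it} h(c(0))` and is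
tangent to the connection formed by the symplectic orthogonal complements of the spaces `ker dh`. -/
def IsHorizontalLift {n : ℕ} (α : ℝ) (c : ℝ → CSpace n) : Prop :=
  ∀ t ∈ Set.Icc 0 α,
    quadH (c t) = Complex.exp ((t : ℂ) * Complex.I) * quadH (c 0) ∧
    ∃ ξ : CSpace n, HasDerivWithinAt c ξ (Set.Icc 0 α) t ∧
      ∀ η : CSpace n, fderiv ℂ quadH (c t) η = 0 → stdOmega ξ η = 0

/-- Parallel transport through the angle `α`, counterclockwise along the circle about the origin,
takes `z` to `z'`. -/
def ParallelTransports {n : ℕ} (α : ℝ) (z z' : CSpace n) : Prop :=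
  ∃ c : ℝ → CSpace n, IsHorizontalLift α c ∧ c 0 = z ∧ c α = z'

/-! ### Submanifolds -/

section Submanifolds

variable {V : Type*} [NormedAddCommGroup V] [NormedSpace ℝ V]

/-- Tangent vectors to `L` at `p`: the velocities of smooth curves in `L`. -/
def tangentSet (L : Set V) (p : V) : Set V :=
  {ξ | ∃ c : ℝ → V, ContDiffAt ℝ ∞ c 0 ∧ c 0 = p ∧ (∀ᶠ t in nhds (0 : ℝ), c t ∈ L) ∧
    HasDerivAt c ξ 0}

/-- `L` is a smooth embedded submanifold (without boundary) of dimension `d`: locally it is the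
image of a smooth parametrization `φ` which has a smooth left inverse `ψ`. -/
def IsEmbeddedSubmanifold (d : ℕ) (L : Set V) : Prop :=
  ∀ p ∈ L, ∃ (U : Set V) (O : Set (EuclideanSpace ℝ (Fin d)))
    (φ : EuclideanSpace ℝ (Fin d) → V) (ψ : V → EuclideanSpace ℝ (Fin d)),
    IsOpen U ∧ p ∈ U ∧ IsOpen O ∧ ContDiffOn ℝ ∞ φ O ∧ ContDiffOn ℝ ∞ ψ U ∧
    φ '' O = L ∩ U ∧ ∀ x ∈ O, ψ (φ x) = x

end Submanifolds

/-- `L` is an exact Lagrangian submanifold of `F`, where `F` is a submanifold of `ℂⁿ` of real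
dimension `2n - 2`, with the structure induced by the standard Liouville form. -/
structure IsExactLagrangian {n : ℕ} (F L : Set (CSpace n)) : Prop where
  subset : L ⊆ F
  submanifold : IsEmbeddedSubmanifold (n - 1) L
  lagrangian : ∀ z ∈ L, ∀ ξ ∈ tangentSet L z, ∀ η ∈ tangentSet L z, stdOmega ξ η = 0
  exact_form : ∃ (O : Set (CSpace n)) (f : CSpace n → ℝ), IsOpen O ∧ L ⊆ O ∧
    ContDiffOn ℝ ∞ f O ∧ ∀ z ∈ L, ∀ ξ ∈ tangentSet L z, stdLambda z ξ = fderiv ℝ f z ξ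

/-- `H` is a smooth Lagrangian isotopy in `F` from `L₀` to `L₁`: a smooth proper family, indexed
by `[0, 1]`, of injective Lagrangian immersions of `L₀` (hence of closed embeddings), which begins
with the inclusion and ends with a map onto `L₁`. -/
structure IsLagrangianIsotopy {n : ℕ} (F L₀ L₁ : Set (CSpace n)) (H : ℝ × CSpace n → CSpace n) :
    Prop where
  smooth : ∃ O : Set (ℝ × CSpace n), IsOpen O ∧ Set.Icc (0 : ℝ) 1 ×ˢ L₀ ⊆ O ∧ ContDiffOn ℝ ∞ H O
  mapsTo : ∀ t ∈ Set.Icc (0 : ℝ) 1, ∀ z ∈ L₀, H (t, z) ∈ F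
  injOn : ∀ t ∈ Set.Icc (0 : ℝ) 1, Set.InjOn (fun z => H (t, z)) L₀
  immersion : ∀ t ∈ Set.Icc (0 : ℝ) 1, ∀ z ∈ L₀, ∀ ξ ∈ tangentSet L₀ z,
    fderiv ℝ (fun y => H (t, y)) z ξ = 0 → ξ = 0
  lagrangian : ∀ t ∈ Set.Icc (0 : ℝ) 1, ∀ z ∈ L₀, ∀ ξ ∈ tangentSet L₀ z, ∀ η ∈ tangentSet L₀ z,
    stdOmega (fderiv ℝ (fun y => H (t, y)) z ξ) (fderiv ℝ (fun y => H (t, y)) z η) = 0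
  proper : ∀ K : Set (CSpace n), IsCompact K →
    IsCompact {x : ℝ × CSpace n | x.1 ∈ Set.Icc (0 : ℝ) 1 ∧ x.2 ∈ L₀ ∧ H x ∈ K}
  start : ∀ z ∈ L₀, H (0, z) = z
  finish : (fun z => H (1, z)) '' L₀ = L₁

/-- `L₀` and `L₁` are isotopic in `F` (through Lagrangian submanifolds). -/
def LagrangianIsotopic {n : ℕ} (F L₀ L₁ : Set (CSpace n)) : Prop :=
  ∃ H, IsLagrangianIsotopy F L₀ L₁ H

/-! ### Morse–Bott Lagrangian surgery

Let `L₁`, `L₂` be Lagrangian submanifolds of `F` which intersect cleanly along the compact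
submanifold `D = L₁ ∩ L₂`, of codimension `k`, whose normal bundle in `L₁` is trivial. A
neighborhood of `D` in `F` is then symplectomorphic to a neighborhood of `{0} × D` in `ℂᵏ × T*D`,
with `L₁` and `L₂` corresponding to `ℝᵏ × D` and `iℝᵏ × D`. -/

/-- Vectors of `ℂᵏ` which belong to `ℝᵏ`. -/
def IsRealVec {k : ℕ} (v : CSpace k) : Prop := ∀ j, (v j).im = 0

/-- Vectors of `ℂᵏ` which belong to `iℝᵏ`. -/
def IsImagVec {k : ℕ} (v : CSpace k) : Prop := ∀ j, (v j).re = 0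

/-- The neighborhood of size `ε` of `{0} × D` in `ℂᵏ × T*D`. A point of it is a triple `(v, q, p)`
with `v ∈ ℂᵏ`, `q ∈ D`, and `p` a tangent vector to `D` at `q`, viewed as a covector by means of the
Euclidean scalar product of the ambient space. -/
def modelTube {n : ℕ} (k : ℕ) (D : Set (CSpace n)) (ε : ℝ) :
    Set (CSpace k × CSpace n × CSpace n) :=
  {x | ‖x.1‖ < ε ∧ x.2.1 ∈ D ∧ x.2.2 ∈ tangentSet D x.2.1 ∧ ‖x.2.2‖ < ε}

/-- The symplectic form `∑ dxⱼ ∧ dyⱼ + ∑ dpⱼ ∧ dqⱼ` of `ℂᵏ × T*D`. -/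
def modelOmega {n k : ℕ} (ξ η : CSpace k × CSpace n × CSpace n) : ℝ :=
  stdOmega ξ.1 η.1 + ((inner ℂ ξ.2.2 η.2.1).re - (inner ℂ η.2.2 ξ.2.1).re)

/-- `Φ` is a symplectic chart of size `ε` about the clean intersection `L₁ ∩ L₂`, of codimension
`k`, in `F`. -/
structure IsSurgeryChart {n : ℕ} (k : ℕ) (F L₁ L₂ : Set (CSpace n)) (ε : ℝ)
    (Φ : CSpace k × CSpace n × CSpace n → CSpace n) : Prop where
  pos : 0 < ε
  compact : IsCompact (L₁ ∩ L₂)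
  smooth : ∃ O, IsOpen O ∧ modelTube k (L₁ ∩ L₂) ε ⊆ O ∧ ContDiffOn ℝ ∞ Φ O
  injOn : Set.InjOn Φ (modelTube k (L₁ ∩ L₂) ε)
  open_image : ∃ O, IsOpen O ∧ Φ '' modelTube k (L₁ ∩ L₂) ε = F ∩ O
  symplectic : ∀ x ∈ modelTube k (L₁ ∩ L₂) ε,
    ∀ ξ ∈ tangentSet (modelTube k (L₁ ∩ L₂) ε) x,
    ∀ η ∈ tangentSet (modelTube k (L₁ ∩ L₂) ε) x,
      stdOmega (fderiv ℝ Φ x ξ) (fderiv ℝ Φ x η) = modelOmega ξ η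
  zero_section : ∀ q ∈ L₁ ∩ L₂, Φ (0, q, 0) = q
  mem_first : ∀ x ∈ modelTube k (L₁ ∩ L₂) ε, Φ x ∈ L₁ ↔ IsRealVec x.1 ∧ x.2.2 = 0
  mem_second : ∀ x ∈ modelTube k (L₁ ∩ L₂) ε, Φ x ∈ L₂ ↔ IsImagVec x.1 ∧ x.2.2 = 0

/-- The profile curve of a handle: an immersed curve in `ℂ` that follows the positive imaginary axis,
then crosses the open first quadrant monotonically inside the disk of radius `ε`, and finally follows
the positive real axis. (In the oriented plane `ℂ`, a traveller who comes along the real axis towards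
the origin turns right onto the imaginary axis, so the corresponding handle is the right-handed
one.) -/
structure IsRightHandedProfile (ε δ : ℝ) (γ : ℝ → ℂ) : Prop where
  pos : 0 < δ
  lt : δ < ε
  smooth : ContDiff ℝ ∞ γ
  real_end : ∀ s, δ ≤ s → γ s = (s : ℂ)
  imag_end : ∀ s, s ≤ -δ → γ s = ((-s : ℝ) : ℂ) * Complex.I
  quadrant : ∀ s, |s| < δ → 0 < (γ s).re ∧ 0 < (γ s).im ∧ ‖γ s‖ < ε
  monotone : ∀ s, |s| < δ → 0 ≤ (deriv γ s).re ∧ (deriv γ s).im ≤ 0 ∧ deriv γ s ≠ 0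

/-- The handle `{γ(s) v : s ∈ ℝ, v ∈ ℝᵏ, ‖v‖ = 1} × D`, inside the tube of size `ε`. -/
def modelHandle {n : ℕ} (k : ℕ) (D : Set (CSpace n)) (ε : ℝ) (γ : ℝ → ℂ) :
    Set (CSpace k × CSpace n × CSpace n) :=
  {x | x ∈ modelTube k D ε ∧ x.2.2 = 0 ∧
    ∃ (s : ℝ) (v : CSpace k), IsRealVec v ∧ ‖v‖ = 1 ∧ x.1 = γ s • v}

/-- `S` is obtained from `L₁` and `L₂` by right-handed Morse–Bott Lagrangian surgery along
`L₁ ∩ L₂`, performed in the chart `Φ` of size `ε`: inside the chart, `L₁ ∪ L₂` is replaced with a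
handle. -/
def IsRightHandedSurgery {n : ℕ} (k : ℕ) (L₁ L₂ : Set (CSpace n)) (ε : ℝ)
    (Φ : CSpace k × CSpace n × CSpace n → CSpace n) (S : Set (CSpace n)) : Prop :=
  ∃ (δ : ℝ) (γ : ℝ → ℂ), IsRightHandedProfile ε δ γ ∧
    S = ((L₁ ∪ L₂) \ Φ '' modelTube k (L₁ ∩ L₂) ε) ∪ Φ '' modelHandle k (L₁ ∩ L₂) ε γ

end

/-!
# Half a turn of parallel transport and Morse–Bott surgery

Write `n = k + m`. All the objects are invariant under `O(k) × O(m)`, and the proof is explicit.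

*Parallel transport.* A horizontal vector at `z` is a multiple of the conjugate of `z`
(`horizontal_iff`). Hence a horizontal lift of a circle about the origin has constant norm, and
satisfies a differential equation which is linear over the reals once this norm is fixed. Its
solution gives uniqueness and the closed formula `halfTransport` for `τ_π` (`parallelTransports_iff`).
The image of `Q_{k,-u} = {(iy, x) : |y|² = |x|² + u}` consists of the points `(a(t) y, b(t) x)`, where
`t = |x|²`, and where `a` and `b` are smooth functions of `t` with complex values
(`image_realLevel`). A set of this form is Lagrangian, as `|y|²` and `|x|²` are both functions of
`t`, and here the Liouville form has the primitive `π u² / (4 |z|²)`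
(`isExactLagrangian_transportLag`).

*The chart.* The fiber `F_u` is the cotangent bundle of a sphere, and `surgeryChart` is the
cotangent lift of the map `(y, q) ↦ (y, q) / |(y, q)|` from `ℝᵏ × D` to this sphere, up to factors
which depend on `u`. It is defined on all of `ℂᵏ × T*D`, so that tubes of every size are available.

*The isotopy.* For coefficients `a`, `b` with `a² (t + u) + b² t = u`, the point `(a y, b x)` has in
this chart the coordinates `(c e, q, 0)`, where `e` and `q` are the normalized directions of `-y` and
`x`, and `c` is a complex number determined by `a`, `b` and `t` (`twist_eq_surgeryChart`). Thus the
transported Lagrangian is a handle whose profile is a certain curve of the first quadrant,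
`transportProfile`, along which the real part increases and the imaginary part decreases. It is
joined to the given profile `γ` by linear interpolation (`isoProfile`). The difference of real and
imaginary parts is strictly increasing along all the interpolated curves, and this makes all members
of the family injective immersions (`injOn_transportIsotopy`, `iso_nondegenerate`).

The points with `x = 0` are not in the range of the chart. Near them the isotopy is smooth because
`γ` runs along the imaginary axis there, and because the parametrization `profileParam` of `γ` by `t`
is adjusted to the transported Lagrangian (`contDiffAt_slope_finish`). There the end of the isotopy
consists of points of `Z_u`, so that it is the surgery (`image_transportIsotopy`).
-/

noncomputable section

open scoped ComplexConjugate

/-! ### The functions `cos √w` and `sin √w / √w` -/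

/-- The entire function `∑ (-1)ⁿ wⁿ / (2n)!`, whose value at `x²` is `cos x`. -/
def cosSqrt (w : ℝ) : ℝ :=
  FormalMultilinearSeries.ofScalarsSum (𝕜 := ℝ) (fun n : ℕ => (-1 : ℝ) ^ n / ((2 * n).factorial : ℝ)) w

/-- The entire function `∑ (-1)ⁿ wⁿ / (2n + 1)!`, whose value at `x²` is `sin x / x`. -/
def sincSqrt (w : ℝ) : ℝ :=
  FormalMultilinearSeries.ofScalarsSum (𝕜 := ℝ)
    (fun n : ℕ => (-1 : ℝ) ^ n / ((2 * n + 1).factorial : ℝ)) w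

theorem contDiff_ofScalarsSum_of_ratio (c : ℕ → ℝ) (hc : ∀ n, c n ≠ 0)
    (h : Filter.Tendsto (fun n => ‖c n.succ‖ / ‖c n‖) Filter.atTop (nhds 0)) :
    ContDiff ℝ ∞ (FormalMultilinearSeries.ofScalarsSum (E := ℝ) c) := by
  have hr := FormalMultilinearSeries.ofScalars_radius_eq_top_of_tendsto (E := ℝ) c
    (Filter.Eventually.of_forall hc) h
  have hp := (FormalMultilinearSeries.ofScalars ℝ c).hasFPowerSeriesOnBall (by rw [hr]; simp)
  rw [hr] at hp
  have : AnalyticOnNhd ℝ (FormalMultilinearSeries.ofScalarsSum (E := ℝ) c) Set.univ := by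
    intro x _
    exact hp.analyticAt_of_mem (by simp)
  exact this.contDiff

theorem contDiff_cosSqrt : ContDiff ℝ ∞ cosSqrt := by
  refine contDiff_ofScalarsSum_of_ratio _ (fun n => by positivity) ?_
  refine squeeze_zero (fun n => by positivity) (fun n => ?_) tendsto_one_div_add_atTop_nhds_zero_nat
  rw [norm_div, norm_div, norm_pow, norm_pow, norm_neg, norm_one, one_pow, one_pow,
    div_div_div_cancel_left' _ _ one_ne_zero, Real.norm_natCast, Real.norm_natCast,
    div_le_div_iff₀ (by positivity) (by positivity), Nat.mul_succ, Nat.factorial_succ,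
    Nat.factorial_succ]
  push_cast
  have h : (0 : ℝ) < (2 * n).factorial := by positivity
  have h2 : (0 : ℝ) ≤ n := n.cast_nonneg
  nlinarith [mul_nonneg h.le h2, mul_nonneg (mul_nonneg h.le h2) h2]

theorem contDiff_sincSqrt : ContDiff ℝ ∞ sincSqrt := by
  refine contDiff_ofScalarsSum_of_ratio _ (fun n => by positivity) ?_
  refine squeeze_zero (fun n => by positivity) (fun n => ?_) tendsto_one_div_add_atTop_nhds_zero_nat
  rw [norm_div, norm_div, norm_pow, norm_pow, norm_neg, norm_one, one_pow, one_pow,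
    div_div_div_cancel_left' _ _ one_ne_zero, Real.norm_natCast, Real.norm_natCast,
    div_le_div_iff₀ (by positivity) (by positivity), Nat.mul_succ,
    show 2 * n + 2 + 1 = 2 * n + 1 + 1 + 1 by ring, Nat.factorial_succ (2 * n + 1 + 1),
    Nat.factorial_succ (2 * n + 1)]
  push_cast
  have h : (0 : ℝ) < (2 * n + 1).factorial := by positivity
  have h2 : (0 : ℝ) ≤ n := n.cast_nonneg
  nlinarith [mul_nonneg h.le h2, mul_nonneg (mul_nonneg h.le h2) h2]

theorem cosSqrt_sq (x : ℝ) : cosSqrt (x ^ 2) = Real.cos x := by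
  rw [cosSqrt, FormalMultilinearSeries.ofScalars_sum_eq, Real.cos_eq_tsum]
  congr 1; ext n; simp only [smul_eq_mul]; ring

theorem sincSqrt_sq_mul (x : ℝ) : sincSqrt (x ^ 2) * x = Real.sin x := by
  rw [sincSqrt, FormalMultilinearSeries.ofScalars_sum_eq, Real.sin_eq_tsum, ← tsum_mul_right]
  congr 1; ext n; simp only [smul_eq_mul]; ring

theorem sincSqrt_zero : sincSqrt 0 = 1 := by
  rw [sincSqrt, FormalMultilinearSeries.ofScalarsSum_zero]; simp

theorem cosSqrt_zero : cosSqrt 0 = 1 := by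
  rw [cosSqrt, FormalMultilinearSeries.ofScalarsSum_zero]; simp

/-! ### The transport angle -/

/-- The geometric mean `√(t(t + u))` of `|x|² = t` and `|y|² = t + u`. -/
def geoMean (u t : ℝ) : ℝ := √(t * (t + u))

/-- The angle through which half a turn of the base rotates the points with `|z|² = 2t + u`. -/
def angle (u t : ℝ) : ℝ := Real.pi * geoMean u t / (2 * t + u)

/-- The cosine of the transport angle, as a function which is smooth also at `t = 0`. -/
def angleCos (u t : ℝ) : ℝ := cosSqrt (Real.pi ^ 2 * (t * (t + u)) / (2 * t + u) ^ 2)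

/-- The sine of the transport angle divided by `√(t(t + u))`, smooth also at `t = 0`. -/
def angleSinc (u t : ℝ) : ℝ :=
  Real.pi * sincSqrt (Real.pi ^ 2 * (t * (t + u)) / (2 * t + u) ^ 2) / (2 * t + u)

section Angle
variable {u t : ℝ}

theorem geoMean_sq (hu : 0 < u) (ht : 0 ≤ t) : geoMean u t ^ 2 = t * (t + u) :=
  Real.sq_sqrt (by positivity)

theorem geoMean_pos (hu : 0 < u) (ht : 0 < t) : 0 < geoMean u t :=
  Real.sqrt_pos.2 (by positivity)

theorem geoMean_nonneg : 0 ≤ geoMean u t := Real.sqrt_nonneg _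

theorem angle_sq (hu : 0 < u) (ht : 0 ≤ t) :
    angle u t ^ 2 = Real.pi ^ 2 * (t * (t + u)) / (2 * t + u) ^ 2 := by
  rw [angle, div_pow, mul_pow, geoMean_sq hu ht]

theorem angleCos_eq (hu : 0 < u) (ht : 0 ≤ t) : angleCos u t = Real.cos (angle u t) := by
  rw [angleCos, ← angle_sq hu ht, cosSqrt_sq]

theorem angleSinc_mul (hu : 0 < u) (ht : 0 ≤ t) :
    angleSinc u t * geoMean u t = Real.sin (angle u t) := by
  rw [angleSinc, ← angle_sq hu ht, ← sincSqrt_sq_mul, angle]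
  ring

theorem angle_nonneg (hu : 0 < u) (ht : 0 ≤ t) : 0 ≤ angle u t := by
  unfold angle; have := @geoMean_nonneg u t; positivity

theorem angle_pos (hu : 0 < u) (ht : 0 < t) : 0 < angle u t := by
  unfold angle; have := geoMean_pos hu ht; positivity

theorem angle_lt (hu : 0 < u) (ht : 0 ≤ t) : angle u t < Real.pi / 2 := by
  have h : 2 * geoMean u t < 2 * t + u := by
    refine lt_of_pow_lt_pow_left₀ 2 (by positivity) ?_
    rw [mul_pow, geoMean_sq hu ht]; nlinarith
  rw [angle, div_lt_iff₀ (by positivity)]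
  nlinarith [Real.pi_pos]

theorem angleCos_pos (hu : 0 < u) (ht : 0 ≤ t) : 0 < angleCos u t := by
  rw [angleCos_eq hu ht]
  have := angle_nonneg hu ht
  exact Real.cos_pos_of_mem_Ioo ⟨by linarith [Real.pi_pos], angle_lt hu ht⟩

theorem sin_angle_pos (hu : 0 < u) (ht : 0 < t) : 0 < Real.sin (angle u t) :=
  Real.sin_pos_of_pos_of_lt_pi (angle_pos hu ht) (by linarith [Real.pi_pos, angle_lt hu ht.le])

theorem angleSinc_pos (hu : 0 < u) (ht : 0 ≤ t) : 0 < angleSinc u t := by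
  rcases ht.eq_or_lt with rfl | ht
  · simp only [angleSinc, zero_mul, mul_zero, zero_div, sincSqrt_zero, zero_add, mul_one]
    have := Real.pi_pos; positivity
  · have h := angleSinc_mul hu ht.le
    have h2 := sin_angle_pos hu ht
    rw [← h] at h2
    exact pos_of_mul_pos_left h2 (geoMean_nonneg)

theorem angle_identity (hu : 0 < u) (ht : 0 ≤ t) :
    angleCos u t ^ 2 + angleSinc u t ^ 2 * (t * (t + u)) = 1 := by
  rw [← geoMean_sq hu ht, ← mul_pow, angleCos_eq hu ht, angleSinc_mul hu ht, Real.cos_sq_add_sin_sq]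

theorem contDiffAt_angleCos (ht : 0 < 2 * t + u) : ContDiffAt ℝ ∞ (angleCos u) t := by
  refine contDiff_cosSqrt.contDiffAt.comp t ?_
  exact ContDiffAt.div (by fun_prop) (by fun_prop) (by positivity)

theorem contDiffAt_angleSinc (ht : 0 < 2 * t + u) : ContDiffAt ℝ ∞ (angleSinc u) t := by
  refine ContDiffAt.div (contDiffAt_const.mul (contDiff_sincSqrt.contDiffAt.comp t ?_))
    (by fun_prop) (by positivity)
  exact ContDiffAt.div (by fun_prop) (by fun_prop) (by positivity)

theorem hasDerivAt_geoMean (hu : 0 < u) (ht : 0 < t) :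
    HasDerivAt (geoMean u) ((2 * t + u) / (2 * geoMean u t)) t := by
  have h : HasDerivAt (fun t => t * (t + u)) (2 * t + u) t := by
    have := (hasDerivAt_id t).mul ((hasDerivAt_id t).add_const u)
    refine this.congr_deriv ?_
    simp only [id]; ring
  exact h.sqrt (by positivity)

theorem hasDerivAt_angle (hu : 0 < u) (ht : 0 < t) :
    HasDerivAt (angle u) (Real.pi * u ^ 2 / (2 * geoMean u t * (2 * t + u) ^ 2)) t := by
  have h := ((hasDerivAt_geoMean hu ht).const_mul Real.pi).div
    (((hasDerivAt_id t).const_mul 2).add_const u) (by simp only [id]; positivity)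
  refine h.congr_deriv ?_
  have hg := geoMean_pos hu ht
  have hs := geoMean_sq hu ht.le
  simp only [id]
  field_simp
  linear_combination (-4) * hs

end Angle

/-! ### Coordinates of `ℂⁿ` -/

section Coordinates
variable {n : ℕ}

theorem hasDerivWithinAt_cspace {f : ℝ → CSpace n} {f' : CSpace n} {s : Set ℝ} {t : ℝ} :
    HasDerivWithinAt f f' s t ↔ ∀ j, HasDerivWithinAt (fun t => f t j) (f' j) s t := by
  simp only [hasDerivWithinAt_iff_hasFDerivWithinAt]
  rw [hasFDerivWithinAt_piLp 2]
  refine forall_congr' fun j => ?_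
  congr! 1

theorem hasDerivAt_cspace {f : ℝ → CSpace n} {f' : CSpace n} {t : ℝ} :
    HasDerivAt f f' t ↔ ∀ j, HasDerivAt (fun t => f t j) (f' j) t := by
  simp only [← hasDerivWithinAt_univ]
  exact hasDerivWithinAt_cspace

theorem stdOmega_eq (v w : CSpace n) : stdOmega v w = (∑ j, conj (v j) * w j).im := by
  rw [Complex.im_sum, stdOmega]
  refine Finset.sum_congr rfl fun j _ => ?_
  simp only [Complex.mul_im, Complex.conj_re, Complex.conj_im]; ring

theorem sum_mul_conj (z : CSpace n) : ∑ j, z j * conj (z j) = ((‖z‖ ^ 2 : ℝ) : ℂ) := by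
  rw [EuclideanSpace.norm_sq_eq, Complex.ofReal_sum]
  exact Finset.sum_congr rfl fun j _ => by rw [Complex.mul_conj, Complex.normSq_eq_norm_sq]

theorem norm_quadH_le (z : CSpace n) : ‖quadH z‖ ≤ ‖z‖ ^ 2 := by
  rw [EuclideanSpace.norm_sq_eq]
  refine (norm_sum_le _ _).trans_eq (Finset.sum_congr rfl fun j _ => norm_pow _ _)

theorem hasFDerivAt_quadH (z : CSpace n) :
    HasFDerivAt (quadH (n := n)) (∑ j, (2 * z j) • (EuclideanSpace.proj j : CSpace n →L[ℂ] ℂ)) z := by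
  unfold quadH
  refine HasFDerivAt.fun_sum fun j _ => ?_
  have := ((EuclideanSpace.proj j : CSpace n →L[ℂ] ℂ).hasFDerivAt (x := z)).pow 2
  simpa using this

theorem fderiv_quadH (z η : CSpace n) : fderiv ℂ quadH z η = 2 * ∑ j, z j * η j := by
  rw [(hasFDerivAt_quadH z).fderiv, sum_apply, Finset.mul_sum]
  refine Finset.sum_congr rfl fun j _ => ?_
  simp [mul_assoc]

/-- The symplectic orthogonal complement of `ker dh` at `z` is the complex line spanned by the
conjugate of `z`. -/
theorem horizontal_iff {z ξ : CSpace n} (hz : z ≠ 0) :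
    (∀ η : CSpace n, fderiv ℂ quadH z η = 0 → stdOmega ξ η = 0) ↔ ∃ κ : ℂ, ∀ j, ξ j = κ * conj (z j) := by
  constructor
  · intro h
    have hr : ((‖z‖ ^ 2 : ℝ) : ℂ) ≠ 0 := by
      exact_mod_cast pow_ne_zero 2 (norm_ne_zero_iff.2 hz)
    set κ : ℂ := (∑ j, z j * ξ j) / ((‖z‖ ^ 2 : ℝ) : ℂ) with hκ
    have hsum : ∀ c : ℂ, ∑ j, z j * (c * (ξ j - κ * conj (z j))) = 0 := by
      intro c
      have : ∑ j, z j * (c * (ξ j - κ * conj (z j)))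
          = c * (∑ j, z j * ξ j) - c * κ * ∑ j, z j * conj (z j) := by
        simp only [Finset.mul_sum, ← Finset.sum_sub_distrib]
        exact Finset.sum_congr rfl fun j _ => by ring
      rw [this, sum_mul_conj, hκ]
      field_simp
      ring
    -- Testing against `η` and `iη` gives a complex equation.
    have htest : ∀ c : ℂ, (c * ∑ j, conj (ξ j) * (ξ j - κ * conj (z j))).im = 0 := by
      intro c
      have h1 := h (WithLp.toLp 2 fun j => c * (ξ j - κ * conj (z j))) (by
        rw [fderiv_quadH]; simp only [hsum, mul_zero])
      rw [stdOmega_eq] at h1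
      rw [Finset.mul_sum, ← h1]
      congr 1
      exact Finset.sum_congr rfl fun j _ => by ring
    have hzero : ∑ j, conj (ξ j) * (ξ j - κ * conj (z j)) = 0 := by
      refine Complex.ext ?_ ?_
      · simpa using htest Complex.I
      · simpa using htest 1
    have hnorm : ∑ j, (ξ j - κ * conj (z j)) * conj (ξ j - κ * conj (z j)) = 0 := by
      have : ∑ j, (ξ j - κ * conj (z j)) * conj (ξ j - κ * conj (z j))
          = ∑ j, conj (ξ j) * (ξ j - κ * conj (z j))
            - conj κ * ∑ j, z j * (1 * (ξ j - κ * conj (z j))) := by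
        rw [Finset.mul_sum, ← Finset.sum_sub_distrib]
        refine Finset.sum_congr rfl fun j _ => ?_
        simp only [map_sub, map_mul, Complex.conj_conj]; ring
      rw [this, hzero, hsum]; simp
    refine ⟨κ, fun j => ?_⟩
    have h2 := sum_mul_conj (WithLp.toLp 2 fun j => ξ j - κ * conj (z j) : CSpace n)
    simp only [hnorm] at h2
    have h3 : (WithLp.toLp 2 fun j => ξ j - κ * conj (z j) : CSpace n) = 0 := by
      rw [← norm_eq_zero]
      exact pow_eq_zero_iff two_ne_zero |>.1 (by exact_mod_cast h2.symm)
    have h4 := congrArg (fun v : CSpace n => v j) h3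
    simpa [sub_eq_zero] using h4
  · rintro ⟨κ, hκ⟩ η hη
    rw [fderiv_quadH, mul_eq_zero, or_iff_right two_ne_zero] at hη
    have : ∑ j, conj (ξ j) * η j = conj κ * ∑ j, z j * η j := by
      rw [Finset.mul_sum]
      refine Finset.sum_congr rfl fun j _ => ?_
      rw [hκ, map_mul, Complex.conj_conj, mul_assoc]
    rw [stdOmega_eq, this, hη, mul_zero, Complex.zero_im]

theorem quadH_comb (P R : ℂ) (z w : CSpace n) (hw : ∀ j, w j = P * z j + R * conj (z j)) :
    quadH w = P ^ 2 * quadH z + R ^ 2 * conj (quadH z) + 2 * P * R * ((‖z‖ ^ 2 : ℝ) : ℂ) := by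
  rw [← sum_mul_conj]
  simp only [quadH, map_sum, map_pow, Finset.mul_sum, ← Finset.sum_add_distrib]
  exact Finset.sum_congr rfl fun j _ => by rw [hw]; ring

theorem norm_sq_comb (P R : ℂ) (z w : CSpace n) (hw : ∀ j, w j = P * z j + R * conj (z j)) :
    ((‖w‖ ^ 2 : ℝ) : ℂ) = (P * conj P + R * conj R) * ((‖z‖ ^ 2 : ℝ) : ℂ)
      + P * conj R * quadH z + R * conj P * conj (quadH z) := by
  rw [← sum_mul_conj, ← sum_mul_conj]
  simp only [quadH, map_sum, map_pow, Finset.mul_sum, ← Finset.sum_add_distrib]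
  refine Finset.sum_congr rfl fun j _ => ?_
  rw [hw]; simp only [map_add, map_mul, Complex.conj_conj]; ring

end Coordinates

/-! ### Parallel transport along the half circle -/

/-- Solutions of `C' = -σ² S`, `S' = C`: the functions `cos σt` and `sin σt / σ`. -/
theorem exists_trig_pair (σ : ℝ) : ∃ C S : ℝ → ℝ, (∀ t, HasDerivAt C (-(σ ^ 2 * S t)) t) ∧
    (∀ t, HasDerivAt S (C t) t) ∧ (∀ t, C t ^ 2 + σ ^ 2 * S t ^ 2 = 1) ∧ C 0 = 1 ∧ S 0 = 0 ∧
    C Real.pi = cosSqrt ((σ * Real.pi) ^ 2) ∧ S Real.pi = Real.pi * sincSqrt ((σ * Real.pi) ^ 2) := by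
  rcases eq_or_ne σ 0 with rfl | hσ
  · refine ⟨fun _ => 1, fun t => t, fun t => ?_, fun t => hasDerivAt_id t, ?_, rfl, rfl, ?_, ?_⟩
    · simpa using hasDerivAt_const t (1 : ℝ)
    · simp
    · simp [cosSqrt_zero]
    · simp [sincSqrt_zero]
  · have hl : ∀ t : ℝ, HasDerivAt (fun t => σ * t) σ t := fun t => by
      simpa using (hasDerivAt_id t).const_mul σ
    refine ⟨fun t => Real.cos (σ * t), fun t => Real.sin (σ * t) / σ, fun t => ?_, fun t => ?_,
      fun t => ?_, by simp, by simp, (cosSqrt_sq _).symm, ?_⟩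
    · refine (hl t).cos.congr_deriv ?_
      field_simp
    · refine ((hl t).sin.div_const σ).congr_deriv ?_
      field_simp
    · have := Real.cos_sq_add_sin_sq (σ * t)
      field_simp
      exact this
    · simp only [← sincSqrt_sq_mul]; field_simp

section Transport
variable {n : ℕ}

/-- Parallel transport along the half circle from `-u` to `u`. -/
def halfTransport (u : ℝ) (z : CSpace n) : CSpace n := WithLp.toLp 2 fun j =>
  let t := (‖z‖ ^ 2 - u) / 2
  (Complex.I * angleCos u t + angleSinc u t * (2 * t + u) / 2) * z j
    + (angleSinc u t * u / 2 : ℝ) * conj (z j)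

theorem le_norm_sq_of_mem {u : ℝ} (hu : 0 < u) {z : CSpace n}
    (hz : z ∈ quadFiber n ((-u : ℝ) : ℂ)) : u ≤ ‖z‖ ^ 2 := by
  have h := norm_quadH_le z
  rw [show quadH z = ((-u : ℝ) : ℂ) from hz, Complex.norm_real, norm_neg, Real.norm_eq_abs,
    abs_of_pos hu] at h
  exact h

/-- The explicit horizontal lift of the half circle starting at `z`. -/
theorem exists_horizontalLift {u : ℝ} (hu : 0 < u) {z : CSpace n}
    (hz : z ∈ quadFiber n ((-u : ℝ) : ℂ)) :
    ∃ c : ℝ → CSpace n, c 0 = z ∧ c Real.pi = halfTransport u z ∧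
      (∀ t : ℝ, quadH (c t) = Complex.exp ((t : ℂ) * Complex.I) * quadH z) ∧
      (∀ t : ℝ, ‖c t‖ ^ 2 = ‖z‖ ^ 2) ∧
      ∀ (t : ℝ) (j : Fin n), HasDerivAt (fun t => c t j) (Complex.I * Complex.exp ((t : ℂ) * Complex.I) * quadH z
        / (2 * ((‖z‖ ^ 2 : ℝ) : ℂ)) * conj (c t j)) t := by
  have hr := le_norm_sq_of_mem hu hz
  have hh : quadH z = ((-u : ℝ) : ℂ) := hz
  set r : ℝ := ‖z‖ ^ 2 with hrdef
  have hr0 : 0 < r := hu.trans_le hr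
  have hrc : (r : ℂ) ≠ 0 := by exact_mod_cast hr0.ne'
  obtain ⟨C, S, hC, hS, hCS, hC0, hS0, hCp, hSp⟩ := exists_trig_pair (√(1 - u ^ 2 / r ^ 2) / 2)
  have hσ : (√(1 - u ^ 2 / r ^ 2) / 2) ^ 2 = (1 - u ^ 2 / r ^ 2) / 4 := by
    rw [div_pow, Real.sq_sqrt]
    · norm_num
    · rw [sub_nonneg, div_le_one (by positivity)]
      exact pow_le_pow_left₀ hu.le hr 2
  rw [hσ] at hCS
  simp only [hσ] at hC
  set q : ℂ := (u : ℂ) / r with hq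
  have hur : (u : ℂ) = q * r := by rw [hq, div_mul_cancel₀ _ hrc]
  have hCS' : ∀ t : ℝ, (C t : ℂ) ^ 2 + (1 - q ^ 2) / 4 * (S t : ℂ) ^ 2 = 1 := by
    intro t; rw [hq, div_pow]; exact_mod_cast hCS t
  have hconj : conj q = q := by rw [hq, map_div₀, Complex.conj_ofReal, Complex.conj_ofReal]
  have hE : ∀ t : ℝ, HasDerivAt (fun t : ℝ => Complex.exp ((t : ℂ) * (Complex.I / 2)))
      (Complex.exp ((t : ℂ) * (Complex.I / 2)) * (Complex.I / 2)) t := by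
    intro t
    have := ((Complex.ofRealCLM.hasDerivAt (x := t)).mul_const (Complex.I / 2)).cexp
    simpa using this
  have hE2 : ∀ t : ℝ, Complex.exp ((t : ℂ) * Complex.I) = Complex.exp ((t : ℂ) * (Complex.I / 2)) ^ 2 := by
    intro t; rw [← Complex.exp_nat_mul]; congr 1; push_cast; ring
  have hE3 : ∀ t : ℝ, Complex.exp ((t : ℂ) * (Complex.I / 2))
      * conj (Complex.exp ((t : ℂ) * (Complex.I / 2))) = 1 := by
    intro t
    rw [← Complex.exp_conj, ← Complex.exp_add]
    rw [map_mul, Complex.conj_ofReal, map_div₀, Complex.conj_I, map_ofNat]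
    ring_nf
    exact Complex.exp_zero
  let P : ℝ → ℂ := fun t => Complex.exp ((t : ℂ) * (Complex.I / 2)) * (C t - Complex.I / 2 * S t)
  let R : ℝ → ℂ := fun t => Complex.exp ((t : ℂ) * (Complex.I / 2)) * (-(Complex.I / 2 * S t * q))
  let c : ℝ → CSpace n := fun t => WithLp.toLp 2 fun j => P t * z j + R t * conj (z j)
  have hc : ∀ t j, c t j = P t * z j + R t * conj (z j) := fun t j => rfl
  have hI : Complex.I ^ 2 = -1 := Complex.I_sq
  refine ⟨c, ?_, ?_, ?_, ?_, ?_⟩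
  · ext j
    simp [hc, P, R, hC0, hS0]
  · ext j
    have hexp : Complex.exp ((Real.pi : ℂ) * (Complex.I / 2)) = Complex.I := by
      rw [show (Real.pi : ℂ) * (Complex.I / 2) = Real.pi / 2 * Complex.I by ring]
      exact Complex.exp_pi_div_two_mul_I
    have ht : (√(1 - u ^ 2 / r ^ 2) / 2 * Real.pi) ^ 2
        = Real.pi ^ 2 * ((r - u) / 2 * ((r - u) / 2 + u)) / (2 * ((r - u) / 2) + u) ^ 2 := by
      rw [mul_pow, hσ, show 2 * ((r - u) / 2) + u = r by ring]
      field_simp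
      ring
    have h1 : C Real.pi = angleCos u ((r - u) / 2) := by rw [hCp, ht]; rfl
    have h2 : S Real.pi = angleSinc u ((r - u) / 2) * r := by
      rw [hSp, ht, angleSinc, show 2 * ((r - u) / 2) + u = r by ring]
      field_simp
    simp only [hc, P, R, halfTransport, hexp, h1, h2, ← hrdef]
    push_cast
    rw [hur]
    linear_combination (-(angleSinc u ((r - u) / 2) * r / 2 : ℂ) * (z j + q * conj (z j))) * hI
  · intro t
    rw [quadH_comb (P t) (R t) z (c t) (hc t), ← hrdef, hE2, hh, Complex.conj_ofReal]
    simp only [P, R]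
    push_cast
    rw [hur]
    linear_combination (-(q * r) * Complex.exp ((t : ℂ) * (Complex.I / 2)) ^ 2) * hCS' t
      + (Complex.exp ((t : ℂ) * (Complex.I / 2)) ^ 2 * q * r * (S t : ℂ) ^ 2 * (1 - q ^ 2) / 4) * hI
  · intro t
    have h := norm_sq_comb (P t) (R t) z (c t) (hc t)
    rw [← hrdef, hh, Complex.conj_ofReal] at h
    have h2 : ((‖c t‖ ^ 2 : ℝ) : ℂ) = (r : ℂ) := by
      rw [h]
      simp only [P, R, map_mul, map_sub, map_neg, map_div₀, Complex.conj_ofReal, Complex.conj_I,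
        map_ofNat, hconj]
      push_cast
      rw [hur]
      linear_combination (r * Complex.exp ((t : ℂ) * (Complex.I / 2))
          * conj (Complex.exp ((t : ℂ) * (Complex.I / 2)))) * hCS' t + r * hE3 t
        - (r * Complex.exp ((t : ℂ) * (Complex.I / 2))
          * conj (Complex.exp ((t : ℂ) * (Complex.I / 2))) * (S t : ℂ) ^ 2 * (1 - q ^ 2) / 4) * hI
    exact_mod_cast h2
  · intro t j
    have hP := (hE t).mul ((hC t).ofReal_comp.sub ((hS t).ofReal_comp.const_mul (Complex.I / 2)))
    have hR := (hE t).mul ((((hS t).ofReal_comp.const_mul (Complex.I / 2)).mul_const q).neg)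
    have h := (hP.mul_const (z j)).add (hR.mul_const (conj (z j)))
    refine h.congr_deriv ?_
    simp only [hc, P, R, map_mul, map_sub, map_add, map_neg, map_div₀, Complex.conj_ofReal,
      Complex.conj_I, map_ofNat, Complex.conj_conj, hE2, hh, hconj,
      Pi.sub_apply, Pi.neg_apply]
    push_cast
    rw [← div_pow, ← hq, hur]
    set E := Complex.exp ((t : ℂ) * (Complex.I / 2)) with hEdef
    rw [show Complex.I * E ^ 2 * -(q * r) / (2 * r) = -(Complex.I * E ^ 2 * q / 2) by field_simp]
    linear_combination (q ^ 2 - 1) * S t / 4 * E * z j * hI + Complex.I * q / 2 * E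
      * ((C t + Complex.I / 2 * S t) * conj (z j) + Complex.I / 2 * S t * q * z j) * hE3 t

/-- The velocity of a horizontal lift is `i h(c) / (2 ‖c‖²)` times the conjugate of `c`. -/
theorem IsHorizontalLift.velocity {α : ℝ} (hα : 0 < α) {c : ℝ → CSpace n}
    (h : IsHorizontalLift α c) (h0 : quadH (c 0) ≠ 0) {t : ℝ} (ht : t ∈ Set.Icc 0 α) (j : Fin n) :
    HasDerivWithinAt (fun t => c t j) (Complex.I * Complex.exp ((t : ℂ) * Complex.I) * quadH (c 0)
      / (2 * ((‖c t‖ ^ 2 : ℝ) : ℂ)) * conj (c t j)) (Set.Icc 0 α) t := by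
  obtain ⟨hq, ξ, hξ, hη⟩ := h t ht
  have hc : c t ≠ 0 := by
    intro hc
    rw [hc] at hq
    simp only [quadH, PiLp.zero_apply, ne_eq, OfNat.ofNat_ne_zero, not_false_eq_true, zero_pow,
      Finset.sum_const_zero] at hq
    exact (mul_ne_zero (Complex.exp_ne_zero _) h0) hq.symm
  have hr : ((‖c t‖ ^ 2 : ℝ) : ℂ) ≠ 0 := by
    exact_mod_cast pow_ne_zero 2 (norm_ne_zero_iff.2 hc)
  obtain ⟨κ, hκ⟩ := (horizontal_iff hc).1 hη
  -- Both sides of `h(c(t)) = e^{it} h(c(0))` are differentiated.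
  have h1 := ((hasFDerivAt_quadH (c t)).restrictScalars ℝ).comp_hasDerivWithinAt t hξ
  have h2 : HasDerivWithinAt (fun t : ℝ => Complex.exp ((t : ℂ) * Complex.I) * quadH (c 0))
      (Complex.exp ((t : ℂ) * Complex.I) * Complex.I * quadH (c 0)) (Set.Icc 0 α) t := by
    have := ((Complex.ofRealCLM.hasDerivAt (x := t)).mul_const Complex.I).cexp.mul_const (quadH (c 0))
    simpa using this.hasDerivWithinAt
  have h3 := ((uniqueDiffOn_Icc hα) t ht).eq_deriv _ (h2.congr_of_mem (fun s hs => (h s hs).1) ht) h1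
  have h4 : Complex.exp ((t : ℂ) * Complex.I) * Complex.I * quadH (c 0)
      = 2 * (κ * ((‖c t‖ ^ 2 : ℝ) : ℂ)) := by
    rw [h3, ← sum_mul_conj, ContinuousLinearMap.coe_restrictScalars', sum_apply, Finset.mul_sum,
      Finset.mul_sum]
    refine Finset.sum_congr rfl fun j _ => ?_
    rw [smul_apply, show (EuclideanSpace.proj j : CSpace n →L[ℂ] ℂ) ξ = ξ j from rfl, hκ,
      smul_eq_mul]
    ring
  have h5 := hasDerivWithinAt_cspace.1 hξ j
  rw [hκ] at h5
  convert h5 using 2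
  rw [div_eq_iff (mul_ne_zero two_ne_zero hr)]
  linear_combination h4

/-- Along a horizontal lift the norm is constant. -/
theorem IsHorizontalLift.norm_sq_eq {α : ℝ} (hα : 0 < α) {c : ℝ → CSpace n}
    (h : IsHorizontalLift α c) (h0 : quadH (c 0) ≠ 0) {t : ℝ} (ht : t ∈ Set.Icc 0 α) :
    ‖c t‖ ^ 2 = ‖c 0‖ ^ 2 := by
  have hd : ∀ s ∈ Set.Icc 0 α, HasDerivWithinAt (fun t => ‖c t‖ ^ 2) 0 (Set.Icc 0 α) s := by
    intro s hs
    have h1 : HasDerivWithinAt (fun t => ((‖c t‖ ^ 2 : ℝ) : ℂ)) 0 (Set.Icc 0 α) s := by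
      simp only [← sum_mul_conj]
      have h2 : ∀ j ∈ Finset.univ, HasDerivWithinAt (fun t => c t j * conj (c t j)) _ (Set.Icc 0 α) s :=
        fun j _ => (h.velocity hα h0 hs j).mul (h.velocity hα h0 hs j).star
      refine (HasDerivWithinAt.fun_sum h2).congr_deriv ?_
      have h6 := (h s hs).1
      have hsum : ∀ κ : ℂ, (∑ j, (κ * conj (c s j) * conj (c s j) + c s j * star (κ * conj (c s j))))
          = κ * conj (quadH (c s)) + conj κ * quadH (c s) := by
        intro κ
        simp only [quadH, map_sum, map_pow, Finset.mul_sum, ← Finset.sum_add_distrib]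
        refine Finset.sum_congr rfl fun j _ => ?_
        rw [← starRingEnd_apply, map_mul, Complex.conj_conj]
        ring
      rw [hsum, mul_assoc Complex.I, ← h6]
      simp only [map_div₀, map_mul, Complex.conj_I, map_ofNat, Complex.conj_ofReal]
      ring
    exact Complex.reCLM.hasFDerivAt.comp_hasDerivWithinAt s h1
  refine constant_of_derivWithin_zero (fun s hs => (hd s hs).differentiableWithinAt)
    (fun s hs => ?_) t ht
  have hs' := Set.Ico_subset_Icc_self hs
  exact (hd s hs').derivWithin (uniqueDiffOn_Icc hα s hs')

/-- Uniqueness holds because the norm of a horizontal lift is constant, and with a constant norm the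
differential equation satisfied by its coordinates is Lipschitz. -/
theorem parallelTransports_iff {u : ℝ} (hu : 0 < u) {z : CSpace n}
    (hz : z ∈ quadFiber n ((-u : ℝ) : ℂ)) (z' : CSpace n) :
    ParallelTransports Real.pi z z' ↔ z' = halfTransport u z := by
  have hr := hu.trans_le (le_norm_sq_of_mem hu hz)
  have hz0 : quadH z ≠ 0 := by
    rw [show quadH z = ((-u : ℝ) : ℂ) from hz]; exact_mod_cast neg_ne_zero.2 hu.ne'
  obtain ⟨c, hc0, hcp, hch, hcn, hcd⟩ := exists_horizontalLift hu hz
  constructor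
  · rintro ⟨b, hb, hb0, rfl⟩
    rw [← hcp]
    ext j
    let v : ℝ → ℂ → ℂ := fun t x => Complex.I * Complex.exp ((t : ℂ) * Complex.I) * quadH z
        / (2 * ((‖z‖ ^ 2 : ℝ) : ℂ)) * conj x
    have hbz : quadH (b 0) ≠ 0 := by rwa [hb0]
    have hv : ∀ t ∈ Set.Ico 0 Real.pi,
        LipschitzOnWith (‖quadH z‖ / (2 * ‖z‖ ^ 2)).toNNReal (v t) Set.univ := by
      intro t _
      refine LipschitzOnWith.of_dist_le_mul fun x _ y _ => ?_
      rw [dist_eq_norm, dist_eq_norm, ← mul_sub, norm_mul, norm_div, norm_mul, norm_mul, norm_mul,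
        ← map_sub, RCLike.norm_conj, Complex.norm_I, Complex.norm_exp_ofReal_mul_I,
        Complex.norm_real, Complex.norm_ofNat, Real.norm_of_nonneg hr.le, one_mul, one_mul,
        Real.coe_toNNReal _ (by positivity)]
    have hbd : ∀ t ∈ Set.Icc 0 Real.pi, HasDerivWithinAt (fun t => b t j) (v t (b t j))
        (Set.Icc 0 Real.pi) t := by
      intro t ht
      have := hb.velocity Real.pi_pos hbz ht j
      rwa [hb.norm_sq_eq Real.pi_pos hbz ht, hb0] at this
    refine ODE_solution_unique_of_mem_Icc_right hv
      (fun t ht => (hbd t ht).continuousWithinAt) (fun t ht => ?_) (fun _ _ => Set.mem_univ _)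
      (fun t _ => (hcd t j).continuousAt.continuousWithinAt)
      (fun t _ => (hcd t j).hasDerivWithinAt) (fun _ _ => Set.mem_univ _) ?_
      (Set.right_mem_Icc.2 Real.pi_pos.le)
    · exact (hbd t (Set.Ico_subset_Icc_self ht)).mono_of_mem_nhdsWithin
        (Icc_mem_nhdsGE_of_mem ht)
    · rw [hb0, hc0]
  · rintro rfl
    refine ⟨c, fun t _ => ⟨by rw [hch, hc0], WithLp.toLp 2 fun j => _,
      (hasDerivAt_cspace.2 fun j => hcd t j).hasDerivWithinAt, ?_⟩, hc0, hcp⟩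
    refine (horizontal_iff ?_).2 ⟨_, fun j => rfl⟩
    intro h
    have := hcn t
    rw [h, norm_zero] at this
    simp at this
    linarith

end Transport

/-! ### Derivatives along curves -/

theorem HasDerivAt.re {f : ℝ → ℂ} {f' : ℂ} {t : ℝ} (h : HasDerivAt f f' t) :
    HasDerivAt (fun t => (f t).re) f'.re t :=
  Complex.reCLM.hasFDerivAt.comp_hasDerivAt t h

theorem HasDerivAt.im {f : ℝ → ℂ} {f' : ℂ} {t : ℝ} (h : HasDerivAt f f' t) :
    HasDerivAt (fun t => (f t).im) f'.im t :=
  Complex.imCLM.hasFDerivAt.comp_hasDerivAt t h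

theorem HasDerivAt.prod_fst {E F : Type*} [NormedAddCommGroup E] [NormedSpace ℝ E]
    [NormedAddCommGroup F] [NormedSpace ℝ F] {f : ℝ → E × F} {f' : E × F} {t : ℝ}
    (h : HasDerivAt f f' t) : HasDerivAt (fun t => (f t).1) f'.1 t :=
  (ContinuousLinearMap.fst ℝ E F).hasFDerivAt.comp_hasDerivAt t h

theorem HasDerivAt.prod_snd {E F : Type*} [NormedAddCommGroup E] [NormedSpace ℝ E]
    [NormedAddCommGroup F] [NormedSpace ℝ F] {f : ℝ → E × F} {f' : E × F} {t : ℝ}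
    (h : HasDerivAt f f' t) : HasDerivAt (fun t => (f t).2) f'.2 t :=
  (ContinuousLinearMap.snd ℝ E F).hasFDerivAt.comp_hasDerivAt t h

theorem HasDerivAt.eq_zero_of_eventually_const {E : Type*} [NormedAddCommGroup E] [NormedSpace ℝ E]
    {f : ℝ → E} {f' a : E} {t : ℝ}
    (h : HasDerivAt f f' t) (hf : ∀ᶠ s in nhds t, f s = a) : f' = 0 :=
  h.unique ((hasDerivAt_const t a).congr_of_eventuallyEq hf)

/-! ### The intersection of the real level set and the vanishing cycle -/

section Chart
variable {k m : ℕ} {u : ℝ}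

theorem mem_realPlane_iff {z : CSpace (k + m)} : z ∈ realPlane (k + m) k ↔
    (∀ i : Fin k, (z (Fin.castAdd m i)).re = 0) ∧ ∀ i : Fin m, (z (Fin.natAdd k i)).im = 0 := by
  constructor
  · intro h
    exact ⟨fun i => (h _).1 (by simp), fun i => (h _).2 (by simp)⟩
  · rintro ⟨h1, h2⟩ j
    refine Fin.addCases (fun i => ⟨fun _ => h1 i, fun h => ?_⟩) (fun i => ⟨fun h => ?_, fun _ => h2 i⟩) j
    · simp at h; omega
    · simp at h

theorem quadH_eq_iff {n : ℕ} {z : CSpace n} {s : ℝ} : quadH z = (s : ℂ) ↔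
    ∑ j, ((z j).re ^ 2 - (z j).im ^ 2) = s ∧ ∑ j, (z j).re * (z j).im = 0 := by
  have hre : (quadH z).re = ∑ j, ((z j).re ^ 2 - (z j).im ^ 2) := by
    rw [quadH, Complex.re_sum]
    exact Finset.sum_congr rfl fun j _ => by rw [sq, Complex.mul_re]; ring
  have him : (quadH z).im = 2 * ∑ j, (z j).re * (z j).im := by
    rw [quadH, Complex.im_sum, Finset.mul_sum]
    exact Finset.sum_congr rfl fun j _ => by rw [sq, Complex.mul_im]; ring
  rw [Complex.ext_iff, hre, him, Complex.ofReal_re, Complex.ofReal_im]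
  simp

/-- The intersection of `Q_{k,u}` and `Z_u`: the sphere of radius `√u` in the space of the last
coordinates. -/
def coreSphere (k m : ℕ) (u : ℝ) : Set (CSpace (k + m)) :=
  {q | (∀ i : Fin k, q (Fin.castAdd m i) = 0) ∧ (∀ i : Fin m, (q (Fin.natAdd k i)).im = 0) ∧
    ∑ i : Fin m, (q (Fin.natAdd k i)).re ^ 2 = u}

/-- The tangent space of `coreSphere k m u` at `q`. -/
def coreTangent (k m : ℕ) (q : CSpace (k + m)) : Set (CSpace (k + m)) :=
  {p | (∀ i : Fin k, p (Fin.castAdd m i) = 0) ∧ (∀ i : Fin m, (p (Fin.natAdd k i)).im = 0) ∧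
    ∑ i : Fin m, (q (Fin.natAdd k i)).re * (p (Fin.natAdd k i)).re = 0}

theorem realLevel_inter_vanishingCycle :
    realLevel (k + m) k u ∩ vanishingCycle (k + m) u = coreSphere k m u := by
  ext q
  constructor
  · rintro ⟨⟨h1, h2⟩, h3, h4⟩
    rw [mem_realPlane_iff] at h2
    have h5 : ∀ i : Fin k, q (Fin.castAdd m i) = 0 := fun i => Complex.ext (h2.1 i) (h4 _)
    refine ⟨h5, h2.2, ?_⟩
    have h6 := (quadH_eq_iff.1 h3).1
    rw [Fin.sum_univ_add] at h6
    simpa [h5, h4] using h6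
  · rintro ⟨h1, h2, h3⟩
    have h4 : quadH q = (u : ℂ) := by
      rw [quadH_eq_iff, Fin.sum_univ_add, Fin.sum_univ_add]
      simpa [h1, h2] using h3
    refine ⟨⟨h4, mem_realPlane_iff.2 ⟨fun i => by simp [h1], h2⟩⟩, h4, ?_⟩
    exact Fin.addCases (fun i => by simp [h1]) h2

theorem tangentSet_coreSphere (hu : 0 < u) {q : CSpace (k + m)} (hq : q ∈ coreSphere k m u) :
    tangentSet (coreSphere k m u) q = coreTangent k m q := by
  ext p
  constructor
  · rintro ⟨c, -, hc0, hc, hp⟩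
    have hp' := hasDerivAt_cspace.1 hp
    refine ⟨fun i => (hp' _).eq_zero_of_eventually_const (hc.mono fun t ht => ht.1 i),
      fun i => (hp' _).im.eq_zero_of_eventually_const (hc.mono fun t ht => ht.2.1 i), ?_⟩
    have h1 : HasDerivAt (fun t => ∑ i : Fin m, (c t (Fin.natAdd k i)).re ^ 2) _ 0 :=
      HasDerivAt.fun_sum fun i _ => ((hp' (Fin.natAdd k i)).re.pow 2)
    have h2 := h1.eq_zero_of_eventually_const (hc.mono fun t ht => ht.2.2)
    rw [hc0] at h2
    have h3 : (2 : ℝ) * ∑ i : Fin m, (q (Fin.natAdd k i)).re * (p (Fin.natAdd k i)).re = 0 := by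
      rw [← h2, Finset.mul_sum]
      exact Finset.sum_congr rfl fun i _ => by norm_num; ring
    linarith
  · rintro ⟨h1, h2, h3⟩
    obtain ⟨g1, g2, g3⟩ := hq
    -- The great circle through `q` with velocity `p`, as a normalized straight line.
    set P : ℝ := ∑ i : Fin m, (p (Fin.natAdd k i)).re ^ 2 with hP
    have hPn : 0 ≤ P := Finset.sum_nonneg fun i _ => sq_nonneg _
    have hpos : ∀ t : ℝ, 0 < 1 + t ^ 2 * P / u := fun t => by positivity
    let g : ℝ → ℝ := fun t => (√(1 + t ^ 2 * P / u))⁻¹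
    have hg : ContDiff ℝ ∞ g := by
      refine ContDiff.inv (ContDiff.sqrt (by fun_prop) fun t => (hpos t).ne') fun t => ?_
      exact (Real.sqrt_pos.2 (hpos t)).ne'
    have hgs : ∀ t, g t ^ 2 * (1 + t ^ 2 * P / u) = 1 := fun t => by
      simp only [g]
      rw [inv_pow, Real.sq_sqrt (hpos t).le, inv_mul_cancel₀ (hpos t).ne']
    have hg0 : g 0 = 1 := by simp [g]
    have hgd : HasDerivAt g 0 0 := by
      have h : HasDerivAt (fun t : ℝ => 1 + t ^ 2 * P / u) 0 0 := by
        have := (((hasDerivAt_id (0 : ℝ)).pow 2).mul_const P).div_const u |>.const_add 1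
        simpa using this
      exact ((h.sqrt (hpos 0).ne').inv (Real.sqrt_pos.2 (hpos 0)).ne').congr_deriv (by simp)
    refine ⟨fun t => g t • (q + t • p), ?_, by simp [hg0], ?_, ?_⟩
    · exact (hg.smul (contDiff_const.add (contDiff_id.smul contDiff_const))).contDiffAt
    · refine Filter.Eventually.of_forall fun t => ⟨fun i => ?_, fun i => ?_, ?_⟩
      · simp [h1, g1]
      · simp [h2, g2]
      · have h4 : ∑ i : Fin m, ((g t • (q + t • p)) (Fin.natAdd k i)).re ^ 2 = g t ^ 2 * (
            ∑ i : Fin m, (q (Fin.natAdd k i)).re ^ 2 + 2 * t *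
            (∑ i : Fin m, (q (Fin.natAdd k i)).re * (p (Fin.natAdd k i)).re) + t ^ 2 * P) := by
          simp only [hP, Finset.mul_sum, ← Finset.sum_add_distrib]
          refine Finset.sum_congr rfl fun i _ => ?_
          simp
          ring
        rw [h4, h3, g3]
        have := hgs t
        field_simp at this
        linear_combination this
    · exact (hgd.smul ((hasDerivAt_id (0 : ℝ)).smul_const p |>.const_add q)).congr_deriv
        (by simp [hg0])

/-! ### The symplectic chart -/

/-- The direction, up to a positive factor, of the real part of the point of the chart
with coordinates `(v, q, p)`: the vector `(Im v, q)`. -/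
def chartPos (v : CSpace k) (q : CSpace (k + m)) : Fin (k + m) → ℝ :=
  Fin.addCases (fun i => (v i).im) (fun i => (q (Fin.natAdd k i)).re)

/-- The direction of minus the imaginary part: the vector `(Re v, p)`, corrected by a multiple of `q`
in order to make it orthogonal to `(Im v, q)`. -/
def chartMom (u : ℝ) (v : CSpace k) (q p : CSpace (k + m)) : Fin (k + m) → ℝ :=
  Fin.addCases (fun i => (v i).re) (fun i => (p (Fin.natAdd k i)).re
    - (∑ l, (v l).re * (v l).im) / u * (q (Fin.natAdd k i)).re)

/-- The squared norm of `(Im v, q)` when `q` lies on the sphere of radius `√u`. -/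
def chartNorm (u : ℝ) (v : CSpace k) : ℝ := ∑ i, (v i).im ^ 2 + u

/-- The positive number `μ` for which `μ (Im v, q) - i μ⁻¹ P` lies on the fiber over `u`, where `P` is
the momentum `chartMom`. -/
def chartScale (u : ℝ) (v : CSpace k) (q p : CSpace (k + m)) : ℝ :=
  √((u + √(u ^ 2 + 4 * chartNorm u v * ∑ j, chartMom u v q p j ^ 2)) / (2 * chartNorm u v))

/-- The symplectic chart about `Q_{k,u} ∩ Z_u`. Under the identification of the fiber with `T*Sⁿ⁻¹`
it is the cotangent lift of the parametrization `(y, q) ↦ (y, q) / |(y, q)|`. -/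
def surgeryChart (u : ℝ) (x : CSpace k × CSpace (k + m) × CSpace (k + m)) : CSpace (k + m) :=
  WithLp.toLp 2 fun j =>
    ((chartScale u x.1 x.2.1 x.2.2 * chartPos x.1 x.2.1 j : ℝ) : ℂ)
    + ((-(chartMom u x.1 x.2.1 x.2.2 j / chartScale u x.1 x.2.1 x.2.2) : ℝ) : ℂ) * Complex.I

variable {v : CSpace k} {q p : CSpace (k + m)}

@[simp] theorem chartPos_castAdd (i : Fin k) : chartPos v q (Fin.castAdd m i) = (v i).im := by
  simp [chartPos]

@[simp] theorem chartPos_natAdd (i : Fin m) :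
    chartPos v q (Fin.natAdd k i) = (q (Fin.natAdd k i)).re := by
  simp [chartPos]

@[simp] theorem chartMom_castAdd (i : Fin k) : chartMom u v q p (Fin.castAdd m i) = (v i).re := by
  simp [chartMom]

@[simp] theorem chartMom_natAdd (i : Fin m) : chartMom u v q p (Fin.natAdd k i)
    = (p (Fin.natAdd k i)).re - (∑ l, (v l).re * (v l).im) / u * (q (Fin.natAdd k i)).re := by
  simp [chartMom]

theorem surgeryChart_re (j : Fin (k + m)) :
    (surgeryChart u (v, q, p) j).re = chartScale u v q p * chartPos v q j := by
  simp [surgeryChart]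

theorem surgeryChart_im (j : Fin (k + m)) :
    (surgeryChart u (v, q, p) j).im = -(chartMom u v q p j / chartScale u v q p) := by
  simp [surgeryChart]

theorem chartNorm_pos (hu : 0 < u) : 0 < chartNorm u v := by
  unfold chartNorm; have : 0 ≤ ∑ i, (v i).im ^ 2 := Finset.sum_nonneg fun i _ => sq_nonneg _
  linarith

theorem chartScale_pos (hu : 0 < u) : 0 < chartScale u v q p := by
  have := chartNorm_pos (v := v) hu
  unfold chartScale; positivity

theorem sum_chartPos_sq (hq : q ∈ coreSphere k m u) : ∑ j, chartPos v q j ^ 2 = chartNorm u v := by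
  rw [Fin.sum_univ_add, chartNorm]
  simp [hq.2.2]

theorem sum_chartPos_mul_chartMom (hu : 0 < u) (hq : q ∈ coreSphere k m u) (hp : p ∈ coreTangent k m q) :
    ∑ j, chartPos v q j * chartMom u v q p j = 0 := by
  rw [Fin.sum_univ_add]
  simp only [chartPos_castAdd, chartMom_castAdd, chartPos_natAdd, chartMom_natAdd]
  have h : ∑ i : Fin m, (q (Fin.natAdd k i)).re * ((p (Fin.natAdd k i)).re
      - (∑ l, (v l).re * (v l).im) / u * (q (Fin.natAdd k i)).re)
      = ∑ i : Fin m, (q (Fin.natAdd k i)).re * (p (Fin.natAdd k i)).re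
        - (∑ l, (v l).re * (v l).im) / u * ∑ i : Fin m, (q (Fin.natAdd k i)).re ^ 2 := by
    rw [Finset.mul_sum, ← Finset.sum_sub_distrib]
    exact Finset.sum_congr rfl fun i _ => by ring
  rw [h, hp.2.2, hq.2.2, div_mul_cancel₀ _ hu.ne', zero_sub, add_neg_eq_zero]
  exact Finset.sum_congr rfl fun i _ => mul_comm _ _

/-- The larger root of the quadratic equation `N T² - u T - P = 0`. -/
theorem quadratic_root {N P u : ℝ} (hN : 0 < N) (hP : 0 ≤ P) (hu : 0 < u) :
    N * ((u + √(u ^ 2 + 4 * N * P)) / (2 * N)) - P / ((u + √(u ^ 2 + 4 * N * P)) / (2 * N)) = u := by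
  have hs : √(u ^ 2 + 4 * N * P) ^ 2 = u ^ 2 + 4 * N * P := Real.sq_sqrt (by positivity)
  have hs0 : 0 ≤ √(u ^ 2 + 4 * N * P) := Real.sqrt_nonneg _
  set s := √(u ^ 2 + 4 * N * P)
  have : u + s ≠ 0 := by positivity
  field_simp
  linear_combination hs

theorem chartScale_eq (hu : 0 < u) : chartNorm u v * chartScale u v q p ^ 2
    - (∑ j, chartMom u v q p j ^ 2) / chartScale u v q p ^ 2 = u := by
  have hN := chartNorm_pos (v := v) hu
  have hP : 0 ≤ ∑ j, chartMom u v q p j ^ 2 := Finset.sum_nonneg fun i _ => sq_nonneg _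
  rw [chartScale, Real.sq_sqrt (by positivity)]
  exact quadratic_root hN hP hu

theorem surgeryChart_mem (hu : 0 < u) (hq : q ∈ coreSphere k m u) (hp : p ∈ coreTangent k m q) :
    surgeryChart u (v, q, p) ∈ quadFiber (k + m) (u : ℂ) := by
  have hμ := chartScale_pos (v := v) (q := q) (p := p) hu
  refine quadH_eq_iff.2 ⟨?_, ?_⟩
  · refine Eq.trans ?_ (chartScale_eq (v := v) (q := q) (p := p) hu)
    rw [← sum_chartPos_sq hq, Finset.sum_mul, Finset.sum_div, ← Finset.sum_sub_distrib]
    refine Finset.sum_congr rfl fun j _ => ?_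
    rw [surgeryChart_re, surgeryChart_im, neg_sq, div_pow]; ring
  · rw [← neg_zero, ← sum_chartPos_mul_chartMom (v := v) hu hq hp, ← Finset.sum_neg_distrib]
    refine Finset.sum_congr rfl fun j _ => ?_
    rw [surgeryChart_re, surgeryChart_im]
    field_simp

theorem chartMom_eq_zero_iff (hu : 0 < u) (hq : q ∈ coreSphere k m u) (hp : p ∈ coreTangent k m q) :
    (∀ i : Fin m, chartMom u v q p (Fin.natAdd k i) = 0) ↔
      p = 0 ∧ ∑ l, (v l).re * (v l).im = 0 := by
  constructor
  · intro h
    have h1 : ∑ i : Fin m, (q (Fin.natAdd k i)).re * chartMom u v q p (Fin.natAdd k i) = 0 := by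
      simp [h]
    have h2 := sum_chartPos_mul_chartMom (v := v) hu hq hp
    rw [Fin.sum_univ_add] at h2
    simp only [chartPos_castAdd, chartMom_castAdd, chartPos_natAdd, h1, add_zero] at h2
    have h3 : ∑ l, (v l).re * (v l).im = 0 := by
      rw [← h2]; exact Finset.sum_congr rfl fun i _ => mul_comm _ _
    refine ⟨?_, h3⟩
    ext j
    refine Fin.addCases (fun i => by simp [hp.1]) (fun i => ?_) j
    have := h i
    rw [chartMom_natAdd, h3] at this
    exact Complex.ext (by simpa using this) (by simp [hp.2.1])
  · rintro ⟨rfl, h⟩ i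
    rw [chartMom_natAdd, h]; simp

theorem surgeryChart_mem_realLevel_iff (hu : 0 < u) (hq : q ∈ coreSphere k m u)
    (hp : p ∈ coreTangent k m q) :
    surgeryChart u (v, q, p) ∈ realLevel (k + m) k u ↔ IsRealVec v ∧ p = 0 := by
  have hμ := (chartScale_pos (v := v) (q := q) (p := p) hu).ne'
  rw [realLevel, Set.mem_inter_iff, and_iff_right (surgeryChart_mem hu hq hp), mem_realPlane_iff]
  simp only [surgeryChart_re, surgeryChart_im, chartPos_castAdd, mul_eq_zero, hμ, false_or, neg_eq_zero,
    div_eq_zero_iff, or_false, chartMom_eq_zero_iff hu hq hp]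
  constructor
  · rintro ⟨h1, h2, -⟩; exact ⟨h1, h2⟩
  · rintro ⟨h1, h2⟩; exact ⟨h1, h2, by simp [h1 _]⟩

theorem surgeryChart_mem_vanishingCycle_iff (hu : 0 < u) (hq : q ∈ coreSphere k m u)
    (hp : p ∈ coreTangent k m q) :
    surgeryChart u (v, q, p) ∈ vanishingCycle (k + m) u ↔ IsImagVec v ∧ p = 0 := by
  have hμ := (chartScale_pos (v := v) (q := q) (p := p) hu).ne'
  have h0 : quadH (surgeryChart u (v, q, p)) = (u : ℂ) := surgeryChart_mem hu hq hp
  rw [vanishingCycle, Set.mem_ofPred_eq, and_iff_right h0, Fin.forall_fin_add]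
  simp only [surgeryChart_im, neg_eq_zero, div_eq_zero_iff, hμ, or_false,
    chartMom_castAdd, chartMom_eq_zero_iff hu hq hp]
  constructor
  · rintro ⟨h1, h2, -⟩; exact ⟨h1, h2⟩
  · rintro ⟨h1, h2⟩; exact ⟨h1, h2, by simp [h1 _]⟩

theorem surgeryChart_zero_section (hu : 0 < u) (hq : q ∈ coreSphere k m u) :
    surgeryChart u ((0 : CSpace k), q, 0) = q := by
  have hM : ∀ j, chartMom u (0 : CSpace k) q 0 j = 0 :=
    Fin.addCases (fun i => by simp) (fun i => by simp)
  have hs : chartScale u (0 : CSpace k) q 0 = 1 := by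
    simp only [chartScale, hM]
    simp [chartNorm, Real.sqrt_sq hu.le, ← two_mul, hu.ne']
  ext j
  refine Complex.ext ?_ ?_
  · rw [surgeryChart_re, hs, one_mul]
    exact Fin.addCases (fun i => by simp [hq.1]) (fun i => by simp) j
  · rw [surgeryChart_im, hM]
    exact Fin.addCases (fun i => by simp [hq.1]) (fun i => by simp [hq.2.1]) j

end Chart

/-! ### The inverse of the chart -/

section ChartInverse
variable {k m : ℕ} {u : ℝ} {v : CSpace k} {q p : CSpace (k + m)}

/-- The length of the last `m` coordinates of the real part of `z`, divided by `√u`. -/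
def tailScale (k m : ℕ) (u : ℝ) (z : CSpace (k + m)) : ℝ :=
  √(∑ i : Fin m, (z (Fin.natAdd k i)).re ^ 2 / u)

/-- The inverse of `surgeryChart`, on the points whose last coordinates are not all imaginary. -/
def surgeryChartInv (u : ℝ) (z : CSpace (k + m)) : CSpace k × CSpace (k + m) × CSpace (k + m) :=
  let μ := tailScale k m u z
  (WithLp.toLp 2 fun i => ((-(μ * (z (Fin.castAdd m i)).im) : ℝ) : ℂ)
      + (((z (Fin.castAdd m i)).re / μ : ℝ) : ℂ) * Complex.I,
    WithLp.toLp 2 (Fin.addCases (fun _ => 0) fun i => (((z (Fin.natAdd k i)).re / μ : ℝ) : ℂ)),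
    WithLp.toLp 2 (Fin.addCases (fun _ => 0) fun i => ((-(μ * (z (Fin.natAdd k i)).im)
      - (∑ l : Fin k, (z (Fin.castAdd m l)).re * (z (Fin.castAdd m l)).im) / u
        * ((z (Fin.natAdd k i)).re / μ) : ℝ) : ℂ)))

theorem tailScale_surgeryChart (hu : 0 < u) (hq : q ∈ coreSphere k m u) :
    tailScale k m u (surgeryChart u (v, q, p)) = chartScale u v q p := by
  have hμ := chartScale_pos (v := v) (q := q) (p := p) hu
  rw [tailScale]
  simp only [surgeryChart_re, mul_pow, chartPos_natAdd]
  rw [← Finset.sum_div, ← Finset.mul_sum, hq.2.2, mul_div_assoc, div_self hu.ne', mul_one,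
    Real.sqrt_sq hμ.le]

theorem surgeryChartInv_surgeryChart (hu : 0 < u) (hq : q ∈ coreSphere k m u)
    (hp : p ∈ coreTangent k m q) : surgeryChartInv u (surgeryChart u (v, q, p)) = (v, q, p) := by
  have hμ := (chartScale_pos (v := v) (q := q) (p := p) hu).ne'
  simp only [surgeryChartInv, tailScale_surgeryChart hu hq, surgeryChart_re, surgeryChart_im,
    chartPos_castAdd, chartPos_natAdd, chartMom_castAdd, chartMom_natAdd]
  refine Prod.ext ?_ (Prod.ext ?_ ?_)
  · ext i
    refine Complex.ext ?_ ?_ <;> simp <;> field_simp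
  · ext j
    refine Fin.addCases (fun i => ?_) (fun i => ?_) j
    · simp [hq.1]
    · refine Complex.ext ?_ ?_
      · simp; field_simp
      · simp [hq.2.1]
  · have hs : ∑ l, chartScale u v q p * (v l).im * -((v l).re / chartScale u v q p)
        = - ∑ l, (v l).re * (v l).im := by
      rw [← Finset.sum_neg_distrib]
      refine Finset.sum_congr rfl fun l _ => ?_
      field_simp
    rw [hs]
    ext j
    refine Fin.addCases (fun i => ?_) (fun i => ?_) j
    · simp [hp.1]
    · refine Complex.ext ?_ ?_
      · simp only [Fin.addCases_right, Complex.ofReal_re]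
        field_simp
        ring
      · simp [hp.2.1]

theorem sq_tailScale (hu : 0 < u) (z : CSpace (k + m)) :
    ∑ i : Fin m, (z (Fin.natAdd k i)).re ^ 2 = u * tailScale k m u z ^ 2 := by
  rw [tailScale, Real.sq_sqrt (Finset.sum_nonneg fun i _ => by positivity), Finset.mul_sum]
  exact Finset.sum_congr rfl fun i _ => by field_simp

/-- The points of the fiber whose last coordinates are not all imaginary are in the domain of the
inverse chart. -/
theorem surgeryChartInv_mem (hu : 0 < u) {z : CSpace (k + m)} (hz : z ∈ quadFiber (k + m) (u : ℂ))
    (hz0 : 0 < tailScale k m u z) : (surgeryChartInv u z).2.1 ∈ coreSphere k m u ∧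
      (surgeryChartInv u z).2.2 ∈ coreTangent k m (surgeryChartInv u z).2.1 ∧
      surgeryChart u (surgeryChartInv u z) = z := by
  have hsq := sq_tailScale hu z
  obtain ⟨hz1, hz2⟩ := quadH_eq_iff.1 hz
  rw [Fin.sum_univ_add] at hz2
  have hv : ∀ i, (surgeryChartInv u z).1 i = ((-(tailScale k m u z * (z (Fin.castAdd m i)).im) : ℝ) : ℂ)
      + (((z (Fin.castAdd m i)).re / tailScale k m u z : ℝ) : ℂ) * Complex.I := fun _ => rfl
  have hq : ∀ i : Fin m, (surgeryChartInv u z).2.1 (Fin.natAdd k i)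
      = (((z (Fin.natAdd k i)).re / tailScale k m u z : ℝ) : ℂ) := fun i => by simp [surgeryChartInv]
  have hp : ∀ i : Fin m, (surgeryChartInv u z).2.2 (Fin.natAdd k i)
      = ((-(tailScale k m u z * (z (Fin.natAdd k i)).im)
      - (∑ l : Fin k, (z (Fin.castAdd m l)).re * (z (Fin.castAdd m l)).im) / u
        * ((z (Fin.natAdd k i)).re / tailScale k m u z) : ℝ) : ℂ) := fun i => by simp [surgeryChartInv]
  set μ := tailScale k m u z with hμ
  have hS : (surgeryChartInv u z).2.1 ∈ coreSphere k m u := by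
    refine ⟨fun i => by simp [surgeryChartInv], fun i => by rw [hq, Complex.ofReal_im], ?_⟩
    simp only [hq, Complex.ofReal_re, div_pow]
    rw [← Finset.sum_div, hsq]
    field_simp
  have hT : (surgeryChartInv u z).2.2 ∈ coreTangent k m (surgeryChartInv u z).2.1 := by
    refine ⟨fun i => by simp [surgeryChartInv], fun i => by rw [hp, Complex.ofReal_im], ?_⟩
    simp only [hq, hp, Complex.ofReal_re]
    set a := ∑ l : Fin k, (z (Fin.castAdd m l)).re * (z (Fin.castAdd m l)).im
    have : ∀ i : Fin m, (z (Fin.natAdd k i)).re / μ * (-(μ * (z (Fin.natAdd k i)).im)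
        - a / u * ((z (Fin.natAdd k i)).re / μ)) = -((z (Fin.natAdd k i)).re * (z (Fin.natAdd k i)).im)
        - a / (u * μ ^ 2) * (z (Fin.natAdd k i)).re ^ 2 := by
      intro i; field_simp
    simp only [this]
    rw [Finset.sum_sub_distrib, Finset.sum_neg_distrib, ← Finset.mul_sum, hsq]
    field_simp
    linarith
  refine ⟨hS, hT, ?_⟩
  set v := (surgeryChartInv u z).1 with hvdef
  set q := (surgeryChartInv u z).2.1 with hqdef
  set p := (surgeryChartInv u z).2.2 with hpdef
  change surgeryChart u (v, q, p) = z
  have hpos : ∀ j, chartPos v q j = (z j).re / μ := by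
    refine Fin.addCases (fun i => ?_) (fun i => ?_)
    · simp [hv]
    · simp [hq]
  have hsum : ∑ l, (v l).re * (v l).im
      = -∑ l : Fin k, (z (Fin.castAdd m l)).re * (z (Fin.castAdd m l)).im := by
    rw [← Finset.sum_neg_distrib]
    refine Finset.sum_congr rfl fun l _ => ?_
    simp only [hv]; simp; field_simp
  have hmom : ∀ j, chartMom u v q p j = -(μ * (z j).im) := by
    refine Fin.addCases (fun i => ?_) (fun i => ?_)
    · simp [hv]
    · rw [chartMom_natAdd, hp, hq, hsum, Complex.ofReal_re, Complex.ofReal_re]; ring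
  have hscale : chartScale u v q p = μ := by
    have hN : chartNorm u v = (∑ j, (z j).re ^ 2) / μ ^ 2 := by
      rw [← sum_chartPos_sq hS, Finset.sum_div]
      exact Finset.sum_congr rfl fun j _ => by rw [hpos, div_pow]
    have hP : ∑ j, chartMom u v q p j ^ 2 = μ ^ 2 * ∑ j, (z j).im ^ 2 := by
      rw [Finset.mul_sum]
      exact Finset.sum_congr rfl fun j _ => by rw [hmom]; ring
    rw [Finset.sum_sub_distrib] at hz1
    have hb : 0 ≤ ∑ j, (z j).im ^ 2 := Finset.sum_nonneg fun i _ => sq_nonneg _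
    set a := ∑ j, (z j).re ^ 2
    set b := ∑ j, (z j).im ^ 2
    have ha : 0 < a := by linarith
    have hr : u ^ 2 + 4 * (a / μ ^ 2) * (μ ^ 2 * b) = (2 * a - u) ^ 2 := by
      field_simp
      rw [← hz1]; ring
    rw [chartScale, hN, hP, hr, Real.sqrt_sq (by linarith),
      show (u + (2 * a - u)) / (2 * (a / μ ^ 2)) = μ ^ 2 by field_simp; ring, Real.sqrt_sq hz0.le]
  ext j
  refine Complex.ext ?_ ?_
  · rw [surgeryChart_re, hscale, hpos]; field_simp
  · rw [surgeryChart_im, hscale, hmom]; field_simp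

theorem contDiff_chartPos (j : Fin (k + m)) : ContDiff ℝ ∞
    fun x : CSpace k × CSpace (k + m) × CSpace (k + m) => chartPos x.1 x.2.1 j := by
  refine Fin.addCases (fun i => ?_) (fun i => ?_) j
  · simp only [chartPos_castAdd]
    exact Complex.imCLM.contDiff.comp ((contDiff_piLp_apply 2).comp contDiff_fst)
  · simp only [chartPos_natAdd]
    exact Complex.reCLM.contDiff.comp
      ((contDiff_piLp_apply 2).comp (contDiff_fst.comp contDiff_snd))

theorem contDiff_chartMom (j : Fin (k + m)) : ContDiff ℝ ∞
    fun x : CSpace k × CSpace (k + m) × CSpace (k + m) => chartMom u x.1 x.2.1 x.2.2 j := by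
  have hre : ∀ i : Fin k, ContDiff ℝ ∞
      fun x : CSpace k × CSpace (k + m) × CSpace (k + m) => (x.1 i).re := fun i =>
    Complex.reCLM.contDiff.comp ((contDiff_piLp_apply 2).comp contDiff_fst)
  have him : ∀ i : Fin k, ContDiff ℝ ∞
      fun x : CSpace k × CSpace (k + m) × CSpace (k + m) => (x.1 i).im := fun i =>
    Complex.imCLM.contDiff.comp ((contDiff_piLp_apply 2).comp contDiff_fst)
  refine Fin.addCases (fun i => ?_) (fun i => ?_) j
  · simpa using hre i
  · simp only [chartMom_natAdd]
    exact (Complex.reCLM.contDiff.comp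
      ((contDiff_piLp_apply 2).comp (contDiff_snd.comp contDiff_snd))).sub
      (((ContDiff.sum fun l _ => (hre l).mul (him l)).div_const u).mul (Complex.reCLM.contDiff.comp
      ((contDiff_piLp_apply 2).comp (contDiff_fst.comp contDiff_snd))))

theorem contDiff_chartScale (hu : 0 < u) : ContDiff ℝ ∞
    fun x : CSpace k × CSpace (k + m) × CSpace (k + m) => chartScale u x.1 x.2.1 x.2.2 := by
  have hN : ContDiff ℝ ∞ fun x : CSpace k × CSpace (k + m) × CSpace (k + m) => chartNorm u x.1 :=
    (ContDiff.sum fun l _ => (Complex.imCLM.contDiff.comp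
      ((contDiff_piLp_apply 2).comp contDiff_fst)).pow 2).add contDiff_const
  have hP : ∀ x : CSpace k × CSpace (k + m) × CSpace (k + m),
      0 ≤ ∑ j, chartMom u x.1 x.2.1 x.2.2 j ^ 2 := fun x => Finset.sum_nonneg fun i _ => sq_nonneg _
  have hN0 : ∀ x : CSpace k × CSpace (k + m) × CSpace (k + m), 0 < chartNorm u x.1 :=
    fun x => chartNorm_pos hu
  refine ContDiff.sqrt (ContDiff.div (contDiff_const.add (ContDiff.sqrt (contDiff_const.add
    ((contDiff_const.mul hN).mul (ContDiff.sum fun j _ => (contDiff_chartMom j).pow 2)))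
    fun x => ?_)) (contDiff_const.mul hN) fun x => ?_) fun x => ?_
  · have := hP x; have := hN0 x; positivity
  · have := hN0 x; positivity
  · have := hP x; have := hN0 x; positivity

theorem contDiff_surgeryChart (hu : 0 < u) : ContDiff ℝ ∞ (surgeryChart (k := k) (m := m) u) := by
  refine (contDiff_piLp 2).2 fun j => ?_
  refine (Complex.ofRealCLM.contDiff.comp ((contDiff_chartScale hu).mul (contDiff_chartPos j))).add
    ((Complex.ofRealCLM.contDiff.comp ((contDiff_chartMom j).div (contDiff_chartScale hu)
      fun x => (chartScale_pos hu).ne').neg).mul contDiff_const)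

theorem continuousOn_surgeryChartInv :
    ContinuousOn (surgeryChartInv (k := k) (m := m) u) {z | 0 < tailScale k m u z} := by
  have hre : ∀ j, Continuous fun z : CSpace (k + m) => (z j).re := fun j => by fun_prop
  have him : ∀ j, Continuous fun z : CSpace (k + m) => (z j).im := fun j => by fun_prop
  have hμ : Continuous (tailScale k m u) :=
    (continuous_finsetSum _ fun i _ => ((hre _).pow 2).div_const u).sqrt
  have hq : ∀ j, ContinuousOn (fun z : CSpace (k + m) => (z j).re / tailScale k m u z)
      {z | 0 < tailScale k m u z} := fun j =>
    (hre j).continuousOn.div hμ.continuousOn fun z hz => ne_of_gt hz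
  have hc : ∀ {f : CSpace (k + m) → ℝ} {s}, ContinuousOn f s → ContinuousOn (fun z => (f z : ℂ)) s :=
    fun h => Complex.continuous_ofReal.comp_continuousOn h
  refine ContinuousOn.prodMk ?_ (ContinuousOn.prodMk ?_ ?_)
  · refine (PiLp.continuous_toLp 2 _).comp_continuousOn (continuousOn_pi.2 fun i => ?_)
    exact (hc (hμ.mul (him _)).neg.continuousOn).add ((hc (hq _)).mul continuousOn_const)
  · refine (PiLp.continuous_toLp 2 _).comp_continuousOn (continuousOn_pi.2 ?_)
    refine Fin.addCases (fun i => ?_) (fun i => ?_)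
    · simpa using continuousOn_const
    · simp only [Fin.addCases_right]
      exact hc (hq _)
  · refine (PiLp.continuous_toLp 2 _).comp_continuousOn (continuousOn_pi.2 ?_)
    refine Fin.addCases (fun i => ?_) (fun i => ?_)
    · simpa using continuousOn_const
    · simp only [Fin.addCases_right]
      refine hc (ContinuousOn.sub (hμ.mul (him _)).neg.continuousOn (ContinuousOn.mul ?_ (hq _)))
      exact ((continuous_finsetSum _ fun l _ => (hre _).mul (him _)).div_const u).continuousOn

/-- The pull-back of the symplectic form by `(Q, P, μ) ↦ μ Q - i μ⁻¹ P`, on the hypersurface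
`∑ Qⱼ Pⱼ = 0`, does not involve `μ`. -/
theorem stdOmega_scaled {n : ℕ} {Q P Q₁ P₁ Q₂ P₂ : Fin n → ℝ} {μ μ₁ μ₂ : ℝ} (hμ : 0 < μ)
    {ξ η : CSpace n} (hξr : ∀ j, (ξ j).re = μ₁ * Q j + μ * Q₁ j)
    (hξi : ∀ j, (ξ j).im = -((P₁ j * μ - P j * μ₁) / μ ^ 2))
    (hηr : ∀ j, (η j).re = μ₂ * Q j + μ * Q₂ j)
    (hηi : ∀ j, (η j).im = -((P₂ j * μ - P j * μ₂) / μ ^ 2))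
    (h₁ : ∑ j, (Q₁ j * P j + Q j * P₁ j) = 0) (h₂ : ∑ j, (Q₂ j * P j + Q j * P₂ j) = 0) :
    stdOmega ξ η = ∑ j, (P₁ j * Q₂ j - Q₁ j * P₂ j) := by
  have h : stdOmega ξ η = ∑ j, (P₁ j * Q₂ j - Q₁ j * P₂ j)
      - μ₁ / μ * ∑ j, (Q₂ j * P j + Q j * P₂ j) + μ₂ / μ * ∑ j, (Q₁ j * P j + Q j * P₁ j) := by
    simp only [stdOmega, Finset.mul_sum, ← Finset.sum_add_distrib, ← Finset.sum_sub_distrib]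
    refine Finset.sum_congr rfl fun j _ => ?_
    rw [hξr, hξi, hηr, hηi]
    field_simp
    ring
  rw [h, h₁, h₂]; ring

/-- Tangent vectors of the model tube, and their images in the chart. -/
theorem surgeryChart_velocity (hu : 0 < u) {ε : ℝ} {x ξ : CSpace k × CSpace (k + m) × CSpace (k + m)}
    (hξ : ξ ∈ tangentSet (modelTube k (coreSphere k m u) ε) x) :
    ξ.2.1 ∈ coreTangent k m x.2.1 ∧ (∀ i : Fin k, ξ.2.2 (Fin.castAdd m i) = 0) ∧
      (∀ i : Fin m, (ξ.2.2 (Fin.natAdd k i)).im = 0) ∧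
      ∃ (Q₁ P₁ : Fin (k + m) → ℝ) (μ₁ s₁ : ℝ),
        (∀ i : Fin k, Q₁ (Fin.castAdd m i) = (ξ.1 i).im ∧ P₁ (Fin.castAdd m i) = (ξ.1 i).re) ∧
        (∀ i : Fin m, Q₁ (Fin.natAdd k i) = (ξ.2.1 (Fin.natAdd k i)).re ∧
          P₁ (Fin.natAdd k i) = (ξ.2.2 (Fin.natAdd k i)).re
            - (s₁ * (x.2.1 (Fin.natAdd k i)).re
              + (∑ l, (x.1 l).re * (x.1 l).im) / u * (ξ.2.1 (Fin.natAdd k i)).re)) ∧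
        ∑ j, (Q₁ j * chartMom u x.1 x.2.1 x.2.2 j + chartPos x.1 x.2.1 j * P₁ j) = 0 ∧
        (∀ j, (fderiv ℝ (surgeryChart u) x ξ j).re
          = μ₁ * chartPos x.1 x.2.1 j + chartScale u x.1 x.2.1 x.2.2 * Q₁ j) ∧
        ∀ j, (fderiv ℝ (surgeryChart u) x ξ j).im
          = -((P₁ j * chartScale u x.1 x.2.1 x.2.2 - chartMom u x.1 x.2.1 x.2.2 j * μ₁)
            / chartScale u x.1 x.2.1 x.2.2 ^ 2) := by
  obtain ⟨c, hcs, rfl, hc, hd⟩ := hξ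
  have hd1 : HasDerivAt (fun t => (c t).1) ξ.1 0 := hd.prod_fst
  have hd2 : HasDerivAt (fun t => (c t).2) ξ.2 0 := hd.prod_snd
  have hdq : HasDerivAt (fun t => (c t).2.1) ξ.2.1 0 := hd2.prod_fst
  have hdp : HasDerivAt (fun t => (c t).2.2) ξ.2.2 0 := hd2.prod_snd
  have hq : ∀ᶠ t in nhds (0 : ℝ), (c t).2.1 ∈ coreSphere k m u := hc.mono fun t ht => ht.2.1
  have hp : ∀ᶠ t in nhds (0 : ℝ), (c t).2.2 ∈ coreTangent k m (c t).2.1 := hc.mono fun t ht => by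
    rw [← tangentSet_coreSphere hu ht.2.1]; exact ht.2.2.1
  have hqc : ContDiffAt ℝ ∞ (fun t => (c t).2.1) 0 := (contDiff_fst.comp contDiff_snd).contDiffAt.comp 0 hcs
  have hv := hasDerivAt_cspace.1 hd1
  have hq' := hasDerivAt_cspace.1 hdq
  have hp' := hasDerivAt_cspace.1 hdp
  have hs : HasDerivAt (fun t => (∑ l, ((c t).1 l).re * ((c t).1 l).im) / u)
    ((∑ l, ((ξ.1 l).re * ((c 0).1 l).im + ((c 0).1 l).re * (ξ.1 l).im)) / u) 0 :=
    (HasDerivAt.fun_sum fun l _ => (hv l).re.mul (hv l).im).div_const u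
  set s₁ := (∑ l, ((ξ.1 l).re * ((c 0).1 l).im + ((c 0).1 l).re * (ξ.1 l).im)) / u
  obtain ⟨Q₁, hQ₁⟩ : ∃ Q₁ : Fin (k + m) → ℝ, Q₁ = Fin.addCases (fun i => (ξ.1 i).im)
    (fun i => (ξ.2.1 (Fin.natAdd k i)).re) := ⟨_, rfl⟩
  obtain ⟨P₁, hP₁⟩ : ∃ P₁ : Fin (k + m) → ℝ, P₁ = Fin.addCases (fun i => (ξ.1 i).re)
    (fun i => (ξ.2.2 (Fin.natAdd k i)).re - (s₁ * ((c 0).2.1 (Fin.natAdd k i)).re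
      + (∑ l, ((c 0).1 l).re * ((c 0).1 l).im) / u * (ξ.2.1 (Fin.natAdd k i)).re)) := ⟨_, rfl⟩
  have hQd : ∀ j, HasDerivAt (fun t => chartPos (c t).1 (c t).2.1 j) (Q₁ j) 0 := by
    refine Fin.addCases (fun i => ?_) (fun i => ?_)
    · simpa [hQ₁] using (hv i).im
    · simpa [hQ₁] using (hq' _).re
  have hPd : ∀ j, HasDerivAt (fun t => chartMom u (c t).1 (c t).2.1 (c t).2.2 j) (P₁ j) 0 := by
    refine Fin.addCases (fun i => ?_) (fun i => ?_)
    · simpa [hP₁] using (hv i).re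
    · simp only [chartMom_natAdd, hP₁, Fin.addCases_right]
      exact (hp' _).re.sub (hs.mul (hq' _).re)
  have hΦ : HasDerivAt (fun t => surgeryChart u (c t)) (fderiv ℝ (surgeryChart u) (c 0) ξ) 0 :=
    (((contDiff_surgeryChart hu).differentiable (by simp)) (c 0)).hasFDerivAt.comp_hasDerivAt 0 hd
  have hΦ' := hasDerivAt_cspace.1 hΦ
  obtain ⟨μ₁, hμd⟩ : ∃ μ₁, HasDerivAt (fun t => chartScale u (c t).1 (c t).2.1 (c t).2.2) μ₁ 0 :=
    ⟨_, (((contDiff_chartScale hu).differentiable (by simp)) (c 0)).hasFDerivAt.comp_hasDerivAt 0 hd⟩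
  have hμ := chartScale_pos (v := (c 0).1) (q := (c 0).2.1) (p := (c 0).2.2) hu
  refine ⟨?_, ?_, ?_, Q₁, P₁, μ₁, s₁, fun i => by simp [hQ₁, hP₁], fun i => by simp [hQ₁, hP₁], ?_,
    fun j => ?_, fun j => ?_⟩
  · rw [← tangentSet_coreSphere hu hq.self_of_nhds]
    exact ⟨_, hqc, rfl, hq, hdq⟩
  · exact fun i => (hp' _).eq_zero_of_eventually_const (hp.mono fun t ht => ht.1 i)
  · exact fun i => (hp' _).im.eq_zero_of_eventually_const (hp.mono fun t ht => ht.2.1 i)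
  · exact (HasDerivAt.fun_sum fun j _ => (hQd j).mul (hPd j)).eq_zero_of_eventually_const
      (a := 0) ((hq.and hp).mono fun t ht => sum_chartPos_mul_chartMom hu ht.1 ht.2)
  · refine (hΦ' j).re.unique ((hμd.mul (hQd j)).congr_of_eventuallyEq ?_)
    exact Filter.Eventually.of_forall fun t => surgeryChart_re j
  · refine (hΦ' j).im.unique (((hPd j).div hμd hμ.ne').neg.congr_of_eventuallyEq ?_)
    exact Filter.Eventually.of_forall fun t => surgeryChart_im j

theorem surgeryChart_symplectic (hu : 0 < u) {ε : ℝ}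
    {x ξ η : CSpace k × CSpace (k + m) × CSpace (k + m)}
    (hξ : ξ ∈ tangentSet (modelTube k (coreSphere k m u) ε) x)
    (hη : η ∈ tangentSet (modelTube k (coreSphere k m u) ε) x) :
    stdOmega (fderiv ℝ (surgeryChart u) x ξ) (fderiv ℝ (surgeryChart u) x η) = modelOmega ξ η := by
  obtain ⟨hξq, hξp, hξp', Q₁, P₁, μ₁, s₁, h1, h2, h3, h4, h5⟩ := surgeryChart_velocity hu hξ
  obtain ⟨hηq, hηp, hηp', Q₂, P₂, μ₂, s₂, g1, g2, g3, g4, g5⟩ := surgeryChart_velocity hu hη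
  rw [stdOmega_scaled (chartScale_pos hu) h4 h5 g4 g5 h3 g3, Fin.sum_univ_add, modelOmega, stdOmega]
  congr 1
  · exact Finset.sum_congr rfl fun i _ => by
      rw [(h1 i).1, (h1 i).2, (g1 i).1, (g1 i).2]
  · have hinner : ∀ {a b : CSpace (k + m)}, (∀ i : Fin k, a (Fin.castAdd m i) = 0) →
        (∀ i : Fin m, (a (Fin.natAdd k i)).im = 0) → (inner ℂ a b).re
          = ∑ i : Fin m, (a (Fin.natAdd k i)).re * (b (Fin.natAdd k i)).re := by
      intro a b ha1 ha2
      rw [PiLp.inner_apply, Complex.re_sum, Fin.sum_univ_add]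
      simp [ha1, ha2, mul_comm]
    rw [hinner hξp hξp', hinner hηp hηp']
    have h6 := hξq.2.2
    have h7 := hηq.2.2
    have h8 : ∑ i : Fin m, (P₁ (Fin.natAdd k i) * Q₂ (Fin.natAdd k i)
        - Q₁ (Fin.natAdd k i) * P₂ (Fin.natAdd k i)) =
        ∑ i : Fin m, (ξ.2.2 (Fin.natAdd k i)).re * (η.2.1 (Fin.natAdd k i)).re
        - ∑ i : Fin m, (η.2.2 (Fin.natAdd k i)).re * (ξ.2.1 (Fin.natAdd k i)).re
        - s₁ * ∑ i : Fin m, (x.2.1 (Fin.natAdd k i)).re * (η.2.1 (Fin.natAdd k i)).re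
        + s₂ * ∑ i : Fin m, (x.2.1 (Fin.natAdd k i)).re * (ξ.2.1 (Fin.natAdd k i)).re := by
      simp only [Finset.mul_sum, ← Finset.sum_add_distrib, ← Finset.sum_sub_distrib]
      refine Finset.sum_congr rfl fun i _ => ?_
      rw [(h2 i).1, (h2 i).2, (g2 i).1, (g2 i).2]; ring
    rw [h8, h6, h7]; ring

theorem mem_modelTube_core (hu : 0 < u) {ε : ℝ} {x : CSpace k × CSpace (k + m) × CSpace (k + m)} :
    x ∈ modelTube k (coreSphere k m u) ε ↔ ‖x.1‖ < ε ∧ x.2.1 ∈ coreSphere k m u ∧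
      x.2.2 ∈ coreTangent k m x.2.1 ∧ ‖x.2.2‖ < ε := by
  constructor
  · rintro ⟨h1, h2, h3, h4⟩
    exact ⟨h1, h2, by rwa [tangentSet_coreSphere hu h2] at h3, h4⟩
  · rintro ⟨h1, h2, h3, h4⟩
    exact ⟨h1, h2, by rwa [tangentSet_coreSphere hu h2], h4⟩

theorem isCompact_coreSphere : IsCompact (coreSphere k m u) := by
  have hcl : IsClosed (coreSphere k m u) := by
    have : coreSphere k m u = (⋂ i : Fin k, {q | q (Fin.castAdd m i) = 0}) ∩
        ((⋂ i : Fin m, {q | (q (Fin.natAdd k i)).im = 0}) ∩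
        {q | ∑ i : Fin m, (q (Fin.natAdd k i)).re ^ 2 = u}) := by
      ext q; simp [coreSphere]
    rw [this]
    refine (isClosed_iInter fun i => isClosed_eq (by fun_prop) (by fun_prop)).inter
      ((isClosed_iInter fun i => isClosed_eq (by fun_prop) (by fun_prop)).inter
      (isClosed_eq (by fun_prop) (by fun_prop)))
  refine Metric.isCompact_of_isClosed_isBounded hcl (isBounded_iff_forall_norm_le.2 ⟨√u, ?_⟩)
  rintro q ⟨h1, h2, h3⟩
  refine Real.le_sqrt_of_sq_le (le_of_eq ?_)
  rw [EuclideanSpace.norm_sq_eq, Fin.sum_univ_add, ← h3]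
  simp only [← Complex.normSq_eq_norm_sq, Complex.normSq_apply, h1, h2]
  simp [sq]

theorem isSurgeryChart (hu : 0 < u) {ε : ℝ} (hε : 0 < ε) :
    IsSurgeryChart k (quadFiber (k + m) (u : ℂ)) (realLevel (k + m) k u) (vanishingCycle (k + m) u) ε
      (surgeryChart u) := by
  have key : realLevel (k + m) k u ∩ vanishingCycle (k + m) u = coreSphere k m u :=
    realLevel_inter_vanishingCycle
  constructor
  · exact hε
  · rw [key]; exact isCompact_coreSphere
  · exact ⟨Set.univ, isOpen_univ, Set.subset_univ _, (contDiff_surgeryChart hu).contDiffOn⟩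
  · rw [key]
    intro x hx y hy h
    rw [mem_modelTube_core hu] at hx hy
    have h' := congrArg (surgeryChartInv u) h
    rwa [surgeryChartInv_surgeryChart hu hx.2.1 hx.2.2.1,
      surgeryChartInv_surgeryChart hu hy.2.1 hy.2.2.1] at h'
  · rw [key]
    have hpos : IsOpen {z : CSpace (k + m) | 0 < tailScale k m u z} := by
      refine isOpen_lt continuous_const ?_
      exact (continuous_finsetSum _ fun i _ => by fun_prop).sqrt
    refine ⟨{z | 0 < tailScale k m u z} ∩ surgeryChartInv u ⁻¹' {x | ‖x.1‖ < ε ∧ ‖x.2.2‖ < ε},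
      continuousOn_surgeryChartInv.isOpen_inter_preimage hpos ?_, ?_⟩
    · exact (isOpen_lt continuous_fst.norm continuous_const).inter
        (isOpen_lt continuous_snd.snd.norm continuous_const)
    · ext z
      constructor
      · rintro ⟨⟨v, q, p⟩, hx, rfl⟩
        rw [mem_modelTube_core hu] at hx
        refine ⟨surgeryChart_mem hu hx.2.1 hx.2.2.1, ?_, ?_⟩
        · rw [Set.mem_ofPred_eq, tailScale_surgeryChart hu hx.2.1]
          exact chartScale_pos hu
        · rw [Set.mem_preimage, surgeryChartInv_surgeryChart hu hx.2.1 hx.2.2.1]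
          exact ⟨hx.1, hx.2.2.2⟩
      · rintro ⟨hz, hz0, hz1, hz2⟩
        obtain ⟨h1, h2, h3⟩ := surgeryChartInv_mem hu hz hz0
        exact ⟨_, (mem_modelTube_core hu).2 ⟨hz1, h1, h2, hz2⟩, h3⟩
  · rw [key]
    exact fun x _ ξ hξ η hη => surgeryChart_symplectic hu hξ hη
  · rw [key]
    exact fun q hq => surgeryChart_zero_section hu hq
  · rw [key]
    intro x hx
    rw [mem_modelTube_core hu] at hx
    exact surgeryChart_mem_realLevel_iff hu hx.2.1 hx.2.2.1
  · rw [key]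
    intro x hx
    rw [mem_modelTube_core hu] at hx
    exact surgeryChart_mem_vanishingCycle_iff hu hx.2.1 hx.2.2.1

end ChartInverse

/-! ### Existence of profile curves -/

theorem smoothTransition_add_reflect (x : ℝ) :
    Real.smoothTransition x + Real.smoothTransition (1 - x) = 1 := by
  have h := (Real.smoothTransition.pos_denom x).ne'
  rw [Real.smoothTransition, Real.smoothTransition, sub_sub_cancel,
    add_comm (expNegInvGlue (1 - x)), ← add_div, div_self h]

/-- A smooth nondecreasing function which vanishes up to `-δ` and is the identity from `δ` on. -/
theorem exists_smooth_ramp {δ : ℝ} (hδ : 0 < δ) : ∃ g χ : ℝ → ℝ, ContDiff ℝ ∞ g ∧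
    (∀ s, HasDerivAt g (χ s) s) ∧ (∀ s, 0 ≤ χ s) ∧ (∀ s, χ s + χ (-s) = 1) ∧
    (∀ s, s ≤ -δ → g s = 0) ∧ (∀ s, δ ≤ s → g s = s) ∧ ∀ s, -δ < s → 0 < g s := by
  let χ : ℝ → ℝ := fun t => Real.smoothTransition ((t + δ) / (2 * δ))
  have hχ : ContDiff ℝ ∞ χ := Real.smoothTransition.contDiff.comp (by fun_prop)
  let g : ℝ → ℝ := fun s => ∫ t in (-δ)..s, χ t
  have hd : ∀ s, HasDerivAt g (χ s) s := fun s =>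
    intervalIntegral.integral_hasDerivAt_right (hχ.continuous.intervalIntegrable _ _)
      (hχ.continuous.stronglyMeasurableAtFilter _ _) hχ.continuous.continuousAt
  have hsum : ∀ s, χ s + χ (-s) = 1 := fun s => by
    rw [← smoothTransition_add_reflect ((s + δ) / (2 * δ))]
    simp only [χ]
    congr 2
    field_simp
    ring
  have hzero : ∀ s, s ≤ -δ → g s = 0 := by
    intro s hs
    refine intervalIntegral.integral_zero_ae (Filter.Eventually.of_forall fun t ht => ?_)
    rw [Set.uIoc_of_ge hs] at ht
    exact Real.smoothTransition.zero_of_nonpos (div_nonpos_of_nonpos_of_nonneg (by linarith [ht.2])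
      (by positivity))
  have hodd : ∀ s, g s - g (-s) - s = 0 := by
    have h : ∀ s, HasDerivAt (fun s => g s - g (-s) - s) 0 s := fun s => by
      have h1 := ((hd s).sub ((hd (-s)).comp s (hasDerivAt_neg s))).sub (hasDerivAt_id s)
      refine h1.congr_deriv ?_
      linarith [hsum s]
    intro s
    have := is_const_of_deriv_eq_zero (fun s => (h s).differentiableAt) (fun s => (h s).deriv) s 0
    simpa using this
  refine ⟨g, χ, ?_, hd, fun s => Real.smoothTransition.nonneg _, hsum, hzero, fun s hs => ?_,
    fun s hs => ?_⟩
  · rw [contDiff_infty_iff_deriv]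
    refine ⟨fun s => (hd s).differentiableAt, ?_⟩
    rwa [show deriv g = χ from funext fun s => (hd s).deriv]
  · have := hodd s
    rw [hzero (-s) (by linarith)] at this
    linarith
  · refine intervalIntegral.intervalIntegral_pos_of_pos_on (hχ.continuous.intervalIntegrable _ _)
      (fun t ht => Real.smoothTransition.pos_of_pos ?_) hs
    have := ht.1
    exact div_pos (by linarith) (by positivity)

theorem exists_rightHandedProfile {ε : ℝ} (hε : 0 < ε) :
    ∃ δ γ, IsRightHandedProfile ε δ γ := by
  obtain ⟨g, χ, hg, hd, hχ, hsum, hzero, hid, hpos⟩ := exists_smooth_ramp (half_pos hε)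
  have hmono : Monotone g := monotone_of_deriv_nonneg (fun s => (hd s).differentiableAt)
    fun s => by rw [(hd s).deriv]; exact hχ s
  let γ : ℝ → ℂ := fun s => (g s : ℂ) + (g (-s) : ℂ) * Complex.I
  have hre : ∀ s, (γ s).re = g s := fun s => by simp [γ]
  have him : ∀ s, (γ s).im = g (-s) := fun s => by simp [γ]
  have hγ : ∀ s, deriv γ s = (χ s : ℂ) + ((-χ (-s) : ℝ) : ℂ) * Complex.I := by
    intro s
    have h2 : HasDerivAt (fun s => g (-s)) (-χ (-s)) s :=
      ((hd (-s)).comp s (hasDerivAt_neg s)).congr_deriv (mul_neg_one _)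
    exact ((hd s).ofReal_comp.add (h2.ofReal_comp.mul_const Complex.I)).deriv
  refine ⟨ε / 2, γ, half_pos hε, half_lt_self hε, ?_, fun s hs => ?_, fun s hs => ?_,
    fun s hs => ⟨?_, ?_, ?_⟩, fun s hs => ⟨?_, ?_, ?_⟩⟩
  · exact (Complex.ofRealCLM.contDiff.comp hg).add
      ((Complex.ofRealCLM.contDiff.comp (hg.comp contDiff_neg)).mul contDiff_const)
  · simp [γ, hid s hs, hzero (-s) (by linarith)]
  · simp [γ, hzero s hs, hid (-s) (by linarith)]
  · rw [hre]; exact hpos s (by linarith [(abs_lt.1 hs).1])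
  · rw [him]; exact hpos (-s) (by linarith [(abs_lt.1 hs).2])
  · have h1 := hmono (abs_lt.1 hs).2.le
    have h2 := hmono (neg_le.1 (abs_lt.1 hs).1.le)
    rw [hid _ le_rfl] at h1 h2
    have h3 := hpos s (by linarith [(abs_lt.1 hs).1])
    have h4 := hpos (-s) (by linarith [(abs_lt.1 hs).2])
    refine lt_of_pow_lt_pow_left₀ 2 hε.le ?_
    rw [← Complex.normSq_eq_norm_sq, Complex.normSq_apply, hre, him]
    nlinarith
  · rw [hγ]; simpa using hχ s
  · rw [hγ]; simpa using hχ (-s)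
  · intro h
    have h1 := congrArg Complex.re h
    have h2 := congrArg Complex.im h
    rw [hγ] at h1 h2
    simp at h1 h2
    linarith [hsum s]

/-! ### Rotationally symmetric Lagrangians -/

section Twist
variable {k m : ℕ} {u : ℝ}

/-- The squared norm of the first `k` coordinates. -/
def headSq (k m : ℕ) (w : Fin (k + m) → ℝ) : ℝ := ∑ i : Fin k, w (Fin.castAdd m i) ^ 2

/-- The squared norm of the last `m` coordinates. -/
def tailSq (k m : ℕ) (w : Fin (k + m) → ℝ) : ℝ := ∑ i : Fin m, w (Fin.natAdd k i) ^ 2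

/-- The hyperboloid `|y|² = |x|² + u`, where `w = (y, x)`. -/
def hyperboloid (k m : ℕ) (u : ℝ) : Set (Fin (k + m) → ℝ) := {w | headSq k m w = tailSq k m w + u}

/-- The vector `(a y, b x)` of `ℂⁿ`, where `w = (y, x)`. -/
def twist (a b : ℂ) (w : Fin (k + m) → ℝ) : CSpace (k + m) :=
  WithLp.toLp 2 (Fin.addCases (fun i => a * w (Fin.castAdd m i)) fun i => b * w (Fin.natAdd k i))

@[simp] theorem twist_castAdd (a b : ℂ) (w : Fin (k + m) → ℝ) (i : Fin k) :
    twist a b w (Fin.castAdd m i) = a * w (Fin.castAdd m i) := by simp [twist]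

@[simp] theorem twist_natAdd (a b : ℂ) (w : Fin (k + m) → ℝ) (i : Fin m) :
    twist a b w (Fin.natAdd k i) = b * w (Fin.natAdd k i) := by simp [twist]

theorem tailSq_nonneg (w : Fin (k + m) → ℝ) : 0 ≤ tailSq k m w :=
  Finset.sum_nonneg fun _ _ => sq_nonneg _

theorem quadH_twist (a b : ℂ) (w : Fin (k + m) → ℝ) :
    quadH (twist a b w) = a ^ 2 * headSq k m w + b ^ 2 * tailSq k m w := by
  rw [quadH, Fin.sum_univ_add, headSq, tailSq]
  simp [mul_pow, Finset.mul_sum]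

theorem norm_sq_twist (a b : ℂ) (w : Fin (k + m) → ℝ) : ‖twist a b w‖ ^ 2
    = Complex.normSq a * headSq k m w + Complex.normSq b * tailSq k m w := by
  rw [EuclideanSpace.norm_sq_eq, Fin.sum_univ_add, headSq, tailSq]
  simp [mul_pow, Finset.mul_sum, Complex.normSq_eq_norm_sq]

/-- The first coefficient of the transported Lagrangian. -/
def transportA (u t : ℝ) : ℂ := -angleCos u t + Complex.I * (angleSinc u t * t : ℝ)

/-- The second coefficient of the transported Lagrangian. -/
def transportB (u t : ℝ) : ℂ := (angleSinc u t * (t + u) : ℝ) + Complex.I * angleCos u t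

/-- The parametrization by the hyperboloid of the image of `Q_{k,-u}` under parallel transport. -/
def transportMap (u : ℝ) (w : Fin (k + m) → ℝ) : CSpace (k + m) :=
  twist (transportA u (tailSq k m w)) (transportB u (tailSq k m w)) w

/-- The image of `Q_{k,-u}` under parallel transport along the half circle; see `image_realLevel`. -/
def transportLag (k m : ℕ) (u : ℝ) : Set (CSpace (k + m)) := transportMap u '' hyperboloid k m u

/-- The parameter `t = |x|²` on the transported Lagrangian, as a function of `|z|² = 2t + u`. -/
def tailParam (u : ℝ) (z : CSpace (k + m)) : ℝ := (‖z‖ ^ 2 - u) / 2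

/-- A left inverse of `transportMap`. -/
def transportInv (u : ℝ) (z : CSpace (k + m)) : Fin (k + m) → ℝ :=
  let t := tailParam u z
  Fin.addCases
    (fun i => angleSinc u t * (t + u) * (z (Fin.castAdd m i)).im - angleCos u t * (z (Fin.castAdd m i)).re)
    fun i => angleSinc u t * t * (z (Fin.natAdd k i)).re + angleCos u t * (z (Fin.natAdd k i)).im

theorem halfTransport_twist {w : Fin (k + m) → ℝ} (hw : w ∈ hyperboloid k m u) :
    halfTransport u (twist Complex.I 1 w) = transportMap u w := by
  have hn : ‖twist Complex.I 1 w‖ ^ 2 = 2 * tailSq k m w + u := by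
    rw [norm_sq_twist, show headSq k m w = _ from hw]; simp; ring
  have ht : (‖twist Complex.I 1 w‖ ^ 2 - u) / 2 = tailSq k m w := by rw [hn]; ring
  ext j
  simp only [halfTransport, ht, transportMap]
  refine Fin.addCases (fun i => ?_) (fun i => ?_) j
  · simp only [twist_castAdd, transportA, map_mul, Complex.conj_I, Complex.conj_ofReal]
    push_cast
    linear_combination (angleCos u (tailSq k m w) * w (Fin.castAdd m i) : ℂ) * Complex.I_sq
  · simp only [twist_natAdd, transportB, map_mul, map_one, Complex.conj_ofReal]
    push_cast
    ring

theorem image_realLevel : halfTransport u '' realLevel (k + m) k (-u) = transportLag k m u := by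
  have h : realLevel (k + m) k (-u) = twist Complex.I 1 '' hyperboloid k m u := by
    ext z
    constructor
    · rintro ⟨h1, h2⟩
      rw [mem_realPlane_iff] at h2
      let w : Fin (k + m) → ℝ := Fin.addCases (fun i => (z (Fin.castAdd m i)).im)
        fun i => (z (Fin.natAdd k i)).re
      have hz : twist Complex.I 1 w = z := by
        ext j
        refine Fin.addCases (fun i => ?_) (fun i => ?_) j
        · rw [twist_castAdd]
          exact Complex.ext (by simp [h2.1]) (by simp [w])
        · rw [twist_natAdd]
          exact Complex.ext (by simp [w]) (by simp [h2.2])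
      refine ⟨w, ?_, hz⟩
      have h3 : quadH (twist Complex.I 1 w) = ((-u : ℝ) : ℂ) := by rw [hz]; exact h1
      rw [quadH_twist, Complex.I_sq] at h3
      have h4 : -1 * headSq k m w + 1 ^ 2 * tailSq k m w = -u := by exact_mod_cast h3
      change headSq k m w = _
      linarith
    · rintro ⟨w, hw, rfl⟩
      have hw' : headSq k m w = tailSq k m w + u := hw
      refine ⟨?_, mem_realPlane_iff.2 ⟨fun i => by simp, fun i => by simp⟩⟩
      change quadH _ = _
      rw [quadH_twist, hw', Complex.I_sq]
      push_cast; ring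
  rw [h, Set.image_image, transportLag]
  exact Set.image_congr fun w hw => halfTransport_twist hw

theorem norm_sq_transportMap (hu : 0 < u) {w : Fin (k + m) → ℝ} (hw : w ∈ hyperboloid k m u) :
    ‖transportMap u w‖ ^ 2 = 2 * tailSq k m w + u := by
  have h := angle_identity hu (tailSq_nonneg w)
  rw [transportMap, norm_sq_twist, show headSq k m w = _ from hw]
  simp only [transportA, transportB, Complex.normSq_apply]
  simp
  linear_combination (2 * tailSq k m w + u) * h

theorem tailParam_transportMap (hu : 0 < u) {w : Fin (k + m) → ℝ} (hw : w ∈ hyperboloid k m u) :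
    tailParam u (transportMap u w) = tailSq k m w := by
  rw [tailParam, norm_sq_transportMap hu hw]; ring

theorem transportInv_transportMap (hu : 0 < u) {w : Fin (k + m) → ℝ} (hw : w ∈ hyperboloid k m u) :
    transportInv u (transportMap u w) = w := by
  have h := angle_identity hu (tailSq_nonneg w)
  simp only [transportInv, tailParam_transportMap hu hw]
  simp only [transportMap, transportA, transportB]
  ext j
  refine Fin.addCases (fun i => ?_) (fun i => ?_) j
  · simp
    linear_combination w (Fin.castAdd m i) * h
  · simp
    linear_combination w (Fin.natAdd k i) * h

theorem mem_transportLag (hu : 0 < u) {z : CSpace (k + m)} (hz : z ∈ transportLag k m u) :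
    transportInv u z ∈ hyperboloid k m u ∧ transportMap u (transportInv u z) = z ∧
      tailParam u z = tailSq k m (transportInv u z) ∧ z ≠ 0 := by
  obtain ⟨w, hw, rfl⟩ := hz
  rw [transportInv_transportMap hu hw]
  refine ⟨hw, rfl, tailParam_transportMap hu hw, fun h => ?_⟩
  have h1 := norm_sq_transportMap hu hw
  rw [h, norm_zero] at h1
  have := tailSq_nonneg w
  norm_num at h1
  linarith

theorem transportLag_subset (hu : 0 < u) : transportLag k m u ⊆ quadFiber (k + m) (u : ℂ) := by
  rintro _ ⟨w, hw, rfl⟩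
  change quadH _ = _
  have h : ((angleCos u (tailSq k m w) ^ 2 + angleSinc u (tailSq k m w) ^ 2
      * (tailSq k m w * (tailSq k m w + u)) : ℝ) : ℂ) = 1 := by
    rw [angle_identity hu (tailSq_nonneg w), Complex.ofReal_one]
  rw [transportMap, quadH_twist, show headSq k m w = _ from hw, transportA, transportB]
  push_cast at h ⊢
  have hI := Complex.I_sq
  linear_combination u * h + ((angleSinc u (tailSq k m w) : ℂ) ^ 2 * (tailSq k m w) ^ 2 * (tailSq k m w + u)
     + (angleCos u (tailSq k m w) : ℂ) ^ 2 * tailSq k m w) * hI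

theorem contDiffAt_tailParam (z : CSpace (k + m)) : ContDiffAt ℝ ∞ (tailParam u) z :=
  (((contDiff_norm_sq ℂ).sub contDiff_const).div_const 2).contDiffAt

theorem two_mul_tailParam_add_pos {z : CSpace (k + m)} (hz : z ≠ 0) : 0 < 2 * tailParam u z + u := by
  have := pow_pos (norm_pos_iff.2 hz) 2
  unfold tailParam; linarith

theorem contDiffAt_transportInv {z : CSpace (k + m)} (hz : z ≠ 0) :
    ContDiffAt ℝ ∞ (transportInv u) z := by
  have ht := contDiffAt_tailParam (u := u) z
  have hK := (contDiffAt_angleSinc (two_mul_tailParam_add_pos (u := u) hz)).comp z ht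
  have hC := (contDiffAt_angleCos (two_mul_tailParam_add_pos (u := u) hz)).comp z ht
  have hre : ∀ j, ContDiffAt ℝ ∞ (fun z : CSpace (k + m) => (z j).re) z := fun j =>
    (Complex.reCLM.contDiff.comp (contDiff_piLp_apply 2)).contDiffAt
  have him : ∀ j, ContDiffAt ℝ ∞ (fun z : CSpace (k + m) => (z j).im) z := fun j =>
    (Complex.imCLM.contDiff.comp (contDiff_piLp_apply 2)).contDiffAt
  refine contDiffAt_pi.2 (Fin.addCases (fun i => ?_) (fun i => ?_))
  · simp only [transportInv, Fin.addCases_left]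
    exact ((hK.mul (ht.add contDiffAt_const)).mul (him _)).sub (hC.mul (hre _))
  · simp only [transportInv, Fin.addCases_right]
    exact ((hK.mul ht).mul (hre _)).add (hC.mul (him _))

theorem contDiff_tailSq : ContDiff ℝ ∞ (tailSq k m) :=
  ContDiff.sum fun _ _ => (contDiff_apply ℝ ℝ _).pow 2

theorem contDiffAt_transportA {t : ℝ} (ht : 0 < 2 * t + u) : ContDiffAt ℝ ∞ (transportA u) t :=
  (Complex.ofRealCLM.contDiff.contDiffAt.comp t (contDiffAt_angleCos ht)).neg.add
    (contDiffAt_const.mul (Complex.ofRealCLM.contDiff.contDiffAt.comp t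
      ((contDiffAt_angleSinc ht).mul contDiffAt_id)))

theorem contDiffAt_transportB {t : ℝ} (ht : 0 < 2 * t + u) : ContDiffAt ℝ ∞ (transportB u) t :=
  (Complex.ofRealCLM.contDiff.contDiffAt.comp t
    ((contDiffAt_angleSinc ht).mul (contDiffAt_id.add contDiffAt_const))).add
    (contDiffAt_const.mul (Complex.ofRealCLM.contDiff.contDiffAt.comp t (contDiffAt_angleCos ht)))

theorem contDiffAt_twist {E : Type*} [NormedAddCommGroup E] [NormedSpace ℝ E] {a b : E → ℂ}
    {w : E → Fin (k + m) → ℝ} {x : E} (ha : ContDiffAt ℝ ∞ a x) (hb : ContDiffAt ℝ ∞ b x)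
    (hw : ContDiffAt ℝ ∞ w x) : ContDiffAt ℝ ∞ (fun x => twist (a x) (b x) (w x)) x := by
  have hw' : ∀ j, ContDiffAt ℝ ∞ (fun x => ((w x j : ℝ) : ℂ)) x := fun j =>
    Complex.ofRealCLM.contDiff.contDiffAt.comp x (contDiffAt_pi.1 hw j)
  refine (contDiffAt_piLp 2).2 (Fin.addCases (fun i => ?_) (fun i => ?_))
  · simp only [twist_castAdd]
    exact ha.mul (hw' _)
  · simp only [twist_natAdd]
    exact hb.mul (hw' _)

end Twist

/-! ### Velocities of rotationally symmetric families -/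

section Velocity
variable {k m : ℕ} {u : ℝ}

/-- `ξ` is the velocity of a curve `twist (a t) (b t) w`, where `w = (y, x)` moves on a hyperboloid
with velocity `w₁`, `t = |x|²` has the derivative `t₁`, and `a'`, `b'` are the derivatives of the
coefficients with respect to `t`. -/
structure IsTwistVelocity (a b a' b' : ℂ) (w w₁ : Fin (k + m) → ℝ) (t₁ : ℝ) (ξ : CSpace (k + m)) :
    Prop where
  head_sum : ∑ i : Fin k, w (Fin.castAdd m i) * w₁ (Fin.castAdd m i) = t₁ / 2
  tail_sum : ∑ i : Fin m, w (Fin.natAdd k i) * w₁ (Fin.natAdd k i) = t₁ / 2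
  head : ∀ i : Fin k, ξ (Fin.castAdd m i) = a' * t₁ * w (Fin.castAdd m i) + a * w₁ (Fin.castAdd m i)
  tail : ∀ i : Fin m, ξ (Fin.natAdd k i) = b' * t₁ * w (Fin.natAdd k i) + b * w₁ (Fin.natAdd k i)

theorem im_conj_sum {ι : Type*} [Fintype ι] (a a' : ℂ) (w w₁ w₂ : ι → ℝ) (t₁ t₂ : ℝ)
    (h₁ : ∑ i, w i * w₁ i = t₁ / 2) (h₂ : ∑ i, w i * w₂ i = t₂ / 2) :
    (∑ i, conj (a' * t₁ * w i + a * w₁ i) * (a' * t₂ * w i + a * w₂ i)).im = 0 := by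
  have h : ∑ i, conj (a' * t₁ * w i + a * w₁ i) * (a' * t₂ * w i + a * w₂ i)
      = conj a' * a' * ((t₁ * t₂ * ∑ i, w i ^ 2 : ℝ) : ℂ) + conj a' * a * ((t₁ * ∑ i, w i * w₂ i : ℝ) : ℂ)
        + conj a * a' * ((t₂ * ∑ i, w i * w₁ i : ℝ) : ℂ) + conj a * a * ((∑ i, w₁ i * w₂ i : ℝ) : ℂ) := by
    push_cast
    simp only [Finset.mul_sum, ← Finset.sum_add_distrib]
    refine Finset.sum_congr rfl fun i _ => ?_
    simp only [map_add, map_mul, Complex.conj_ofReal]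
    ring
  rw [h, h₁, h₂]
  simp only [Complex.add_im, Complex.mul_im, Complex.mul_re, Complex.conj_re, Complex.conj_im,
    Complex.ofReal_re, Complex.ofReal_im]
  ring

/-- Rotationally symmetric submanifolds are Lagrangian. -/
theorem IsTwistVelocity.stdOmega_eq_zero {a b a' b' : ℂ} {w w₁ w₂ : Fin (k + m) → ℝ} {t₁ t₂ : ℝ}
    {ξ η : CSpace (k + m)} (hξ : IsTwistVelocity a b a' b' w w₁ t₁ ξ)
    (hη : IsTwistVelocity a b a' b' w w₂ t₂ η) : stdOmega ξ η = 0 := by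
  rw [stdOmega_eq, Fin.sum_univ_add, Complex.add_im]
  simp only [hξ.head, hξ.tail, hη.head, hη.tail]
  rw [im_conj_sum a a' _ _ _ t₁ t₂ hξ.head_sum hη.head_sum,
    im_conj_sum b b' _ _ _ t₁ t₂ hξ.tail_sum hη.tail_sum, add_zero]

theorem IsTwistVelocity.stdLambda_eq {a b a' b' : ℂ} {w w₁ : Fin (k + m) → ℝ} {t₁ : ℝ}
    {ξ : CSpace (k + m)} (hξ : IsTwistVelocity a b a' b' w w₁ t₁ ξ) :
    stdLambda (twist a b w) ξ
      = (1 / 2) * ((conj a * a').im * headSq k m w + (conj b * b').im * tailSq k m w) * t₁ := by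
  have key : ∀ (a a' : ℂ) (x x₁ : ℝ), (a * x).re * (a' * t₁ * x + a * x₁).im
      - (a * x).im * (a' * t₁ * x + a * x₁).re = (conj a * a').im * t₁ * x ^ 2 := by
    intro a a' x x₁
    simp only [Complex.add_im, Complex.add_re, Complex.mul_im, Complex.mul_re, Complex.conj_re,
      Complex.conj_im, Complex.ofReal_re, Complex.ofReal_im]
    ring
  rw [stdLambda, Fin.sum_univ_add]
  simp only [hξ.head, hξ.tail, twist_castAdd, twist_natAdd, key, ← Finset.mul_sum]
  rw [headSq, tailSq]
  ring

/-- A twist is an immersion when its coefficients do not vanish and the lengths of its two parts do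
not have vanishing derivatives simultaneously. -/
theorem IsTwistVelocity.eq_zero {a b a' b' : ℂ} {w w₁ : Fin (k + m) → ℝ} {t₁ : ℝ}
    (hξ : IsTwistVelocity a b a' b' w w₁ t₁ 0) (ha : a ≠ 0) (hb : b ≠ 0)
    (h : 0 < tailSq k m w → 2 * headSq k m w * a' + a = 0 → 2 * tailSq k m w * b' + b = 0 → False) :
    t₁ = 0 ∧ w₁ = 0 := by
  have hh : ∀ i : Fin k, a' * t₁ * w (Fin.castAdd m i) + a * w₁ (Fin.castAdd m i) = 0 :=
    fun i => (hξ.head i).symm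
  have ht : ∀ i : Fin m, b' * t₁ * w (Fin.natAdd k i) + b * w₁ (Fin.natAdd k i) = 0 :=
    fun i => (hξ.tail i).symm
  have ht₁ : t₁ = 0 := by
    by_contra hne
    have hne' : (t₁ : ℂ) ≠ 0 := by exact_mod_cast hne
    -- Scalar products of the two parts of the equation with the two parts of `w`.
    have h1 : t₁ * (2 * headSq k m w * a' + a) = 0 := by
      have hs : ((∑ i : Fin k, w (Fin.castAdd m i) * w₁ (Fin.castAdd m i) : ℝ) : ℂ)
          = ((t₁ / 2 : ℝ) : ℂ) := by rw [hξ.head_sum]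
      have h0 : ∑ i : Fin k, (w (Fin.castAdd m i) : ℂ)
          * (a' * t₁ * w (Fin.castAdd m i) + a * w₁ (Fin.castAdd m i)) = 0 := by simp [hh]
      have h2 : ∑ i : Fin k, (w (Fin.castAdd m i) : ℂ)
          * (a' * t₁ * w (Fin.castAdd m i) + a * w₁ (Fin.castAdd m i)) = a' * t₁ * headSq k m w
          + a * ((∑ i : Fin k, w (Fin.castAdd m i) * w₁ (Fin.castAdd m i) : ℝ) : ℂ) := by
        rw [headSq]; push_cast
        simp only [Finset.mul_sum, ← Finset.sum_add_distrib]
        exact Finset.sum_congr rfl fun i _ => by ring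
      rw [h2, hs] at h0
      push_cast at h0
      linear_combination 2 * h0
    have h3 : t₁ * (2 * tailSq k m w * b' + b) = 0 := by
      have hs : ((∑ i : Fin m, w (Fin.natAdd k i) * w₁ (Fin.natAdd k i) : ℝ) : ℂ)
          = ((t₁ / 2 : ℝ) : ℂ) := by rw [hξ.tail_sum]
      have h0 : ∑ i : Fin m, (w (Fin.natAdd k i) : ℂ)
          * (b' * t₁ * w (Fin.natAdd k i) + b * w₁ (Fin.natAdd k i)) = 0 := by simp [ht]
      have h2 : ∑ i : Fin m, (w (Fin.natAdd k i) : ℂ)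
          * (b' * t₁ * w (Fin.natAdd k i) + b * w₁ (Fin.natAdd k i)) = b' * t₁ * tailSq k m w
          + b * ((∑ i : Fin m, w (Fin.natAdd k i) * w₁ (Fin.natAdd k i) : ℝ) : ℂ) := by
        rw [tailSq]; push_cast
        simp only [Finset.mul_sum, ← Finset.sum_add_distrib]
        exact Finset.sum_congr rfl fun i _ => by ring
      rw [h2, hs] at h0
      push_cast at h0
      linear_combination 2 * h0
    refine h ((tailSq_nonneg w).lt_of_ne fun h0 => hne ?_) ((mul_eq_zero.1 h1).resolve_left hne')
      ((mul_eq_zero.1 h3).resolve_left hne')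
    have hw : ∀ i : Fin m, w (Fin.natAdd k i) = 0 := fun i => by
      have := (Finset.sum_eq_zero_iff_of_nonneg fun i _ => sq_nonneg _).1 h0.symm i (Finset.mem_univ i)
      exact pow_eq_zero_iff two_ne_zero |>.1 this
    have := hξ.tail_sum
    simp only [hw, zero_mul, Finset.sum_const_zero] at this
    linarith
  refine ⟨ht₁, funext (Fin.addCases (fun i => ?_) (fun i => ?_))⟩
  · have := hh i
    simpa [ht₁, ha] using this
  · have := ht i
    simpa [ht₁, hb] using this

/-- A tangent vector of the transported Lagrangian is the velocity of a curve which comes from the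
hyperboloid. -/
theorem exists_lift_of_tangent (hu : 0 < u) {z ξ : CSpace (k + m)} (hz : z ∈ transportLag k m u)
    (hξ : ξ ∈ tangentSet (transportLag k m u) z) :
    ∃ (c : ℝ → CSpace (k + m)) (w₁ : Fin (k + m) → ℝ) (t₁ : ℝ), c 0 = z ∧ HasDerivAt c ξ 0 ∧
      (∀ᶠ s in nhds (0 : ℝ), c s ∈ transportLag k m u) ∧
      HasDerivAt (fun s => transportInv u (c s)) w₁ 0 ∧
      HasDerivAt (fun s => tailSq k m (transportInv u (c s))) t₁ 0 ∧
      ∑ i : Fin k, transportInv u z (Fin.castAdd m i) * w₁ (Fin.castAdd m i) = t₁ / 2 ∧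
      ∑ i : Fin m, transportInv u z (Fin.natAdd k i) * w₁ (Fin.natAdd k i) = t₁ / 2 := by
  obtain ⟨c, -, rfl, hc, hd⟩ := hξ
  have hW : HasDerivAt (fun s => transportInv u (c s)) (fderiv ℝ (transportInv u) (c 0) ξ) 0 :=
    ((contDiffAt_transportInv (mem_transportLag hu hz).2.2.2).differentiableAt
      (by simp)).hasFDerivAt.comp_hasDerivAt 0 hd
  set w₁ := fderiv ℝ (transportInv u) (c 0) ξ
  have hWj := hasDerivAt_pi.1 hW
  have ht : HasDerivAt (fun s => tailSq k m (transportInv u (c s))) _ 0 :=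
    HasDerivAt.fun_sum fun i _ => (hWj (Fin.natAdd k i)).pow 2
  have hh : HasDerivAt (fun s => headSq k m (transportInv u (c s))) _ 0 :=
    HasDerivAt.fun_sum fun i _ => (hWj (Fin.castAdd m i)).pow 2
  have h1 := ht.add_const u |>.unique (hh.congr_of_eventuallyEq (hc.mono fun s hs =>
    (show headSq k m _ = _ from (mem_transportLag hu hs).1).symm))
  refine ⟨c, w₁, _, rfl, hd, hc, hW, ht, ?_, ?_⟩
  · rw [h1, Finset.sum_div]
    exact Finset.sum_congr rfl fun i _ => by norm_num; ring
  · rw [Finset.sum_div]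
    exact Finset.sum_congr rfl fun i _ => by norm_num; ring

/-- Images of tangent vectors of the transported Lagrangian under a map to another rotationally
symmetric submanifold. -/
theorem exists_isTwistVelocity (hu : 0 < u) {z ξ : CSpace (k + m)} (hz : z ∈ transportLag k m u)
    (hξ : ξ ∈ tangentSet (transportLag k m u) z) :
    ∃ (c : ℝ → CSpace (k + m)) (w₁ : Fin (k + m) → ℝ) (t₁ : ℝ), c 0 = z ∧ HasDerivAt c ξ 0 ∧
      (∀ᶠ s in nhds (0 : ℝ), c s ∈ transportLag k m u) ∧
      HasDerivAt (fun s => tailSq k m (transportInv u (c s))) t₁ 0 ∧ ∀ (a b : ℝ → ℂ) (a' b' : ℂ)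
      (G : CSpace (k + m) → CSpace (k + m)), DifferentiableAt ℝ G z →
      (∀ y ∈ transportLag k m u, G y = twist (a (tailSq k m (transportInv u y)))
        (b (tailSq k m (transportInv u y))) (transportInv u y)) →
      HasDerivAt a a' (tailSq k m (transportInv u z)) →
      HasDerivAt b b' (tailSq k m (transportInv u z)) →
      IsTwistVelocity (a (tailSq k m (transportInv u z))) (b (tailSq k m (transportInv u z))) a' b'
        (transportInv u z) w₁ t₁ (fderiv ℝ G z ξ) := by
  obtain ⟨c, w₁, t₁, rfl, hd, hc, hW, ht, h1, h2⟩ := exists_lift_of_tangent hu hz hξ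
  refine ⟨c, w₁, t₁, rfl, hd, hc, ht, fun a b a' b' G hG hGe ha hb => ⟨h1, h2, fun i => ?_, fun i => ?_⟩⟩
  all_goals
    have hGc := hasDerivAt_cspace.1 (hG.hasFDerivAt.comp_hasDerivAt 0 hd)
  · have hac := ha.scomp 0 ht
    have h3 := hac.mul ((hasDerivAt_pi.1 hW (Fin.castAdd m i)).ofReal_comp)
    refine (hGc (Fin.castAdd m i)).unique (HasDerivAt.congr_deriv (h3.congr_of_eventuallyEq ?_) ?_)
    · filter_upwards [hc] with s hs
      rw [Function.comp_apply, hGe _ hs, twist_castAdd]; rfl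
    · rw [Complex.real_smul, mul_comm (t₁ : ℂ)]; rfl
  · have hbc := hb.scomp 0 ht
    have h3 := hbc.mul ((hasDerivAt_pi.1 hW (Fin.natAdd k i)).ofReal_comp)
    refine (hGc (Fin.natAdd k i)).unique (HasDerivAt.congr_deriv (h3.congr_of_eventuallyEq ?_) ?_)
    · filter_upwards [hc] with s hs
      rw [Function.comp_apply, hGe _ hs, twist_natAdd]; rfl
    · rw [Complex.real_smul, mul_comm (t₁ : ℂ)]; rfl

/-- The identity as a map from the transported Lagrangian to itself. -/
theorem IsTwistVelocity.of_self (hu : 0 < u) {z ξ : CSpace (k + m)}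
    {w₁ : Fin (k + m) → ℝ} {t₁ : ℝ}
    (h : ∀ (a b : ℝ → ℂ) (a' b' : ℂ) (G : CSpace (k + m) → CSpace (k + m)), DifferentiableAt ℝ G z →
      (∀ y ∈ transportLag k m u, G y = twist (a (tailSq k m (transportInv u y)))
        (b (tailSq k m (transportInv u y))) (transportInv u y)) →
      HasDerivAt a a' (tailSq k m (transportInv u z)) →
      HasDerivAt b b' (tailSq k m (transportInv u z)) →
      IsTwistVelocity (a (tailSq k m (transportInv u z))) (b (tailSq k m (transportInv u z))) a' b'
        (transportInv u z) w₁ t₁ (fderiv ℝ G z ξ)) :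
    IsTwistVelocity (transportA u (tailSq k m (transportInv u z)))
      (transportB u (tailSq k m (transportInv u z)))
      (deriv (transportA u) (tailSq k m (transportInv u z)))
      (deriv (transportB u) (tailSq k m (transportInv u z))) (transportInv u z) w₁ t₁ ξ := by
  have ht : 0 < 2 * tailSq k m (transportInv u z) + u := by
    have := tailSq_nonneg (transportInv u z); linarith
  have := h (transportA u) (transportB u) _ _ id differentiableAt_id
    (fun y hy => (mem_transportLag hu hy).2.1.symm)
    ((contDiffAt_transportA ht).differentiableAt (by simp)).hasDerivAt
    ((contDiffAt_transportB ht).differentiableAt (by simp)).hasDerivAt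
  simpa using this

/-- The Liouville form on the transported Lagrangian, up to the factor `t₁ / 2`. -/
theorem im_transport_derivs (hu : 0 < u) {t : ℝ} (ht : 0 < t) :
    (conj (transportA u t) * deriv (transportA u) t).im * (t + u)
      + (conj (transportB u t) * deriv (transportB u) t).im * t
      = -(Real.pi * u ^ 2 / (2 * t + u) ^ 2) := by
  have ht' : 0 < 2 * t + u := by linarith
  set r := geoMean u t
  have hr : 0 < r := geoMean_pos hu ht
  have hr2 : r ^ 2 = t * (t + u) := geoMean_sq hu ht.le
  have hang := hasDerivAt_angle hu ht
  have hgeo := hasDerivAt_geoMean hu ht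
  have hCd := ((contDiffAt_angleCos ht').differentiableAt (by simp)).hasDerivAt
  have hKd := ((contDiffAt_angleSinc ht').differentiableAt (by simp)).hasDerivAt
  have hpos : ∀ᶠ s in nhds t, 0 ≤ s := (eventually_gt_nhds ht).mono fun s hs => hs.le
  have hC' := hCd.unique (hang.cos.congr_of_eventuallyEq (hpos.mono fun s hs => angleCos_eq hu hs))
  have hK' := (hKd.mul hgeo).unique
    (hang.sin.congr_of_eventuallyEq (hpos.mono fun s hs => angleSinc_mul hu hs))
  rw [← angleSinc_mul hu ht.le] at hC'
  rw [← angleCos_eq hu ht.le] at hK'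
  have hid := angle_identity hu ht.le
  have hA := (hCd.ofReal_comp.neg.add ((hKd.mul (hasDerivAt_id t)).ofReal_comp.const_mul Complex.I)).deriv
  have hB := (((hKd.mul ((hasDerivAt_id t).add_const u)).ofReal_comp).add
    (hCd.ofReal_comp.const_mul Complex.I)).deriv
  change deriv (transportA u) t = _ at hA
  change deriv (transportB u) t = _ at hB
  rw [hA, hB, transportA, transportB]
  set C := angleCos u t
  set K := angleSinc u t
  set C' := deriv (angleCos u) t
  set K' := deriv (angleSinc u) t
  obtain ⟨g, hgdef⟩ : ∃ g, g = (2 * t + u) / (2 * r) := ⟨_, rfl⟩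
  obtain ⟨D, hDdef⟩ : ∃ D, D = Real.pi * u ^ 2 / (2 * r * (2 * t + u) ^ 2) := ⟨_, rfl⟩
  have hg : 2 * r * g = 2 * t + u := by rw [hgdef]; field_simp
  have hD : 2 * r * D = Real.pi * u ^ 2 / (2 * t + u) ^ 2 := by rw [hDdef]; field_simp
  change K' * r + K * ((2 * t + u) / (2 * r)) = _ at hK'
  rw [← hgdef, ← hDdef] at hK'
  rw [← hDdef] at hC'
  simp
  linear_combination 2 * r ^ 2 * K * hC' - 2 * r * C * hK' + C * K * hg - 2 * r * D * hid - hD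
    - (2 * (K * C' - C * K') + 2 * r * K ^ 2 * D) * hr2

theorem stdLambda_transportLag (hu : 0 < u) {z : CSpace (k + m)} (hz : z ∈ transportLag k m u)
    {w₁ : Fin (k + m) → ℝ} {t₁ : ℝ} {ξ : CSpace (k + m)}
    (h : IsTwistVelocity (transportA u (tailSq k m (transportInv u z)))
      (transportB u (tailSq k m (transportInv u z)))
      (deriv (transportA u) (tailSq k m (transportInv u z)))
      (deriv (transportB u) (tailSq k m (transportInv u z))) (transportInv u z) w₁ t₁ ξ) :
    stdLambda z ξ = -(Real.pi * u ^ 2 / (2 * (2 * tailSq k m (transportInv u z) + u) ^ 2)) * t₁ := by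
  obtain ⟨h1, h2, -, -⟩ := mem_transportLag hu hz
  have h3 := h.stdLambda_eq
  change stdLambda (transportMap u _) ξ = _ at h3
  rw [h2, show headSq k m _ = _ from h1] at h3
  rw [h3]
  rcases (tailSq_nonneg (transportInv u z)).eq_or_lt with h0 | h0
  · have hw : ∀ i : Fin m, transportInv u z (Fin.natAdd k i) = 0 := fun i => by
      have := (Finset.sum_eq_zero_iff_of_nonneg fun i _ => sq_nonneg _).1 h0.symm i (Finset.mem_univ i)
      exact pow_eq_zero_iff two_ne_zero |>.1 this
    have := h.tail_sum
    simp only [hw, zero_mul, Finset.sum_const_zero] at this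
    rw [show t₁ = 0 by linarith, mul_zero, mul_zero]
  · rw [im_transport_derivs hu h0]
    have : 2 * tailSq k m (transportInv u z) + u ≠ 0 := by positivity
    field_simp

/-! ### The transported Lagrangian is an exact Lagrangian submanifold -/

theorem isEmbeddedSubmanifold_transportLag (hu : 0 < u) :
    IsEmbeddedSubmanifold (k + m - 1) (transportLag k m u) := by
  rintro _ ⟨w₀, hw₀, rfl⟩
  have hw₀' : headSq k m w₀ = tailSq k m w₀ + u := hw₀
  -- Some coordinate of `y` does not vanish; the others are used as coordinates.
  obtain ⟨i₀, hi₀⟩ : ∃ i : Fin k, w₀ (Fin.castAdd m i) ≠ 0 := by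
    by_contra! h
    have : headSq k m w₀ = 0 := by simp [headSq, h]
    have := tailSq_nonneg w₀
    linarith
  obtain ⟨σ, hσ, hσ0⟩ : ∃ σ : ℝ, σ ^ 2 = 1 ∧ 0 < σ * w₀ (Fin.castAdd m i₀) := by
    rcases lt_or_gt_of_ne hi₀ with h | h
    · exact ⟨-1, by norm_num, by linarith⟩
    · exact ⟨1, by norm_num, by linarith⟩
  set j₀ := Fin.castAdd m i₀ with hj₀
  have hcard : Fintype.card {j : Fin (k + m) // j ≠ j₀} = k + m - 1 := by
    rw [Fintype.card_subtype_compl, Fintype.card_subtype_eq, Fintype.card_fin]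
  let e := Fintype.equivFinOfCardEq hcard
  let v : EuclideanSpace ℝ (Fin (k + m - 1)) → ℝ → Fin (k + m) → ℝ := fun c s j =>
    if h : j = j₀ then s else c (e ⟨j, h⟩)
  have hv0 : ∀ c s, v c s j₀ = s := fun c s => by simp [v]
  have htail : ∀ c s, tailSq k m (v c s) = tailSq k m (v c 0) := by
    intro c s
    refine Finset.sum_congr rfl fun i _ => ?_
    have : Fin.natAdd k i ≠ j₀ := by
      intro h
      have h2 := congrArg Fin.val h
      simp [hj₀] at h2
      omega
    simp [v, this]
  have hhead : ∀ c s, headSq k m (v c s) = headSq k m (v c 0) + s ^ 2 := by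
    intro c s
    rw [headSq, headSq, ← Finset.add_sum_erase _ _ (Finset.mem_univ i₀),
      ← Finset.add_sum_erase Finset.univ (fun i => v c 0 (Fin.castAdd m i) ^ 2) (Finset.mem_univ i₀),
      ← hj₀, hv0, hv0]
    have : ∀ i ∈ Finset.univ.erase i₀, v c s (Fin.castAdd m i) ^ 2 = v c 0 (Fin.castAdd m i) ^ 2 := by
      intro i hi
      have hne : Fin.castAdd m i ≠ j₀ := fun h => Finset.ne_of_mem_erase hi (Fin.castAdd_injective _ _ h)
      simp [v, hne]
    rw [Finset.sum_congr rfl this]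
    ring
  have hvsmooth : ∀ {f : EuclideanSpace ℝ (Fin (k + m - 1)) → ℝ} {c}, ContDiffAt ℝ ∞ f c →
      ContDiffAt ℝ ∞ (fun c => v c (f c)) c := by
    intro f c hf
    refine contDiffAt_pi.2 fun j => ?_
    by_cases h : j = j₀
    · simpa [v, h] using hf
    · simp only [v, h, dite_false]
      exact contDiffAt_piLp_apply 2
  let rest : EuclideanSpace ℝ (Fin (k + m - 1)) → ℝ := fun c =>
    u + tailSq k m (v c 0) - headSq k m (v c 0)
  have hrest : ContDiff ℝ ∞ rest := by
    refine contDiff_iff_contDiffAt.2 fun c => ?_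
    have h := hvsmooth (c := c) (contDiffAt_const (c := (0 : ℝ)))
    have hs : ContDiff ℝ ∞ (headSq k m) := ContDiff.sum fun _ _ => (contDiff_apply ℝ ℝ _).pow 2
    exact (contDiffAt_const.add (contDiff_tailSq.contDiffAt.comp c h)).sub (hs.contDiffAt.comp c h)
  let W : EuclideanSpace ℝ (Fin (k + m - 1)) → Fin (k + m) → ℝ := fun c => v c (σ * √(rest c))
  have hW : ∀ c, 0 < rest c → W c ∈ hyperboloid k m u := by
    intro c hc
    change headSq k m (W c) = tailSq k m (W c) + u
    simp only [W]
    rw [hhead, htail, mul_pow, hσ, Real.sq_sqrt hc.le]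
    simp only [rest]; ring
  have hWsmooth : ∀ c, 0 < rest c → ContDiffAt ℝ ∞ W c := fun c hc =>
    hvsmooth (contDiffAt_const.mul (hrest.contDiffAt.sqrt hc.ne'))
  have hψW : ∀ w ∈ hyperboloid k m u, 0 < σ * w j₀ →
      0 < rest (WithLp.toLp 2 fun i => w (e.symm i)) ∧ W (WithLp.toLp 2 fun i => w (e.symm i)) = w := by
    intro w hw hpos
    set c : EuclideanSpace ℝ (Fin (k + m - 1)) := WithLp.toLp 2 fun i => w (e.symm i) with hc
    have h1 : v c (w j₀) = w := by
      ext j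
      by_cases h : j = j₀
      · rw [h, hv0]
      · simp [v, h, hc]
    have hw' : headSq k m w = tailSq k m w + u := hw
    rw [← h1, hhead, htail] at hw'
    have h2 : rest c = w j₀ ^ 2 := by simp only [rest]; linarith
    have h3 : σ * √(rest c) = w j₀ := by
      have : w j₀ ^ 2 = (σ * w j₀) ^ 2 := by rw [mul_pow, hσ, one_mul]
      rw [h2, this, Real.sqrt_sq hpos.le]
      linear_combination w j₀ * hσ
    refine ⟨?_, ?_⟩
    · rw [h2]; have : w j₀ ≠ 0 := by rintro h; simp [h] at hpos
      positivity
    · simp only [W, h3, h1]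
  refine ⟨{z | z ≠ 0} ∩ transportInv u ⁻¹' {w | 0 < σ * w j₀}, {c | 0 < rest c},
    fun c => transportMap u (W c),
    fun z => WithLp.toLp 2 fun i => transportInv u z (e.symm i), ?_, ?_, ?_, ?_, ?_, ?_, ?_⟩
  · refine ContinuousOn.isOpen_inter_preimage
      (fun z hz => (contDiffAt_transportInv hz).continuousAt.continuousWithinAt) isOpen_ne ?_
    exact isOpen_lt continuous_const (by fun_prop)
  · refine ⟨(mem_transportLag hu ⟨w₀, hw₀, rfl⟩).2.2.2, ?_⟩
    rw [Set.mem_preimage, transportInv_transportMap hu hw₀]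
    exact hσ0
  · exact isOpen_lt continuous_const hrest.continuous
  · intro c hc
    have h1 := hWsmooth c hc
    have ht := (contDiff_tailSq (k := k) (m := m)).contDiffAt.comp c h1
    have hpos : 0 < 2 * tailSq k m (W c) + u := by have := tailSq_nonneg (W c); linarith
    exact (contDiffAt_twist ((contDiffAt_transportA hpos).comp c ht)
      ((contDiffAt_transportB hpos).comp c ht) h1).contDiffWithinAt
  · rintro z ⟨hz, -⟩
    exact ((contDiffAt_piLp 2).2 fun i => contDiffAt_pi.1 (contDiffAt_transportInv hz) _).contDiffWithinAt
  · ext z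
    constructor
    · rintro ⟨c, hc, rfl⟩
      have hz : transportMap u (W c) ∈ transportLag k m u := ⟨_, hW c hc, rfl⟩
      refine ⟨hz, (mem_transportLag hu hz).2.2.2, ?_⟩
      rw [Set.mem_preimage, transportInv_transportMap hu (hW c hc)]
      change 0 < σ * W c j₀
      simp only [W, hv0]
      rw [← mul_assoc, ← sq, hσ, one_mul]
      exact Real.sqrt_pos.2 hc
    · rintro ⟨hz, -, hz2⟩
      obtain ⟨h1, h2, -, -⟩ := mem_transportLag hu hz
      obtain ⟨h3, h4⟩ := hψW _ h1 hz2
      exact ⟨_, h3, by simp only [h4]; exact h2⟩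
  · intro c hc
    ext i
    simp only [transportInv_transportMap hu (hW c hc)]
    have : (e.symm i : Fin (k + m)) ≠ j₀ := (e.symm i).2
    simp [W, v, this]

theorem isExactLagrangian_transportLag (hu : 0 < u) :
    IsExactLagrangian (quadFiber (k + m) (u : ℂ)) (transportLag k m u) := by
  refine ⟨transportLag_subset hu, isEmbeddedSubmanifold_transportLag hu, ?_, ?_⟩
  · intro z hz ξ hξ η hη
    obtain ⟨-, w₁, t₁, -, -, -, -, h⟩ := exists_isTwistVelocity hu hz hξ
    obtain ⟨-, w₂, t₂, -, -, -, -, g⟩ := exists_isTwistVelocity hu hz hη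
    exact (IsTwistVelocity.of_self hu h).stdOmega_eq_zero (IsTwistVelocity.of_self hu g)
  · -- The primitive of the Liouville form is `π u² / (4 |z|²)`.
    refine ⟨{z | z ≠ 0}, fun z => Real.pi * u ^ 2 / 4 / ‖z‖ ^ 2, isOpen_ne,
      fun z hz => (mem_transportLag hu hz).2.2.2, fun z hz => ?_, fun z hz ξ hξ => ?_⟩
    · exact (contDiffAt_const.div (contDiff_norm_sq ℂ).contDiffAt
        (pow_ne_zero 2 (norm_ne_zero_iff.2 hz))).contDiffWithinAt
    · obtain ⟨c, w₁, t₁, rfl, hd, hc, ht, h⟩ := exists_isTwistVelocity hu hz hξ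
      rw [stdLambda_transportLag hu hz (IsTwistVelocity.of_self hu h)]
      have hf : DifferentiableAt ℝ (fun z : CSpace (k + m) => Real.pi * u ^ 2 / 4 / ‖z‖ ^ 2) (c 0) :=
        (contDiffAt_const.div (contDiff_norm_sq ℂ).contDiffAt
        (pow_ne_zero 2 (norm_ne_zero_iff.2 (mem_transportLag hu hz).2.2.2))).differentiableAt
          (n := ∞) (by simp)
      have h1 := hf.hasFDerivAt.comp_hasDerivAt 0 hd
      have hpos : 2 * tailSq k m (transportInv u (c 0)) + u ≠ 0 := by
        have := tailSq_nonneg (transportInv u (c 0)); positivity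
      have h2 := (hasDerivAt_const (0 : ℝ) (Real.pi * u ^ 2 / 4)).div
        ((ht.const_mul 2).add_const u) hpos
      refine HasDerivAt.unique (HasDerivAt.congr_deriv (h2.congr_of_eventuallyEq ?_) ?_) h1
      · filter_upwards [hc] with s hs
        obtain ⟨g1, g2, -, -⟩ := mem_transportLag hu hs
        simp only [Function.comp_apply, Pi.div_apply]
        rw [← norm_sq_transportMap hu g1, g2]
      · field_simp
        ring

end Velocity

/-! ### Interpolation of handle profiles -/

section ProfileFacts
variable {ε δ : ℝ} {γ : ℝ → ℂ}

theorem IsRightHandedProfile.re_nonneg (h : IsRightHandedProfile ε δ γ) (s : ℝ) :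
    0 ≤ (γ s).re ∧ 0 ≤ (γ s).im ∧ γ s ≠ 0 := by
  have hδ := h.pos
  rcases le_or_gt δ s with h1 | h1
  · rw [h.real_end s h1]
    refine ⟨by simp; linarith, by simp, by simp; linarith⟩
  · rcases le_or_gt s (-δ) with h2 | h2
    · rw [h.imag_end s h2]
      refine ⟨by simp, by simp; linarith, by simp; linarith⟩
    · obtain ⟨h3, h4, -⟩ := h.quadrant s (abs_lt.2 ⟨h2, h1⟩)
      exact ⟨h3.le, h4.le, fun h5 => by simp [h5] at h3⟩

/-- A right-handed profile curve moves strictly to the lower right, in the sense that the difference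
of its coordinates has a positive derivative. -/
theorem IsRightHandedProfile.deriv_re_sub_im_pos (h : IsRightHandedProfile ε δ γ) (s : ℝ) :
    0 < (deriv γ s).re - (deriv γ s).im := by
  have hd : HasDerivAt γ (deriv γ s) s := (h.smooth.differentiable (by simp) s).hasDerivAt
  rcases le_or_gt δ s with h1 | h1
  · have h2 : HasDerivWithinAt γ 1 (Set.Ici δ) s :=
      (Complex.ofRealCLM.hasDerivAt (x := s)).hasDerivWithinAt.congr_of_mem
        (fun x hx => h.real_end x hx) h1
    rw [(uniqueDiffOn_Ici δ s h1).eq_deriv _ hd.hasDerivWithinAt h2]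
    simp
  · rcases le_or_gt s (-δ) with h2 | h2
    · have h3 : HasDerivWithinAt γ ((-1 : ℝ) * Complex.I) (Set.Iic (-δ)) s :=
        ((hasDerivAt_neg s).ofReal_comp.mul_const Complex.I).hasDerivWithinAt.congr_of_mem
          (fun x hx => h.imag_end x hx) h2
      rw [(uniqueDiffOn_Iic (-δ) s h2).eq_deriv _ hd.hasDerivWithinAt h3]
      simp
    · obtain ⟨h3, h4, h5⟩ := h.monotone s (abs_lt.2 ⟨h2, h1⟩)
      rcases h3.eq_or_lt with h6 | h6
      · rcases h4.eq_or_lt with h7 | h7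
        · exact absurd (Complex.ext h6.symm h7) h5
        · linarith
      · linarith

end ProfileFacts

section Interpolation
variable {u t τ : ℝ} {ε δ : ℝ} {γ : ℝ → ℂ}

/-- The parameter of the profile curve which corresponds to the parameter `t = |x|²` of the transported
Lagrangian. It maps `(0, ∞)` onto the real line, and is chosen in such a way that, near the beginning,
the imaginary part of the profile differs by a smooth multiple of `√t` from that of the transported
Lagrangian. -/
def profileParam (u t : ℝ) : ℝ :=
  √u * (geoMean u t - Real.cos (angle u t) / Real.sin (angle u t))

/-- The profile curve of the transported Lagrangian, viewed as a handle in the surgery chart. -/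
def transportProfile (u t : ℝ) : ℂ :=
  ⟨Real.sin (angle u t) ^ 2 * geoMean u t / √u, √u * (Real.cos (angle u t) / Real.sin (angle u t))⟩

/-- The linear interpolation between the profile of the transported Lagrangian and a given one. -/
def isoProfile (u : ℝ) (γ : ℝ → ℂ) (τ t : ℝ) : ℂ :=
  (1 - τ) • transportProfile u t + τ • γ (profileParam u t)

theorem hasDerivAt_cot_angle (hu : 0 < u) (ht : 0 < t) :
    ∃ d < 0, HasDerivAt (fun t => Real.cos (angle u t) / Real.sin (angle u t)) d t := by
  have hs := sin_angle_pos hu ht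
  have hr := geoMean_pos hu ht
  have ha := hasDerivAt_angle hu ht
  have h := ha.cos.div ha.sin hs.ne'
  refine ⟨_, ?_, h⟩
  refine div_neg_of_neg_of_pos ?_ (by positivity)
  have hD : 0 < Real.pi * u ^ 2 / (2 * geoMean u t * (2 * t + u) ^ 2) := by
    have := Real.pi_pos; positivity
  have hcs := Real.sin_sq_add_cos_sq (angle u t)
  nlinarith

theorem hasDerivAt_geoMean_pos (hu : 0 < u) (ht : 0 < t) : ∃ d > 0, HasDerivAt (geoMean u) d t := by
  have hr := geoMean_pos hu ht
  exact ⟨_, by positivity, hasDerivAt_geoMean hu ht⟩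

theorem hasDerivAt_profileParam (hu : 0 < u) (ht : 0 < t) :
    ∃ d > 0, HasDerivAt (profileParam u) d t := by
  obtain ⟨d₁, hd₁, h₁⟩ := hasDerivAt_cot_angle hu ht
  obtain ⟨d₂, hd₂, h₂⟩ := hasDerivAt_geoMean_pos hu ht
  exact ⟨_, mul_pos (Real.sqrt_pos.2 hu) (by linarith), (h₂.sub h₁).const_mul (√u)⟩

theorem hasDerivAt_transportProfile (hu : 0 < u) (ht : 0 < t) :
    ∃ d > 0, HasDerivAt (fun t => (transportProfile u t).re - (transportProfile u t).im) d t := by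
  obtain ⟨d₁, hd₁, h₁⟩ := hasDerivAt_cot_angle hu ht
  obtain ⟨d₂, hd₂, h₂⟩ := hasDerivAt_geoMean_pos hu ht
  have hs := sin_angle_pos hu ht
  have hc : 0 < Real.cos (angle u t) := by rw [← angleCos_eq hu ht.le]; exact angleCos_pos hu ht.le
  have hr := geoMean_pos hu ht
  have hu' := Real.sqrt_pos.2 hu
  have h := (((hasDerivAt_angle hu ht).sin.pow 2).mul h₂).div_const (√u) |>.sub (h₁.const_mul (√u))
  refine ⟨_, ?_, h⟩
  have hD : 0 < Real.pi * u ^ 2 / (2 * geoMean u t * (2 * t + u) ^ 2) := by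
    have := Real.pi_pos; positivity
  have h3 : √u * d₁ < 0 := mul_neg_of_pos_of_neg hu' hd₁
  have h4 : 0 < ((2 : ℕ) * Real.sin (angle u t) ^ (2 - 1) * (Real.cos (angle u t) *
      (Real.pi * u ^ 2 / (2 * geoMean u t * (2 * t + u) ^ 2))) * geoMean u t
      + Real.sin (angle u t) ^ 2 * d₂) / √u := by positivity
  exact sub_pos.2 (h3.trans h4)

/-- The monotone quantity along the interpolated profiles. -/
theorem hasDerivAt_isoProfile (hu : 0 < u) (hγ : IsRightHandedProfile ε δ γ) (ht : 0 < t)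
    (hτ : τ ∈ Set.Icc (0 : ℝ) 1) :
    ∃ d > 0, HasDerivAt (fun t => (isoProfile u γ τ t).re - (isoProfile u γ τ t).im) d t := by
  obtain ⟨d₁, hd₁, h₁⟩ := hasDerivAt_transportProfile hu ht
  obtain ⟨d₂, hd₂, h₂⟩ := hasDerivAt_profileParam hu ht
  have h₃ : HasDerivAt γ (deriv γ (profileParam u t)) (profileParam u t) :=
    (hγ.smooth.differentiable (by simp) _).hasDerivAt
  have h₄ := (h₃.re.comp t h₂).sub (h₃.im.comp t h₂)
  have hpos := hγ.deriv_re_sub_im_pos (profileParam u t)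
  have h := (h₁.const_mul (1 - τ)).add (h₄.const_mul τ)
  refine ⟨_, ?_, h.congr_of_eventuallyEq (Filter.Eventually.of_forall fun s => ?_)⟩
  · rw [← sub_mul]
    have h5 : 0 < ((deriv γ (profileParam u t)).re - (deriv γ (profileParam u t)).im) * d₂ :=
      mul_pos hpos hd₂
    rcases hτ.1.eq_or_lt with h6 | h6
    · rw [← h6]; linarith
    · have := mul_pos h6 h5
      have := mul_nonneg (sub_nonneg.2 hτ.2) hd₁.le
      linarith
  · simp [isoProfile]
    ring

theorem strictMonoOn_isoProfile (hu : 0 < u) (hγ : IsRightHandedProfile ε δ γ)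
    (hτ : τ ∈ Set.Icc (0 : ℝ) 1) :
    StrictMonoOn (fun t => (isoProfile u γ τ t).re - (isoProfile u γ τ t).im) (Set.Ioi 0) := by
  refine strictMonoOn_of_deriv_pos (convex_Ioi 0) (fun t ht => ?_) fun t ht => ?_
  · obtain ⟨d, -, h⟩ := hasDerivAt_isoProfile hu hγ ht hτ
    exact h.continuousAt.continuousWithinAt
  · rw [interior_Ioi] at ht
    obtain ⟨d, hd, h⟩ := hasDerivAt_isoProfile hu hγ ht hτ
    rwa [h.deriv]

theorem isoProfile_nonneg (hu : 0 < u) (hγ : IsRightHandedProfile ε δ γ) (ht : 0 < t)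
    (hτ : τ ∈ Set.Icc (0 : ℝ) 1) :
    0 ≤ (isoProfile u γ τ t).re ∧ 0 ≤ (isoProfile u γ τ t).im ∧ isoProfile u γ τ t ≠ 0 := by
  have hs := sin_angle_pos hu ht
  have hc : 0 < Real.cos (angle u t) := by rw [← angleCos_eq hu ht.le]; exact angleCos_pos hu ht.le
  have hr := geoMean_pos hu ht
  have hu' := Real.sqrt_pos.2 hu
  obtain ⟨h1, h2, h3⟩ := hγ.re_nonneg (profileParam u t)
  have h4 : 0 ≤ 1 - τ := sub_nonneg.2 hτ.2
  have h5 := hτ.1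
  have h6 : 0 < (transportProfile u t).im := by simp only [transportProfile]; positivity
  have h7 : 0 < (transportProfile u t).re := by simp only [transportProfile]; positivity
  refine ⟨by simp [isoProfile]; positivity, by simp [isoProfile]; positivity, fun h => ?_⟩
  rcases hτ.2.eq_or_lt with h8 | h8
  · simp [isoProfile, h8] at h; exact h3 h
  · have := congrArg Complex.im h
    simp [isoProfile] at this
    have h9 := mul_pos (sub_pos.2 h8) h6
    have h10 := mul_nonneg h5 h2
    linarith

theorem profileParam_eq (hu : 0 < u) (ht : 0 < t) : profileParam u t
    = √u * (geoMean u t - angleCos u t / (angleSinc u t * geoMean u t)) := by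
  rw [profileParam, angleCos_eq hu ht.le, angleSinc_mul hu ht.le]

theorem geoMean_zero : geoMean u 0 = 0 := by simp [geoMean]

theorem angleCos_zero : angleCos u 0 = 1 := by simp [angleCos, cosSqrt_zero]

/-- The parameter tends to `-∞` at the beginning. -/
theorem eventually_profileParam_lt (hu : 0 < u) (D : ℝ) :
    ∀ᶠ t in nhds (0 : ℝ), 0 < t → profileParam u t < D := by
  have hu' := Real.sqrt_pos.2 hu
  have hcg : ContinuousAt (geoMean u) 0 := by unfold geoMean; fun_prop
  have h0 : 0 < 2 * (0 : ℝ) + u := by linarith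
  have hcont : ContinuousAt (fun t => angleCos u t - angleSinc u t * geoMean u t ^ 2
      + D / √u * (angleSinc u t * geoMean u t)) 0 :=
    ((contDiffAt_angleCos h0).continuousAt.sub
      ((contDiffAt_angleSinc h0).continuousAt.mul (hcg.pow 2))).add
      (continuousAt_const.mul ((contDiffAt_angleSinc h0).continuousAt.mul hcg))
  have hev := hcont.eventually (lt_mem_nhds (a := 0) (by simp [geoMean_zero, angleCos_zero]))
  filter_upwards [hev] with t h ht
  have hK := angleSinc_pos hu ht.le
  have hr := geoMean_pos hu ht
  rw [profileParam_eq hu ht, ← lt_div_iff₀' hu', sub_lt_iff_lt_add, ← sub_lt_iff_lt_add',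
    lt_div_iff₀ (by positivity)]
  nlinarith

theorem two_mul_geoMean_div_le_sin (hu : 0 < u) (ht : 0 ≤ t) :
    2 * geoMean u t / (2 * t + u) ≤ Real.sin (angle u t) := by
  refine le_trans (le_of_eq ?_) (Real.mul_le_sin (angle_nonneg hu ht) (angle_lt hu ht).le)
  rw [angle]
  have := Real.pi_pos
  field_simp

theorem le_geoMean (hu : 0 < u) (ht : 0 ≤ t) : t ≤ geoMean u t :=
  Real.le_sqrt_of_sq_le (by nlinarith)

/-- Lower bounds for large `t`. -/
theorem profile_lower_bounds (hu : 0 < u) (ht : u ≤ t) :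
    4 / 9 * t / √u ≤ (transportProfile u t).re ∧ √u * (t - 3 / 2) ≤ profileParam u t := by
  have ht0 : 0 < t := hu.trans_le ht
  have hr := geoMean_pos hu ht0
  have hrt := le_geoMean hu ht0.le
  have hs := two_mul_geoMean_div_le_sin hu ht0.le
  have hu' := Real.sqrt_pos.2 hu
  have h1 : 2 / 3 ≤ 2 * geoMean u t / (2 * t + u) := by
    rw [div_le_div_iff₀ (by norm_num) (by positivity)]; linarith
  have h2 : 2 / 3 ≤ Real.sin (angle u t) := h1.trans hs
  constructor
  · simp only [transportProfile]
    refine div_le_div_of_nonneg_right ?_ hu'.le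
    have : 4 / 9 ≤ Real.sin (angle u t) ^ 2 := by nlinarith
    exact mul_le_mul this hrt ht0.le (by positivity)
  · refine mul_le_mul_of_nonneg_left (sub_le_sub hrt ?_) hu'.le
    rw [div_le_iff₀ (by linarith)]
    linarith [Real.cos_le_one (angle u t)]

theorem exists_isoProfile_large (hu : 0 < u) (hγ : IsRightHandedProfile ε δ γ) (R : ℝ) :
    ∃ T, ∀ t, T ≤ t → 0 < t → ∀ τ ∈ Set.Icc (0 : ℝ) 1, R < (isoProfile u γ τ t).re := by
  have hu' := Real.sqrt_pos.2 hu
  refine ⟨max u (max (9 / 4 * (√u * (|R| + 1))) (3 / 2 + (δ + |R| + 1) / √u)), fun t ht ht0 τ hτ => ?_⟩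
  obtain ⟨h1, h2⟩ := profile_lower_bounds hu ((le_max_left _ _).trans ht)
  have h3 := (le_max_left _ _).trans ((le_max_right _ _).trans ht)
  have h4 := (le_max_right _ _).trans ((le_max_right _ _).trans ht)
  have h5 : |R| + 1 ≤ (transportProfile u t).re := by
    refine le_trans ?_ h1
    rw [le_div_iff₀ hu']; linarith
  have h6 : δ + |R| + 1 ≤ profileParam u t := by
    refine le_trans ?_ h2
    rw [← div_le_iff₀' hu']; linarith
  have h7 : (γ (profileParam u t)).re = profileParam u t := by
    rw [hγ.real_end _ (by linarith [abs_nonneg R])]; simp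
  have h8 := hγ.pos
  have hR := le_abs_self R
  simp only [isoProfile, Complex.add_re, Complex.smul_re, smul_eq_mul, h7]
  have h9 := mul_le_mul_of_nonneg_left h5 (sub_nonneg.2 hτ.2)
  have h10 := mul_le_mul_of_nonneg_left (show |R| + 1 ≤ profileParam u t by linarith) hτ.1
  linarith

theorem exists_profileParam_eq (hu : 0 < u) (s : ℝ) : ∃ t, 0 < t ∧ profileParam u t = s := by
  obtain ⟨η, hη, h⟩ := Metric.eventually_nhds_iff.1 (eventually_profileParam_lt hu s)
  have h1 : profileParam u (min (η / 2) (u / 2)) < s := by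
    refine h ?_ (by positivity)
    rw [Real.dist_eq, sub_zero, abs_of_pos (by positivity)]
    exact (min_le_left _ _).trans_lt (half_lt_self hη)
  have hu' := Real.sqrt_pos.2 hu
  have h2 : s ≤ profileParam u (max u (3 / 2 + s / √u)) := by
    refine le_trans ?_ (profile_lower_bounds hu (le_max_left _ _)).2
    rw [← div_le_iff₀' hu']
    linarith [le_max_right u (3 / 2 + s / √u)]
  have hab : min (η / 2) (u / 2) ≤ max u (3 / 2 + s / √u) :=
    (min_le_right _ _).trans ((half_lt_self hu).le.trans (le_max_left _ _))
  have hpos : 0 < min (η / 2) (u / 2) := by positivity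
  have hc : ContinuousOn (profileParam u) (Set.Icc (min (η / 2) (u / 2)) (max u (3 / 2 + s / √u))) :=
    fun t ht => by
      obtain ⟨d, -, hd⟩ := hasDerivAt_profileParam hu (hpos.trans_le ht.1)
      exact hd.continuousAt.continuousWithinAt
  obtain ⟨t, ht, hts⟩ := intermediate_value_Icc hab hc ⟨h1.le, h2⟩
  exact ⟨t, hpos.trans_le ht.1, hts⟩

end Interpolation

/-! ### The coefficients of the isotopy -/

section Coefficients
variable {u t τ : ℝ} {ε δ : ℝ} {γ : ℝ → ℂ}

/-- Up to the factor `t / (√u √(t(t + u)))`, which makes it smooth at `t = 0`, the imaginary part of the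
interpolated profile. -/
def isoSlope (u : ℝ) (γ : ℝ → ℂ) (τ t : ℝ) : ℝ :=
  (1 - τ) * (angleCos u t / (angleSinc u t * (t + u))) +
    τ * (if t ≤ 0 then angleCos u t / (angleSinc u t * (t + u)) - t
      else t * (γ (profileParam u t)).im / (√u * geoMean u t))

/-- Up to the factor `√u / (t √(t(t + u)))`, which makes it smooth at `t = 0`, the real part of the
interpolated profile. -/
def isoMomentum (u : ℝ) (γ : ℝ → ℂ) (τ t : ℝ) : ℝ :=
  (1 - τ) * (angleSinc u t ^ 2 * (t + u)) +
    τ * (if t ≤ 0 then 0 else √u * (γ (profileParam u t)).re / (t * geoMean u t))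

/-- The squared norm of the direction of the real part. -/
def isoNorm (u : ℝ) (γ : ℝ → ℂ) (τ t : ℝ) : ℝ := t + isoSlope u γ τ t ^ 2 * (t + u)

/-- The discriminant of the quadratic equation for the scale. -/
def isoDisc (u : ℝ) (γ : ℝ → ℂ) (τ t : ℝ) : ℝ :=
  u ^ 2 + 4 * isoNorm u γ τ t * (isoNorm u γ τ t * (isoMomentum u γ τ t ^ 2 * t * (t + u)))

/-- The scale for which the points of the isotopy lie on the fiber. -/
def isoScale (u : ℝ) (γ : ℝ → ℂ) (τ t : ℝ) : ℝ :=
  √((u + √(isoDisc u γ τ t)) / (2 * isoNorm u γ τ t))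

/-- The coefficient of the first `k` coordinates in the isotopy. -/
def isoA (u : ℝ) (γ : ℝ → ℂ) (τ t : ℝ) : ℂ :=
  ((-(isoScale u γ τ t * isoSlope u γ τ t) : ℝ) : ℂ)
    + ((isoMomentum u γ τ t * t / isoScale u γ τ t : ℝ) : ℂ) * Complex.I

/-- The coefficient of the last coordinates in the isotopy. -/
def isoB (u : ℝ) (γ : ℝ → ℂ) (τ t : ℝ) : ℂ :=
  ((isoScale u γ τ t : ℝ) : ℂ)
    + ((isoMomentum u γ τ t * isoSlope u γ τ t * (t + u) / isoScale u γ τ t : ℝ) : ℂ) * Complex.I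

theorem isoSlope_eq (hu : 0 < u) (ht : 0 < t) :
    isoSlope u γ τ t = t * (isoProfile u γ τ t).im / (√u * geoMean u t) := by
  have hr := geoMean_pos hu ht
  have hu' := Real.sqrt_pos.2 hu
  have hK := angleSinc_pos hu ht.le
  have hr2 := geoMean_sq hu ht.le
  simp only [isoSlope, if_neg (not_le.2 ht), isoProfile, Complex.add_im, Complex.smul_im, smul_eq_mul,
    transportProfile, ← angleCos_eq hu ht.le, ← angleSinc_mul hu ht.le]
  have htu : t + u ≠ 0 := by positivity
  field_simp
  linear_combination ((1 - τ) * angleCos u t * √u) * hr2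

theorem isoMomentum_eq (hu : 0 < u) (ht : 0 < t) :
    isoMomentum u γ τ t = √u * (isoProfile u γ τ t).re / (t * geoMean u t) := by
  have hr := geoMean_pos hu ht
  have hu' := Real.sqrt_pos.2 hu
  have hr2 := geoMean_sq hu ht.le
  simp only [isoMomentum, if_neg (not_le.2 ht), isoProfile, Complex.add_re, Complex.smul_re, smul_eq_mul,
    transportProfile, ← angleSinc_mul hu ht.le]
  field_simp
  linear_combination (-(1 - τ) * angleSinc u t ^ 2 * geoMean u t) * hr2

theorem isoSlope_zero (hu : 0 < u) : 0 < isoSlope u γ τ 0 := by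
  have := angleSinc_pos hu le_rfl
  simp only [isoSlope, le_refl, if_true, angleCos_zero]
  ring_nf
  positivity

theorem isoNorm_pos (hu : 0 < u) (ht : 0 ≤ t) : 0 < isoNorm u γ τ t := by
  unfold isoNorm
  rcases ht.eq_or_lt with rfl | ht
  · have := isoSlope_zero (γ := γ) (τ := τ) hu; positivity
  · positivity

theorem isoDisc_pos (hu : 0 < u) (ht : 0 ≤ t) : 0 < isoDisc u γ τ t := by
  have := isoNorm_pos (γ := γ) (τ := τ) hu ht
  unfold isoDisc; positivity

theorem isoScale_pos (hu : 0 < u) (hN : 0 < isoNorm u γ τ t) : 0 < isoScale u γ τ t := by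
  have : 0 ≤ √(isoDisc u γ τ t) := Real.sqrt_nonneg _
  unfold isoScale; positivity

theorem isoScale_eq (hu : 0 < u) (ht : 0 ≤ t) : isoNorm u γ τ t * (isoScale u γ τ t ^ 2
    - isoMomentum u γ τ t ^ 2 * t * (t + u) / isoScale u γ τ t ^ 2) = u := by
  have hN := isoNorm_pos (γ := γ) (τ := τ) hu ht
  have hs : 0 ≤ √(isoDisc u γ τ t) := Real.sqrt_nonneg _
  have h := quadratic_root (P := isoNorm u γ τ t * (isoMomentum u γ τ t ^ 2 * t * (t + u))) hN
    (by positivity) hu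
  rw [isoScale, Real.sq_sqrt (by positivity), mul_sub]
  refine Eq.trans ?_ h
  congr 1
  exact (mul_div_assoc _ _ _).symm

theorem isoA_re : (isoA u γ τ t).re = -(isoScale u γ τ t * isoSlope u γ τ t) := by simp [isoA]
theorem isoA_im : (isoA u γ τ t).im = isoMomentum u γ τ t * t / isoScale u γ τ t := by simp [isoA]
theorem isoB_re : (isoB u γ τ t).re = isoScale u γ τ t := by simp [isoB]
theorem isoB_im : (isoB u γ τ t).im
    = isoMomentum u γ τ t * isoSlope u γ τ t * (t + u) / isoScale u γ τ t := by simp [isoB]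

/-- The points of the isotopy lie on the fiber. -/
theorem iso_fiber (hu : 0 < u) (ht : 0 ≤ t) :
    isoA u γ τ t ^ 2 * (t + u) + isoB u γ τ t ^ 2 * t = u := by
  have hs := isoScale_pos hu (isoNorm_pos (γ := γ) (τ := τ) hu ht)
  have h := isoScale_eq (γ := γ) (τ := τ) hu ht
  rw [isoNorm] at h
  refine Complex.ext ?_ ?_
  · simp only [Complex.add_re, Complex.mul_re, Complex.add_im, Complex.ofReal_re, Complex.ofReal_im, sq,
      Complex.mul_im, isoA_re, isoA_im, isoB_re, isoB_im]
    refine Eq.trans ?_ h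
    field_simp
    ring
  · simp only [Complex.add_re, Complex.mul_re, Complex.add_im, Complex.ofReal_re, Complex.ofReal_im, sq,
      Complex.mul_im, isoA_re, isoA_im, isoB_re, isoB_im]
    field_simp
    ring

theorem isoB_re_pos (hu : 0 < u) (ht : 0 ≤ t) : 0 < (isoB u γ τ t).re := by
  rw [isoB_re]; exact isoScale_pos hu (isoNorm_pos hu ht)

theorem isoB_ne_zero (hu : 0 < u) (ht : 0 ≤ t) : isoB u γ τ t ≠ 0 := fun h => by
  have := isoB_re_pos (γ := γ) (τ := τ) hu ht
  simp [h] at this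

theorem isoProfile_re_eq (hu : 0 < u) (ht : 0 < t) : (isoProfile u γ τ t).re
    = (isoA u γ τ t).im * (isoB u γ τ t).re * geoMean u t / √u := by
  have hs := isoScale_pos hu (isoNorm_pos (γ := γ) (τ := τ) hu ht.le)
  have hr := geoMean_pos hu ht
  have hu' := Real.sqrt_pos.2 hu
  rw [isoA_im, isoB_re, isoMomentum_eq hu ht]
  field_simp

theorem isoProfile_im_eq (hu : 0 < u) (ht : 0 < t) : (isoProfile u γ τ t).im
    = -(√u * geoMean u t * (isoA u γ τ t).re / (t * (isoB u γ τ t).re)) := by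
  have hs := isoScale_pos hu (isoNorm_pos (γ := γ) (τ := τ) hu ht.le)
  have hr := geoMean_pos hu ht
  have hu' := Real.sqrt_pos.2 hu
  rw [isoA_re, isoB_re, isoSlope_eq hu ht]
  field_simp

theorem isoA_ne_zero (hu : 0 < u) (hγ : IsRightHandedProfile ε δ γ) (ht : 0 ≤ t)
    (hτ : τ ∈ Set.Icc (0 : ℝ) 1) : isoA u γ τ t ≠ 0 := by
  intro h
  rcases ht.eq_or_lt with rfl | ht
  · have h1 := isoSlope_zero (γ := γ) (τ := τ) hu
    have h2 := isoScale_pos hu (isoNorm_pos (γ := γ) (τ := τ) hu le_rfl)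
    have h3 := isoA_re (u := u) (γ := γ) (τ := τ) (t := 0)
    rw [h, Complex.zero_re] at h3
    nlinarith
  · refine (isoProfile_nonneg hu hγ ht hτ).2.2 (Complex.ext ?_ ?_)
    · rw [isoProfile_re_eq hu ht, h]; simp
    · rw [isoProfile_im_eq hu ht, h]; simp

/-- The isotopy starts at the transported Lagrangian. -/
theorem iso_start (hu : 0 < u) (ht : 0 ≤ t) :
    isoA u γ 0 t = transportA u t ∧ isoB u γ 0 t = transportB u t := by
  have hK := angleSinc_pos hu ht
  have hid := angle_identity hu ht
  have htu : 0 < t + u := by positivity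
  have hG : isoSlope u γ 0 t = angleCos u t / (angleSinc u t * (t + u)) := by simp [isoSlope]
  have hF : isoMomentum u γ 0 t = angleSinc u t ^ 2 * (t + u) := by simp [isoMomentum]
  have hN : isoNorm u γ 0 t = 1 / (angleSinc u t ^ 2 * (t + u)) := by
    rw [isoNorm, hG]
    field_simp
    linear_combination hid
  have hM : isoScale u γ 0 t = angleSinc u t * (t + u) := by
    have hD : isoDisc u γ 0 t = (2 * t + u) ^ 2 := by
      rw [isoDisc, hN, hF]
      field_simp
      ring
    rw [isoScale, hD, Real.sqrt_sq (by positivity), hN]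
    refine (Real.sqrt_eq_iff_eq_sq (by positivity) (by positivity)).2 ?_
    field_simp
    ring
  constructor
  · refine Complex.ext ?_ ?_
    · rw [isoA_re, hM, hG, transportA]; simp; field_simp
    · rw [isoA_im, hM, hF, transportA]; simp; field_simp
  · refine Complex.ext ?_ ?_
    · rw [isoB_re, hM, transportB]; simp
    · rw [isoB_im, hM, hF, hG, transportB]; simp; field_simp

/-- The derivatives of the two coefficients do not degenerate simultaneously: otherwise the derivative
of the difference between the real and imaginary parts of the profile would vanish. -/
theorem iso_nondegenerate (hu : 0 < u) (hγ : IsRightHandedProfile ε δ γ) (ht : 0 < t)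
    (hτ : τ ∈ Set.Icc (0 : ℝ) 1) {a' b' : ℂ} (ha : HasDerivAt (isoA u γ τ) a' t)
    (hb : HasDerivAt (isoB u γ τ) b' t) (h1 : 2 * (t + u : ℝ) * a' + isoA u γ τ t = 0)
    (h2 : 2 * (t : ℂ) * b' + isoB u γ τ t = 0) : False := by
  obtain ⟨d, hd, h⟩ := hasDerivAt_isoProfile hu hγ ht hτ
  have hr := geoMean_pos hu ht
  have hr2 := geoMean_sq hu ht.le
  have hu' := Real.sqrt_pos.2 hu
  have hB := isoB_re_pos (γ := γ) (τ := τ) hu ht.le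
  have hpos : ∀ᶠ s in nhds t, 0 < s := eventually_gt_nhds ht
  have hg := hasDerivAt_geoMean hu ht
  have h3 := ((ha.im.mul hb.re).mul hg).div_const (√u)
  have h4 := ((hg.const_mul (√u)).mul ha.re).div ((hasDerivAt_id t).mul hb.re) (mul_pos ht hB).ne'
  have h5 := h.unique ((h3.add h4).congr_of_eventuallyEq (hpos.mono fun s hs => by
    simp only [isoProfile_re_eq hu hs, isoProfile_im_eq hu hs, sub_neg_eq_add]; rfl))
  have e1 : a'.re = -(isoA u γ τ t).re / (2 * (t + u)) := by
    have := congrArg Complex.re h1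
    simp at this
    rw [eq_div_iff (by positivity)]; linarith
  have e2 : a'.im = -(isoA u γ τ t).im / (2 * (t + u)) := by
    have := congrArg Complex.im h1
    simp at this
    rw [eq_div_iff (by positivity)]; linarith
  have e3 : b'.re = -(isoB u γ τ t).re / (2 * t) := by
    have := congrArg Complex.re h2
    simp at this
    rw [eq_div_iff (by positivity)]; linarith
  rw [e1, e2, e3] at h5
  have : d = 0 := by
    rw [h5]
    have : t + u ≠ 0 := by positivity
    simp
    field_simp
    rw [hr2]
    ring
  linarith

end Coefficients

/-! ### Smoothness of the coefficients -/

section Smoothness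
variable {u t τ : ℝ} {ε δ : ℝ} {γ : ℝ → ℂ}

theorem contDiffAt_geoMean (hu : 0 < u) (ht : 0 < t) : ContDiffAt ℝ ∞ (geoMean u) t :=
  ContDiffAt.sqrt (f := fun t => t * (t + u)) (by fun_prop) (by positivity)

theorem contDiffAt_profileParam (hu : 0 < u) (ht : 0 < t) : ContDiffAt ℝ ∞ (profileParam u) t := by
  have h0 : 0 < 2 * t + u := by positivity
  have hg := contDiffAt_geoMean hu ht
  have h : ContDiffAt ℝ ∞
      (fun t => √u * (geoMean u t - angleCos u t / (angleSinc u t * geoMean u t))) t :=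
    contDiffAt_const.mul (hg.sub ((contDiffAt_angleCos h0).div ((contDiffAt_angleSinc h0).mul hg)
      (mul_pos (angleSinc_pos hu ht.le) (geoMean_pos hu ht)).ne'))
  exact h.congr_of_eventuallyEq ((eventually_gt_nhds ht).mono fun s hs => profileParam_eq hu hs)

theorem contDiffAt_slope_start (hu : 0 < u) (ht : 0 < 2 * t + u) (hK : 0 < angleSinc u t) :
    ContDiffAt ℝ ∞ (fun t => angleCos u t / (angleSinc u t * (t + u))) t :=
  (contDiffAt_angleCos ht).div ((contDiffAt_angleSinc ht).mul (contDiffAt_id.add contDiffAt_const))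
    (mul_pos hK (by linarith)).ne'

theorem contDiffAt_slope_finish (hu : 0 < u) (hγ : IsRightHandedProfile ε δ γ) (ht : 0 < 2 * t + u)
    (hK : 0 < angleSinc u t) : ContDiffAt ℝ ∞
      (fun t => if t ≤ 0 then angleCos u t / (angleSinc u t * (t + u)) - t
        else t * (γ (profileParam u t)).im / (√u * geoMean u t)) t := by
  have h1 := (contDiffAt_slope_start hu ht hK).sub contDiffAt_id
  rcases lt_trichotomy t 0 with h | rfl | h
  · exact h1.congr_of_eventuallyEq ((eventually_lt_nhds h).mono fun s hs => if_pos hs.le)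
  · -- Near `t = 0` the profile curve runs along the imaginary axis.
    refine h1.congr_of_eventuallyEq ((eventually_profileParam_lt hu (-δ)).mono fun s hs => ?_)
    rcases le_or_gt s 0 with h | h
    · exact if_pos h
    · have hr := geoMean_pos hu h
      have hu' := Real.sqrt_pos.2 hu
      have hK := angleSinc_pos hu h.le
      have hr2 := geoMean_sq hu h.le
      have hsu : s + u ≠ 0 := by positivity
      refine (if_neg (not_le.2 h)).trans ?_
      rw [hγ.imag_end _ (hs h).le, profileParam_eq hu h]
      simp only [Complex.mul_im, Complex.ofReal_re, Complex.ofReal_im, Complex.I_re, Complex.I_im, id]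
      field_simp
      linear_combination (-√u * angleCos u s) * hr2
  · refine ContDiffAt.congr_of_eventuallyEq ?_
      ((eventually_gt_nhds h).mono fun s hs => if_neg (not_le.2 hs))
    exact (contDiffAt_id.mul (Complex.imCLM.contDiff.contDiffAt.comp t
      (hγ.smooth.contDiffAt.comp t (contDiffAt_profileParam hu h)))).div
      (contDiffAt_const.mul (contDiffAt_geoMean hu h))
      (mul_pos (Real.sqrt_pos.2 hu) (geoMean_pos hu h)).ne'

theorem contDiffAt_momentum_finish (hu : 0 < u) (hγ : IsRightHandedProfile ε δ γ) (t : ℝ) :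
    ContDiffAt ℝ ∞
      (fun t => if t ≤ 0 then 0 else √u * (γ (profileParam u t)).re / (t * geoMean u t)) t := by
  have h1 : ContDiffAt ℝ ∞ (fun _ : ℝ => (0 : ℝ)) t := contDiffAt_const
  rcases lt_trichotomy t 0 with h | rfl | h
  · exact h1.congr_of_eventuallyEq ((eventually_lt_nhds h).mono fun s hs => if_pos hs.le)
  · refine h1.congr_of_eventuallyEq ((eventually_profileParam_lt hu (-δ)).mono fun s hs => ?_)
    rcases le_or_gt s 0 with h | h
    · exact if_pos h
    · simp [hγ.imag_end _ (hs h).le]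
  · refine ContDiffAt.congr_of_eventuallyEq ?_
      ((eventually_gt_nhds h).mono fun s hs => if_neg (not_le.2 hs))
    exact (contDiffAt_const.mul (Complex.reCLM.contDiff.contDiffAt.comp t
      (hγ.smooth.contDiffAt.comp t (contDiffAt_profileParam hu h)))).div
      (contDiffAt_id.mul (contDiffAt_geoMean hu h)) (mul_pos h (geoMean_pos hu h)).ne'

variable {x : ℝ × ℝ}

theorem contDiffAt_isoSlope (hu : 0 < u) (hγ : IsRightHandedProfile ε δ γ) (ht : 0 < 2 * x.2 + u)
    (hK : 0 < angleSinc u x.2) : ContDiffAt ℝ ∞ (fun x : ℝ × ℝ => isoSlope u γ x.1 x.2) x :=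
  ((contDiffAt_const.sub contDiffAt_fst).mul
    ((contDiffAt_slope_start hu ht hK).comp x contDiffAt_snd)).add
    (contDiffAt_fst.mul ((contDiffAt_slope_finish hu hγ ht hK).comp x contDiffAt_snd))

theorem contDiffAt_isoMomentum (hu : 0 < u) (hγ : IsRightHandedProfile ε δ γ) (ht : 0 < 2 * x.2 + u) :
    ContDiffAt ℝ ∞ (fun x : ℝ × ℝ => isoMomentum u γ x.1 x.2) x := by
  have h : ContDiffAt ℝ ∞ (fun t => angleSinc u t ^ 2 * (t + u)) x.2 :=
    ((contDiffAt_angleSinc ht).pow 2).mul (contDiffAt_id.add contDiffAt_const)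
  exact ((contDiffAt_const.sub contDiffAt_fst).mul (h.comp x contDiffAt_snd)).add
    (contDiffAt_fst.mul ((contDiffAt_momentum_finish hu hγ x.2).comp x contDiffAt_snd))

theorem contDiffAt_isoNorm (hu : 0 < u) (hγ : IsRightHandedProfile ε δ γ) (ht : 0 < 2 * x.2 + u)
    (hK : 0 < angleSinc u x.2) : ContDiffAt ℝ ∞ (fun x : ℝ × ℝ => isoNorm u γ x.1 x.2) x :=
  contDiffAt_snd.add (((contDiffAt_isoSlope hu hγ ht hK).pow 2).mul
    (contDiffAt_snd.add contDiffAt_const))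

theorem contDiffAt_isoDisc (hu : 0 < u) (hγ : IsRightHandedProfile ε δ γ) (ht : 0 < 2 * x.2 + u)
    (hK : 0 < angleSinc u x.2) : ContDiffAt ℝ ∞ (fun x : ℝ × ℝ => isoDisc u γ x.1 x.2) x := by
  have hN := contDiffAt_isoNorm hu hγ ht hK
  exact contDiffAt_const.add ((contDiffAt_const.mul hN).mul (hN.mul
    ((((contDiffAt_isoMomentum hu hγ ht).pow 2).mul contDiffAt_snd).mul
      (contDiffAt_snd.add contDiffAt_const))))

/-- The coefficients of the isotopy are smooth on a neighborhood of the set of all `(τ, t)` with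
`t ≥ 0`. -/
theorem eventually_contDiffAt_iso (hu : 0 < u) (hγ : IsRightHandedProfile ε δ γ) (hx : 0 ≤ x.2) :
    ∀ᶠ y in nhds x, ContDiffAt ℝ ∞ (fun y : ℝ × ℝ => isoA u γ y.1 y.2) y ∧
      ContDiffAt ℝ ∞ (fun y : ℝ × ℝ => isoB u γ y.1 y.2) y := by
  have ht : 0 < 2 * x.2 + u := by linarith
  have hK := angleSinc_pos hu hx
  have e1 : ∀ᶠ y : ℝ × ℝ in nhds x, 0 < 2 * y.2 + u :=
    (show ContinuousAt (fun y : ℝ × ℝ => 2 * y.2 + u) x by fun_prop).eventually (lt_mem_nhds ht)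
  have e2 : ∀ᶠ y : ℝ × ℝ in nhds x, 0 < angleSinc u y.2 :=
    ((contDiffAt_angleSinc ht).continuousAt.comp (x := x) continuousAt_snd).eventually
      (lt_mem_nhds hK)
  have e3 := (contDiffAt_isoNorm hu hγ ht hK).continuousAt.eventually
    (lt_mem_nhds (isoNorm_pos hu hx))
  have e4 := (contDiffAt_isoDisc hu hγ ht hK).continuousAt.eventually
    (lt_mem_nhds (isoDisc_pos hu hx))
  filter_upwards [e1, e2, e3, e4] with y h1 h2 h3 h4
  have hS : ContDiffAt ℝ ∞ (fun y : ℝ × ℝ => isoScale u γ y.1 y.2) y := by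
    refine ContDiffAt.sqrt ((contDiffAt_const.add
      ((contDiffAt_isoDisc hu hγ h1 h2).sqrt h4.ne')).div
      (contDiffAt_const.mul (contDiffAt_isoNorm hu hγ h1 h2)) (by positivity)) ?_
    have : 0 ≤ √(isoDisc u γ y.1 y.2) := Real.sqrt_nonneg _
    positivity
  have hS0 := (isoScale_pos hu h3).ne'
  have hG := contDiffAt_isoSlope hu hγ h1 h2
  have hF := contDiffAt_isoMomentum hu hγ h1
  have hc : ∀ {f : ℝ × ℝ → ℝ}, ContDiffAt ℝ ∞ f y → ContDiffAt ℝ ∞ (fun y => (f y : ℂ)) y :=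
    fun hf => Complex.ofRealCLM.contDiff.contDiffAt.comp y hf
  exact ⟨(hc (hS.mul hG).neg).add ((hc ((hF.mul contDiffAt_snd).div hS hS0)).mul contDiffAt_const),
    (hc hS).add ((hc (((hF.mul hG).mul (contDiffAt_snd.add contDiffAt_const)).div hS hS0)).mul
      contDiffAt_const)⟩

end Smoothness

/-! ### The isotopy -/

section Isotopy
variable {k m : ℕ} {u t τ : ℝ} {ε δ : ℝ} {γ : ℝ → ℂ}

theorem sum_head_re_sq (a b : ℂ) (w : Fin (k + m) → ℝ) :
    ∑ i : Fin k, (twist a b w (Fin.castAdd m i)).re ^ 2 = a.re ^ 2 * headSq k m w := by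
  simp [headSq, Finset.mul_sum, mul_pow]

theorem sum_head_im_sq (a b : ℂ) (w : Fin (k + m) → ℝ) :
    ∑ i : Fin k, (twist a b w (Fin.castAdd m i)).im ^ 2 = a.im ^ 2 * headSq k m w := by
  simp [headSq, Finset.mul_sum, mul_pow]

theorem sum_tail_re_sq (a b : ℂ) (w : Fin (k + m) → ℝ) :
    ∑ i : Fin m, (twist a b w (Fin.natAdd k i)).re ^ 2 = b.re ^ 2 * tailSq k m w := by
  simp [tailSq, Finset.mul_sum, mul_pow]

theorem contDiff_headSq : ContDiff ℝ ∞ (headSq k m) :=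
  ContDiff.sum fun _ _ => (contDiff_apply ℝ ℝ _).pow 2

theorem isClosed_transportLag (hu : 0 < u) : IsClosed (transportLag k m u) := by
  have hC : IsClosed {z : CSpace (k + m) | u ≤ ‖z‖ ^ 2} := isClosed_le continuous_const (by fun_prop)
  have hne : ∀ z : CSpace (k + m), u ≤ ‖z‖ ^ 2 → z ≠ 0 := by
    rintro _ h rfl
    norm_num at h
    linarith
  have hI : ContinuousOn (transportInv (k := k) (m := m) u) {z | u ≤ ‖z‖ ^ 2} := fun z hz =>
    (contDiffAt_transportInv (hne z hz)).continuousAt.continuousWithinAt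
  have hT : Continuous (transportMap (k := k) (m := m) u) := continuous_iff_continuousAt.2 fun w => by
    have ht : 0 < 2 * tailSq k m w + u := by have := tailSq_nonneg w; linarith
    exact (contDiffAt_twist ((contDiffAt_transportA ht).comp w contDiff_tailSq.contDiffAt)
      ((contDiffAt_transportB ht).comp w contDiff_tailSq.contDiffAt) contDiffAt_id).continuousAt
  have hP := ((hT.comp_continuousOn hI).sub continuousOn_id).prodMk
    ((contDiff_headSq.continuous.comp_continuousOn hI).sub
      (contDiff_tailSq.continuous.comp_continuousOn hI))
  convert hP.preimage_isClosed_of_isClosed hC (isClosed_singleton (x := ((0 : CSpace (k + m)), u)))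
  ext z
  simp only [Set.mem_inter_iff, Set.mem_preimage, Set.mem_singleton_iff, Prod.mk.injEq]
  constructor
  · intro hz
    obtain ⟨h1, h2, h3, -⟩ := mem_transportLag hu hz
    have h1' : headSq k m _ = _ := h1
    refine ⟨?_, sub_eq_zero.2 h2, by simp [h1']⟩
    have := tailSq_nonneg (transportInv u z)
    rw [tailParam] at h3
    change u ≤ _
    linarith
  · rintro ⟨-, h2, h3⟩
    exact ⟨transportInv u z, eq_add_of_sub_eq' h3, sub_eq_zero.1 h2⟩

/-- The isotopy from the transported Lagrangian to the one whose profile is `γ`. -/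
def transportIsotopy (k m : ℕ) (u : ℝ) (γ : ℝ → ℂ) (x : ℝ × CSpace (k + m)) : CSpace (k + m) :=
  twist (isoA u γ x.1 (tailParam u x.2)) (isoB u γ x.1 (tailParam u x.2)) (transportInv u x.2)

theorem transportIsotopy_eq (hu : 0 < u) {z : CSpace (k + m)} (hz : z ∈ transportLag k m u) :
    transportIsotopy k m u γ (τ, z) = twist (isoA u γ τ (tailSq k m (transportInv u z)))
      (isoB u γ τ (tailSq k m (transportInv u z))) (transportInv u z) := by
  rw [transportIsotopy, (mem_transportLag hu hz).2.2.1]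

theorem eventually_contDiffAt_transportIsotopy (hu : 0 < u) (hγ : IsRightHandedProfile ε δ γ)
    {x : ℝ × CSpace (k + m)} (hx : x.2 ∈ transportLag k m u) :
    ∀ᶠ y in nhds x, ContDiffAt ℝ ∞ (transportIsotopy k m u γ) y := by
  obtain ⟨-, -, h1, h2⟩ := mem_transportLag hu hx
  have hp : ∀ y : ℝ × CSpace (k + m),
      ContDiffAt ℝ ∞ (fun y : ℝ × CSpace (k + m) => (y.1, tailParam u y.2)) y := fun y =>
    contDiffAt_fst.prodMk ((contDiffAt_tailParam y.2).comp y contDiffAt_snd)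
  have h0 : 0 ≤ tailParam u x.2 := h1.symm ▸ tailSq_nonneg _
  have e1 := (hp x).continuousAt.eventually
    (eventually_contDiffAt_iso hu hγ (x := (x.1, tailParam u x.2)) h0)
  have e2 : ∀ᶠ y : ℝ × CSpace (k + m) in nhds x, y.2 ≠ 0 := continuousAt_snd.eventually_ne h2
  filter_upwards [e1, e2] with y h3 h4
  have hA : ContDiffAt ℝ ∞ (fun y : ℝ × CSpace (k + m) => isoA u γ y.1 (tailParam u y.2)) y :=
    h3.1.comp (f := fun y : ℝ × CSpace (k + m) => (y.1, tailParam u y.2)) y (hp y)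
  have hB : ContDiffAt ℝ ∞ (fun y : ℝ × CSpace (k + m) => isoB u γ y.1 (tailParam u y.2)) y :=
    h3.2.comp (f := fun y : ℝ × CSpace (k + m) => (y.1, tailParam u y.2)) y (hp y)
  have hI : ContDiffAt ℝ ∞ (fun y : ℝ × CSpace (k + m) => transportInv u y.2) y :=
    ContDiffAt.comp y (contDiffAt_transportInv h4) contDiffAt_snd
  exact contDiffAt_twist hA hB hI

theorem hasDerivAt_iso (hu : 0 < u) (hγ : IsRightHandedProfile ε δ γ) (ht : 0 ≤ t) :
    ∃ a' b', HasDerivAt (isoA u γ τ) a' t ∧ HasDerivAt (isoB u γ τ) b' t := by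
  obtain ⟨h1, h2⟩ := (eventually_contDiffAt_iso hu hγ (x := (τ, t)) ht).self_of_nhds
  have hp : ContDiffAt ℝ ∞ (fun t : ℝ => (τ, t)) t := contDiffAt_const.prodMk contDiffAt_id
  exact ⟨_, _, ((h1.comp t hp).differentiableAt (by simp)).hasDerivAt,
    ((h2.comp t hp).differentiableAt (by simp)).hasDerivAt⟩

theorem isoProfile_eq_sqrt (hu : 0 < u) (hγ : IsRightHandedProfile ε δ γ) (ht : 0 < t)
    (hτ : τ ∈ Set.Icc (0 : ℝ) 1) :
    (isoProfile u γ τ t).re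
        = √((isoA u γ τ t).im ^ 2 * (t + u) * ((isoB u γ τ t).re ^ 2 * t) / u) ∧
      (isoProfile u γ τ t).im
        = √(u * ((isoA u γ τ t).re ^ 2 * (t + u)) / ((isoB u γ τ t).re ^ 2 * t)) := by
  obtain ⟨h1, h2, -⟩ := isoProfile_nonneg hu hγ ht hτ
  have hB := isoB_re_pos (γ := γ) (τ := τ) hu ht.le
  have hr2 := geoMean_sq hu ht.le
  have hu2 := Real.sq_sqrt hu.le
  constructor
  · rw [eq_comm, Real.sqrt_eq_iff_eq_sq (by positivity) h1, isoProfile_re_eq hu ht, div_pow, hu2,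
      mul_pow, mul_pow, hr2]
    ring
  · rw [eq_comm, Real.sqrt_eq_iff_eq_sq (by positivity) h2, isoProfile_im_eq hu ht, neg_sq, div_pow,
      mul_pow, mul_pow, mul_pow, hu2, hr2]
    field_simp

/-- The image point determines the profile point, by `isoProfile_eq_sqrt`, hence the parameter `t`, by
monotonicity. -/
theorem injOn_transportIsotopy (hu : 0 < u) (hγ : IsRightHandedProfile ε δ γ)
    (hτ : τ ∈ Set.Icc (0 : ℝ) 1) :
    Set.InjOn (fun z => transportIsotopy k m u γ (τ, z)) (transportLag k m u) := by
  intro z hz z' hz' h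
  simp only [transportIsotopy_eq hu hz, transportIsotopy_eq hu hz'] at h
  obtain ⟨hw, e, -⟩ := mem_transportLag hu hz
  obtain ⟨hw', e', -⟩ := mem_transportLag hu hz'
  rw [← e, ← e']
  generalize transportInv u z = w at *
  generalize transportInv u z' = w' at *
  have hw₁ : headSq k m w = tailSq k m w + u := hw
  have hw₁' : headSq k m w' = tailSq k m w' + u := hw'
  have ht := tailSq_nonneg w
  have ht' := tailSq_nonneg w'
  have s1 := congrArg (fun Z : CSpace (k + m) => ∑ i : Fin k, (Z (Fin.castAdd m i)).re ^ 2) h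
  have s2 := congrArg (fun Z : CSpace (k + m) => ∑ i : Fin k, (Z (Fin.castAdd m i)).im ^ 2) h
  have s3 := congrArg (fun Z : CSpace (k + m) => ∑ i : Fin m, (Z (Fin.natAdd k i)).re ^ 2) h
  simp only [sum_head_re_sq, sum_head_im_sq, sum_tail_re_sq, hw₁, hw₁'] at s1 s2 s3
  have hB := isoB_re_pos (γ := γ) (τ := τ) hu ht
  have hB' := isoB_re_pos (γ := γ) (τ := τ) hu ht'
  have htt : tailSq k m w = tailSq k m w' := by
    rcases ht.eq_or_lt with h0 | h0
    · rw [← h0, mul_zero, eq_comm, mul_eq_zero] at s3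
      rw [← h0, s3.resolve_left (by positivity)]
    · have h0' : 0 < tailSq k m w' := by
        have : 0 < (isoB u γ τ (tailSq k m w')).re ^ 2 * tailSq k m w' := by rw [← s3]; positivity
        exact pos_of_mul_pos_right this (by positivity)
      refine (strictMonoOn_isoProfile hu hγ hτ).injOn h0 h0' ?_
      rw [(isoProfile_eq_sqrt hu hγ h0 hτ).1, (isoProfile_eq_sqrt hu hγ h0 hτ).2,
        (isoProfile_eq_sqrt hu hγ h0' hτ).1, (isoProfile_eq_sqrt hu hγ h0' hτ).2, s1, s2, s3]
  have hA0 := isoA_ne_zero hu hγ ht' hτ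
  have hB0 := isoB_ne_zero (γ := γ) (τ := τ) hu ht'
  rw [htt] at h
  have hww : w = w' := by
    ext j
    have hj := congrArg (fun Z : CSpace (k + m) => Z j) h
    refine Fin.addCases (fun i hj => ?_) (fun i hj => ?_) j hj
    · simp only [twist_castAdd] at hj
      exact_mod_cast mul_left_cancel₀ hA0 hj
    · simp only [twist_natAdd] at hj
      exact_mod_cast mul_left_cancel₀ hB0 hj
  rw [hww]

/-- The real part of the profile bounds the norm from below. -/
theorem two_mul_isoProfile_re_le (hu : 0 < u) {z : CSpace (k + m)} (hz : z ∈ transportLag k m u)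
    (ht : 0 < tailSq k m (transportInv u z)) :
    2 * √u * (isoProfile u γ τ (tailSq k m (transportInv u z))).re
      ≤ ‖transportIsotopy k m u γ (τ, z)‖ ^ 2 := by
  have hw : headSq k m _ = _ := (mem_transportLag hu hz).1
  rw [transportIsotopy_eq hu hz, norm_sq_twist, hw, isoProfile_re_eq hu ht]
  generalize tailSq k m (transportInv u z) = t at *
  have hu' := Real.sqrt_pos.2 hu
  have hr2 := geoMean_sq hu ht.le
  have hst := Real.sq_sqrt ht.le
  have hsu := Real.sq_sqrt (show 0 ≤ t + u by linarith)
  have hr : geoMean u t = √t * √(t + u) := Real.sqrt_mul ht.le _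
  rw [hr]
  have h1 := sq_nonneg ((isoA u γ τ t).im * √(t + u) - (isoB u γ τ t).re * √t)
  have e : 2 * √u * ((isoA u γ τ t).im * (isoB u γ τ t).re * (√t * √(t + u)) / √u)
      = 2 * ((isoA u γ τ t).im * √(t + u) * ((isoB u γ τ t).re * √t)) := by
    field_simp
  rw [e, Complex.normSq_apply, Complex.normSq_apply]
  have h2 : 0 ≤ (isoA u γ τ t).re ^ 2 * (t + u) := by positivity
  have h3 : 0 ≤ (isoB u γ τ t).im ^ 2 * t := by positivity
  nlinarith

theorem isCompact_transportIsotopy_preimage (hu : 0 < u) (hγ : IsRightHandedProfile ε δ γ)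
    {K : Set (CSpace (k + m))} (hK : IsCompact K) :
    IsCompact {x : ℝ × CSpace (k + m) | x.1 ∈ Set.Icc (0 : ℝ) 1 ∧ x.2 ∈ transportLag k m u ∧
      transportIsotopy k m u γ x ∈ K} := by
  have hu' := Real.sqrt_pos.2 hu
  obtain ⟨R, hR⟩ := hK.isBounded.subset_closedBall (0 : CSpace (k + m))
  obtain ⟨T, hT⟩ := exists_isoProfile_large hu hγ (R ^ 2 / (2 * √u))
  let C : Set (ℝ × CSpace (k + m)) := Set.Icc (0 : ℝ) 1 ×ˢ
    (Metric.closedBall 0 (√(2 * |T| + u)) ∩ transportLag k m u)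
  have hC : IsCompact C :=
    isCompact_Icc.prod ((isCompact_closedBall _ _).inter_right (isClosed_transportLag hu))
  have hc : ContinuousOn (transportIsotopy k m u γ) C := fun x hx =>
    (eventually_contDiffAt_transportIsotopy hu hγ
      hx.2.2).self_of_nhds.continuousAt.continuousWithinAt
  convert hC.of_isClosed_subset (hc.preimage_isClosed_of_isClosed hC.isClosed hK.isClosed)
    Set.inter_subset_left
  ext x
  refine ⟨fun ⟨h1, h2, h3⟩ => ⟨⟨h1, ?_, h2⟩, h3⟩, fun ⟨⟨h1, _, h2⟩, h3⟩ => ⟨h1, h2, h3⟩⟩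
  have ht : tailSq k m (transportInv u x.2) ≤ |T| := by
    by_contra! hlt
    have h0 := (abs_nonneg T).trans_lt hlt
    have h4 := hT _ ((le_abs_self T).trans hlt.le) h0 x.1 h1
    have h5 := two_mul_isoProfile_re_le (γ := γ) (τ := x.1) hu h2 h0
    have h6 : ‖transportIsotopy k m u γ x‖ ≤ R := by simpa using hR h3
    rw [div_lt_iff₀' (by positivity)] at h4
    exact absurd (h4.trans_le h5) (not_lt.2 (pow_le_pow_left₀ (norm_nonneg _) h6 2))
  rw [mem_closedBall_zero_iff]
  refine Real.le_sqrt_of_sq_le ?_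
  have := (mem_transportLag hu h2).2.2.1
  rw [tailParam] at this
  linarith

theorem isLagrangianIsotopy_transportIsotopy (hu : 0 < u) (hγ : IsRightHandedProfile ε δ γ) :
    IsLagrangianIsotopy (quadFiber (k + m) (u : ℂ)) (transportLag k m u)
      ((fun z => transportIsotopy k m u γ (1, z)) '' transportLag k m u)
      (transportIsotopy k m u γ) := by
  have hdiff : ∀ τ, ∀ z ∈ transportLag k m u,
      DifferentiableAt ℝ (fun y => transportIsotopy k m u γ (τ, y)) z := fun τ z hz =>
    ((eventually_contDiffAt_transportIsotopy hu hγ (x := (τ, z)) hz).self_of_nhds.comp z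
      (contDiffAt_const.prodMk contDiffAt_id)).differentiableAt (by simp)
  refine ⟨⟨{x | ∀ᶠ y in nhds x, ContDiffAt ℝ ∞ (transportIsotopy k m u γ) y},
      isOpen_setOfPred_eventually_nhds,
      fun x hx => eventually_contDiffAt_transportIsotopy hu hγ hx.2,
      fun x hx => (Filter.Eventually.self_of_nhds hx).contDiffWithinAt⟩,
    fun τ hτ z hz => ?_, fun τ hτ => injOn_transportIsotopy hu hγ hτ, fun τ hτ z hz ξ hξ h0 => ?_,
    fun τ hτ z hz ξ hξ η hη => ?_, fun K hK => isCompact_transportIsotopy_preimage hu hγ hK,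
    fun z hz => ?_, rfl⟩
  · have hw : headSq k m _ = _ := (mem_transportLag hu hz).1
    change quadH _ = _
    rw [transportIsotopy_eq hu hz, quadH_twist, hw, ← iso_fiber (γ := γ) (τ := τ) hu (tailSq_nonneg _)]
    push_cast
    rfl
  · obtain ⟨c, w₁, t₁, -, -, -, -, h⟩ := exists_isTwistVelocity hu hz hξ
    obtain ⟨a', b', ha, hb⟩ := hasDerivAt_iso (τ := τ) hu hγ (tailSq_nonneg (transportInv u z))
    have hV := h _ _ a' b' _ (hdiff τ z hz) (fun y hy => transportIsotopy_eq hu hy) ha hb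
    rw [h0] at hV
    have hw : headSq k m _ = _ := (mem_transportLag hu hz).1
    obtain ⟨rfl, rfl⟩ := hV.eq_zero (isoA_ne_zero hu hγ (tailSq_nonneg _) hτ)
      (isoB_ne_zero hu (tailSq_nonneg _)) fun ht h1 h2 => by
        rw [hw] at h1
        exact iso_nondegenerate hu hγ ht hτ ha hb h1 h2
    have hS := IsTwistVelocity.of_self hu h
    ext j
    exact Fin.addCases (fun i => by rw [hS.head]; simp) (fun i => by rw [hS.tail]; simp) j
  · obtain ⟨-, w₁, t₁, -, -, -, -, h⟩ := exists_isTwistVelocity hu hz hξ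
    obtain ⟨-, w₂, t₂, -, -, -, -, g⟩ := exists_isTwistVelocity hu hz hη
    obtain ⟨a', b', ha, hb⟩ := hasDerivAt_iso (τ := τ) hu hγ (tailSq_nonneg (transportInv u z))
    exact (h _ _ a' b' _ (hdiff τ z hz) (fun y hy => transportIsotopy_eq hu hy) ha hb).stdOmega_eq_zero
      (g _ _ a' b' _ (hdiff τ z hz) (fun y hy => transportIsotopy_eq hu hy) ha hb)
  · obtain ⟨h1, h2⟩ := iso_start (γ := γ) hu (tailSq_nonneg (transportInv u z))
    rw [transportIsotopy_eq hu hz, h1, h2]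
    exact (mem_transportLag hu hz).2.1

end Isotopy

/-! ### The end of the isotopy -/

section Finish
variable {k m : ℕ} {u t τ : ℝ} {ε δ : ℝ} {γ : ℝ → ℂ}

/-- The unit vector in the direction of minus the first `k` coordinates of `w`. -/
def headUnit (u : ℝ) (w : Fin (k + m) → ℝ) : CSpace k :=
  WithLp.toLp 2 fun i => ((-(w (Fin.castAdd m i) / √(tailSq k m w + u)) : ℝ) : ℂ)

/-- The point of the sphere of radius `√u` in the direction of the last coordinates of `w`. -/
def tailUnit (u : ℝ) (w : Fin (k + m) → ℝ) : CSpace (k + m) :=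
  WithLp.toLp 2 (Fin.addCases (fun _ => 0)
    fun i => ((√u / √(tailSq k m w) * w (Fin.natAdd k i) : ℝ) : ℂ))

theorem headUnit_apply (w : Fin (k + m) → ℝ) (i : Fin k) :
    headUnit u w i = ((-(w (Fin.castAdd m i) / √(tailSq k m w + u)) : ℝ) : ℂ) := rfl

theorem tailUnit_natAdd (w : Fin (k + m) → ℝ) (i : Fin m) :
    tailUnit u w (Fin.natAdd k i) = ((√u / √(tailSq k m w) * w (Fin.natAdd k i) : ℝ) : ℂ) := by
  simp [tailUnit]

theorem isRealVec_headUnit (w : Fin (k + m) → ℝ) : IsRealVec (headUnit u w) := fun i => by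
  rw [headUnit_apply, Complex.ofReal_im]

theorem norm_headUnit (hu : 0 < u) {w : Fin (k + m) → ℝ} (hw : w ∈ hyperboloid k m u) :
    ‖headUnit u w‖ = 1 := by
  have hw' : headSq k m w = tailSq k m w + u := hw
  have ht := tailSq_nonneg w
  have h0 : 0 < tailSq k m w + u := by linarith
  rw [← sq_eq_sq₀ (norm_nonneg _) zero_le_one, EuclideanSpace.norm_sq_eq]
  simp only [headUnit_apply, Complex.norm_real, Real.norm_eq_abs, sq_abs, neg_sq, div_pow,
    Real.sq_sqrt h0.le, ← Finset.sum_div]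
  rw [show ∑ i : Fin k, w (Fin.castAdd m i) ^ 2 = _ from hw', div_self h0.ne', one_pow]

theorem tailUnit_mem (hu : 0 < u) {w : Fin (k + m) → ℝ} (ht : 0 < tailSq k m w) :
    tailUnit u w ∈ coreSphere k m u := by
  refine ⟨fun i => by simp [tailUnit], fun i => by rw [tailUnit_natAdd, Complex.ofReal_im], ?_⟩
  simp only [tailUnit_natAdd, Complex.ofReal_re, mul_pow, div_pow, Real.sq_sqrt hu.le,
    Real.sq_sqrt ht.le, ← Finset.mul_sum]
  exact div_mul_cancel₀ _ ht.ne'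

theorem zero_mem_coreTangent (q : CSpace (k + m)) : (0 : CSpace (k + m)) ∈ coreTangent k m q :=
  ⟨fun _ => rfl, fun _ => rfl, by simp⟩

/-- In the surgery chart, the Lagrangians swept out by the rotations of a curve are handles. -/
theorem twist_eq_surgeryChart (hu : 0 < u) {A B c : ℂ} {w : Fin (k + m) → ℝ}
    (hw : w ∈ hyperboloid k m u) (ht : 0 < tailSq k m w)
    (hAB : A ^ 2 * (tailSq k m w + u) + B ^ 2 * tailSq k m w = u) (hB : 0 < B.re)
    (hre : c.re = A.im * B.re * geoMean u (tailSq k m w) / √u)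
    (him : c.im = -(√u * geoMean u (tailSq k m w) * A.re / (tailSq k m w * B.re))) :
    twist A B w = surgeryChart u (c • headUnit u w, tailUnit u w, 0) := by
  have hw' : headSq k m w = tailSq k m w + u := hw
  have hmem : twist A B w ∈ quadFiber (k + m) (u : ℂ) := by
    change quadH _ = _
    rw [quadH_twist, hw', ← hAB]
    push_cast
    rfl
  have hr : geoMean u (tailSq k m w) = √(tailSq k m w) * √(tailSq k m w + u) :=
    Real.sqrt_mul ht.le _
  have hu' := Real.sqrt_pos.2 hu
  have hst := Real.sqrt_pos.2 ht
  have hsu := Real.sqrt_pos.2 (show 0 < tailSq k m w + u by linarith)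
  have hst2 := Real.sq_sqrt ht.le
  have hu2 := Real.sq_sqrt hu.le
  have hμ : tailScale k m u (twist A B w) = B.re * √(tailSq k m w) / √u := by
    rw [tailScale, ← Finset.sum_div, sum_tail_re_sq, Real.sqrt_div (by positivity),
      Real.sqrt_mul (by positivity), Real.sqrt_sq hB.le]
  obtain ⟨-, -, h⟩ := surgeryChartInv_mem hu hmem (by rw [hμ]; positivity)
  have him0 : A.re * A.im * (tailSq k m w + u) + B.re * B.im * tailSq k m w = 0 := by
    have := congrArg Complex.im hAB
    simp [sq] at this
    linarith
  have hI : ∀ a b : ℝ, ((a : ℂ) + (b : ℂ) * Complex.I).re = a ∧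
      ((a : ℂ) + (b : ℂ) * Complex.I).im = b := fun a b => by simp
  rw [← h]
  congr 1
  refine Prod.ext ?_ (Prod.ext ?_ ?_)
  · ext i
    simp only [surgeryChartInv, hμ, twist_castAdd, PiLp.smul_apply, headUnit_apply, smul_eq_mul]
    refine Complex.ext ?_ ?_
    · rw [(hI _ _).1, Complex.re_mul_ofReal, hre, Complex.im_mul_ofReal, hr]
      field_simp
    · rw [(hI _ _).2, Complex.im_mul_ofReal, him, Complex.re_mul_ofReal, hr]
      field_simp
      rw [hst2]
  · ext j
    refine Fin.addCases (fun i => ?_) (fun i => ?_) j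
    · simp [surgeryChartInv, tailUnit]
    · rw [tailUnit_natAdd]
      simp only [surgeryChartInv, hμ, twist_natAdd, Fin.addCases_right]
      congr 1
      simp
      field_simp
  · have hs : ∑ l : Fin k, (twist A B w (Fin.castAdd m l)).re * (twist A B w (Fin.castAdd m l)).im
        = A.re * A.im * (tailSq k m w + u) := by
      rw [← hw', headSq, Finset.mul_sum]
      exact Finset.sum_congr rfl fun l _ => by simp; ring
    ext j
    refine Fin.addCases (fun i => ?_) (fun i => ?_) j
    · simp [surgeryChartInv]
    · simp only [surgeryChartInv, hμ, hs, Fin.addCases_right, PiLp.zero_apply]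
      rw [Complex.ofReal_eq_zero]
      simp
      field_simp
      rw [hst2, hu2]
      linear_combination (-u * w (Fin.natAdd k i)) * him0

theorem tailScale_eq_zero_iff (hu : 0 < u) {z : CSpace (k + m)} :
    tailScale k m u z = 0 ↔ ∀ i : Fin m, (z (Fin.natAdd k i)).re = 0 := by
  have h := sq_tailScale hu z
  constructor
  · intro h0
    rw [h0] at h
    simp only [ne_eq, OfNat.ofNat_ne_zero, not_false_eq_true, zero_pow, mul_zero] at h
    rw [Finset.sum_eq_zero_iff_of_nonneg fun i _ => sq_nonneg _] at h
    exact fun i => pow_eq_zero_iff two_ne_zero |>.1 (h i (Finset.mem_univ i))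
  · intro h0
    simp [tailScale, h0]

theorem isoA_zero_re_sq (hu : 0 < u) : (isoA u γ τ 0).im = 0 ∧ (isoA u γ τ 0).re ^ 2 = 1 := by
  have h1 : (isoA u γ τ 0).im = 0 := by rw [isoA_im]; simp
  refine ⟨h1, ?_⟩
  have h := congrArg Complex.re (iso_fiber (γ := γ) (τ := τ) hu le_rfl)
  simp [sq, h1] at h
  rw [sq]
  exact mul_right_cancel₀ hu.ne' (h.trans (one_mul u).symm)

theorem isoProfile_one : isoProfile u γ 1 t = γ (profileParam u t) := by simp [isoProfile]

theorem tailSq_eq_zero {w : Fin (k + m) → ℝ} (h : tailSq k m w = 0) :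
    ∀ i : Fin m, w (Fin.natAdd k i) = 0 := fun i =>
  pow_eq_zero_iff two_ne_zero |>.1
    ((Finset.sum_eq_zero_iff_of_nonneg fun _ _ => sq_nonneg _).1 h i (Finset.mem_univ i))

/-- The end of the isotopy consists of the handle with profile `γ`, extended to infinity, and of the
points of the vanishing cycle which do not belong to the chart. -/
theorem mem_image_transportIsotopy_iff (hu : 0 < u) {z : CSpace (k + m)} :
    z ∈ (fun z => transportIsotopy k m u γ (1, z)) '' transportLag k m u ↔
      (z ∈ vanishingCycle (k + m) u ∧ tailScale k m u z = 0) ∨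
      ∃ (s : ℝ) (e : CSpace k) (q : CSpace (k + m)), IsRealVec e ∧ ‖e‖ = 1 ∧ q ∈ coreSphere k m u ∧
        z = surgeryChart u (γ s • e, q, 0) := by
  have himage : z ∈ (fun z => transportIsotopy k m u γ (1, z)) '' transportLag k m u ↔
      ∃ w ∈ hyperboloid k m u, twist (isoA u γ 1 (tailSq k m w)) (isoB u γ 1 (tailSq k m w)) w = z := by
    rw [transportLag, Set.image_image]
    refine exists_congr fun w => and_congr_right fun hw => ?_
    change transportIsotopy k m u γ (1, transportMap u w) = z ↔ _
    rw [transportIsotopy_eq hu (Set.mem_image_of_mem _ hw), transportInv_transportMap hu hw]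
  have hchart : ∀ w ∈ hyperboloid k m u, 0 < tailSq k m w →
      twist (isoA u γ 1 (tailSq k m w)) (isoB u γ 1 (tailSq k m w)) w
        = surgeryChart u (γ (profileParam u (tailSq k m w)) • headUnit u w, tailUnit u w, 0) :=
    fun w hw ht => by
      rw [← isoProfile_one (u := u) (γ := γ)]
      exact twist_eq_surgeryChart hu hw ht (by simpa using iso_fiber (γ := γ) (τ := 1) hu ht.le)
        (isoB_re_pos hu ht.le) (isoProfile_re_eq hu ht) (isoProfile_im_eq hu ht)
  rw [himage]
  obtain ⟨hA1, hA2⟩ := isoA_zero_re_sq (γ := γ) (τ := 1) hu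
  constructor
  · rintro ⟨w, hw, rfl⟩
    rcases (tailSq_nonneg w).eq_or_lt with h0 | h0
    · have hw0 := tailSq_eq_zero h0.symm
      rw [← h0]
      refine Or.inl ⟨⟨?_, ?_⟩, ?_⟩
      · have hw' : headSq k m w = tailSq k m w + u := hw
        rw [quadH_twist, hw', ← h0, ← iso_fiber (γ := γ) (τ := 1) hu le_rfl]
        push_cast
        rfl
      · exact Fin.addCases (fun i => by simp [hA1]) (fun i => by simp [hw0])
      · rw [tailScale_eq_zero_iff hu]
        exact fun i => by simp [hw0]
    · exact Or.inr ⟨_, _, _, isRealVec_headUnit w, norm_headUnit hu hw, tailUnit_mem hu h0, hchart w hw h0⟩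
  · rintro (⟨⟨h1, h2⟩, h3⟩ | ⟨s, e, q, he, hn, hq, rfl⟩)
    · rw [tailScale_eq_zero_iff hu] at h3
      set a := (isoA u γ 1 0).re with ha
      have ha0 : a ≠ 0 := by rintro h; rw [h] at hA2; norm_num at hA2
      let w : Fin (k + m) → ℝ := Fin.addCases (fun i => (z (Fin.castAdd m i)).re / a) fun _ => 0
      have hw1 : ∀ i : Fin k, w (Fin.castAdd m i) = (z (Fin.castAdd m i)).re / a := fun i => by simp [w]
      have hw2 : ∀ i : Fin m, w (Fin.natAdd k i) = 0 := fun i => by simp [w]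
      have ht : tailSq k m w = 0 := by simp [tailSq, hw2]
      refine ⟨w, ?_, ?_⟩
      · change headSq k m w = _
        have h5 := (quadH_eq_iff.1 h1).1
        rw [Fin.sum_univ_add] at h5
        simp only [h2, h3] at h5
        rw [ht, headSq]
        simp only [hw1, div_pow, hA2, div_one]
        simpa using h5
      · rw [ht]
        ext j
        refine Fin.addCases (fun i => ?_) (fun i => ?_) j
        · rw [twist_castAdd, hw1]
          refine Complex.ext ?_ ?_
          · simp [← ha]; field_simp
          · simp [hA1, h2]
        · rw [twist_natAdd, hw2]
          exact Complex.ext (by simp [h3]) (by simp [h2])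
    · obtain ⟨t, ht, rfl⟩ := exists_profileParam_eq hu s
      let w : Fin (k + m) → ℝ := Fin.addCases (fun i => -(√(t + u) * (e i).re))
        fun i => √t / √u * (q (Fin.natAdd k i)).re
      have hu' := Real.sqrt_pos.2 hu
      have hst := Real.sqrt_pos.2 ht
      have htu : 0 < t + u := by linarith
      have hsu := Real.sqrt_pos.2 htu
      have hw1 : ∀ i : Fin k, w (Fin.castAdd m i) = -(√(t + u) * (e i).re) := fun i => by simp [w]
      have hw2 : ∀ i : Fin m, w (Fin.natAdd k i) = √t / √u * (q (Fin.natAdd k i)).re :=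
        fun i => by simp [w]
      have hwt : tailSq k m w = t := by
        simp only [tailSq, hw2, mul_pow, div_pow, Real.sq_sqrt ht.le, Real.sq_sqrt hu.le,
          ← Finset.mul_sum, hq.2.2]
        exact div_mul_cancel₀ _ hu.ne'
      have hwh : headSq k m w = t + u := by
        have hn2 : ∑ i, (e i).re ^ 2 = 1 := by
          have := EuclideanSpace.norm_sq_eq e
          rw [hn, one_pow] at this
          rw [this]
          refine Finset.sum_congr rfl fun i _ => ?_
          rw [← Complex.normSq_eq_norm_sq, Complex.normSq_apply, he i]; ring
        simp only [headSq, hw1, neg_sq, mul_pow, Real.sq_sqrt htu.le, ← Finset.mul_sum, hn2, mul_one]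
      have hw : w ∈ hyperboloid k m u := by
        change headSq k m w = _
        rw [hwh, hwt]
      refine ⟨w, hw, ?_⟩
      have he' : headUnit u w = e := by
        ext i
        rw [headUnit_apply, hwt, hw1]
        exact Complex.ext (by simp; field_simp) (by simp [he i])
      have hq' : tailUnit u w = q := by
        ext j
        refine Fin.addCases (fun i => ?_) (fun i => ?_) j
        · simp [tailUnit, hq.1]
        · rw [tailUnit_natAdd, hwt, hw2]
          exact Complex.ext (by simp; field_simp) (by simp [hq.2.1])
      rw [hchart w hw (by rw [hwt]; exact ht), he', hq', hwt]

end Finish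

/-! ### Comparison with the surgery -/

section Surgery
variable {k m : ℕ} {u : ℝ} {ε δ : ℝ} {γ : ℝ → ℂ}

theorem tailScale_pos_of_mem_realLevel (hu : 0 < u) {z : CSpace (k + m)}
    (hz : z ∈ realLevel (k + m) k u) : 0 < tailScale k m u z := by
  refine (Real.sqrt_nonneg _).lt_of_ne fun h => ?_
  have h0 := (tailScale_eq_zero_iff hu).1 h.symm
  obtain ⟨h1, h2⟩ := hz
  have h3 := (quadH_eq_iff.1 h1).1
  rw [mem_realPlane_iff] at h2
  rw [Fin.sum_univ_add] at h3
  simp only [h0, h2] at h3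
  have : 0 ≤ ∑ i : Fin k, (z (Fin.castAdd m i)).im ^ 2 := Finset.sum_nonneg fun i _ => sq_nonneg _
  simp at h3
  linarith

/-- Outside the tube, the handle continues along the two Lagrangians. -/
theorem exists_smul_eq_of_le (hγ : IsRightHandedProfile ε δ γ) {v : CSpace k} (hv : ε ≤ ‖v‖)
    (h : IsRealVec v ∨ IsImagVec v) : ∃ (s : ℝ) (e : CSpace k), IsRealVec e ∧ ‖e‖ = 1 ∧ v = γ s • e := by
  have h0 : δ ≤ ‖v‖ := hγ.lt.le.trans hv
  have hpos : 0 < ‖v‖ := hγ.pos.trans_le h0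
  have hne : ((‖v‖ : ℝ) : ℂ) ≠ 0 := by exact_mod_cast hpos.ne'
  rcases h with h | h
  · refine ⟨‖v‖, ((‖v‖⁻¹ : ℝ) : ℂ) • v, fun i => by simp [h i], ?_, ?_⟩
    · rw [norm_smul, Complex.norm_real, norm_inv, norm_norm, inv_mul_cancel₀ hpos.ne']
    · rw [hγ.real_end _ h0, smul_smul, Complex.ofReal_inv, mul_inv_cancel₀ hne, one_smul]
  · refine ⟨-‖v‖, (((‖v‖⁻¹ : ℝ) : ℂ) * -Complex.I) • v, fun i => by simp [h i], ?_, ?_⟩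
    · rw [norm_smul, norm_mul, norm_neg, Complex.norm_I, mul_one, Complex.norm_real, norm_inv, norm_norm,
        inv_mul_cancel₀ hpos.ne']
    · rw [hγ.imag_end _ (neg_le_neg h0), neg_neg, smul_smul,
        show (‖v‖ : ℂ) * Complex.I * (((‖v‖⁻¹ : ℝ) : ℂ) * -Complex.I) = 1 by
          push_cast; field_simp; rw [Complex.I_sq, neg_neg], one_smul]

theorem isRealVec_or_isImagVec (hγ : IsRightHandedProfile ε δ γ) {s : ℝ} (hs : ε ≤ ‖γ s‖)
    {e : CSpace k} (he : IsRealVec e) : IsRealVec (γ s • e) ∨ IsImagVec (γ s • e) := by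
  rcases le_or_gt δ s with h | h
  · exact Or.inl fun i => by simp [hγ.real_end s h, he i]
  · rcases le_or_gt s (-δ) with h' | h'
    · exact Or.inr fun i => by simp [hγ.imag_end s h', he i]
    · exact absurd hs (not_le.2 (hγ.quadrant s (abs_lt.2 ⟨h', h⟩)).2.2)

theorem surgeryChart_fst_inj (hu : 0 < u) {v v' : CSpace k} {q q' p p' : CSpace (k + m)}
    (hq : q ∈ coreSphere k m u) (hp : p ∈ coreTangent k m q) (hq' : q' ∈ coreSphere k m u)
    (hp' : p' ∈ coreTangent k m q') (h : surgeryChart u (v, q, p) = surgeryChart u (v', q', p')) :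
    v = v' := by
  have h1 := surgeryChartInv_surgeryChart (v := v) hu hq hp
  rw [h, surgeryChartInv_surgeryChart hu hq' hp'] at h1
  exact (congrArg Prod.fst h1).symm

/-- The isotopy ends at the surgery. -/
theorem image_transportIsotopy (hu : 0 < u) (hγ : IsRightHandedProfile ε δ γ) :
    (fun z => transportIsotopy k m u γ (1, z)) '' transportLag k m u
      = ((realLevel (k + m) k u ∪ vanishingCycle (k + m) u) \
          surgeryChart u '' modelTube k (coreSphere k m u) ε)
        ∪ surgeryChart u '' modelHandle k (coreSphere k m u) ε γ := by
  ext z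
  rw [mem_image_transportIsotopy_iff hu]
  constructor
  · rintro (⟨h1, h2⟩ | ⟨s, e, q, he, hn, hq, rfl⟩)
    · refine Or.inl ⟨Or.inr h1, ?_⟩
      rintro ⟨⟨v, q, p⟩, hx, rfl⟩
      rw [mem_modelTube_core hu] at hx
      rw [tailScale_surgeryChart hu hx.2.1] at h2
      exact (chartScale_pos hu).ne' h2
    · have hp := zero_mem_coreTangent q
      have hnorm : ‖γ s • e‖ = ‖γ s‖ := by rw [norm_smul, hn, mul_one]
      have hε : 0 < ε := hγ.pos.trans hγ.lt
      rcases lt_or_ge ‖γ s‖ ε with h | h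
      · have hT : (γ s • e, q, (0 : CSpace (k + m))) ∈ modelTube k (coreSphere k m u) ε :=
          (mem_modelTube_core hu).2 ⟨hnorm.trans_lt h, hq, hp, by simpa using hε⟩
        exact Or.inr (Set.mem_image_of_mem _ ⟨hT, rfl, s, e, he, hn, rfl⟩)
      · refine Or.inl ⟨?_, ?_⟩
        · rcases isRealVec_or_isImagVec hγ h he with h' | h'
          · exact Or.inl ((surgeryChart_mem_realLevel_iff hu hq hp).2 ⟨h', rfl⟩)
          · exact Or.inr ((surgeryChart_mem_vanishingCycle_iff hu hq hp).2 ⟨h', rfl⟩)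
        · rintro ⟨⟨v', q', p'⟩, hx, hxe⟩
          rw [mem_modelTube_core hu] at hx
          have h3 : v' = γ s • e := surgeryChart_fst_inj hu hx.2.1 hx.2.2.1 hq hp hxe
          have h4 : ‖v'‖ < ε := hx.1
          rw [h3, hnorm] at h4
          exact absurd h4 (not_lt.2 h)
  · rintro (⟨h1, h2⟩ | ⟨⟨v, q, p⟩, ⟨hx, hp, s, e, he, hn, hv⟩, rfl⟩)
    · have hz : z ∈ quadFiber (k + m) (u : ℂ) := h1.elim (fun h => h.1) fun h => h.1
      rcases (show 0 ≤ tailScale k m u z from Real.sqrt_nonneg _).eq_or_lt with h0 | h0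
      · exact Or.inl ⟨h1.resolve_left fun h =>
          (tailScale_pos_of_mem_realLevel hu h).ne h0, h0.symm⟩
      · obtain ⟨hq, hp, hzx⟩ := surgeryChartInv_mem hu hz h0
        generalize surgeryChartInv u z = x at *
        obtain ⟨v, q, p⟩ := x
        subst hzx
        simp only at hq hp
        rw [Set.mem_union, surgeryChart_mem_realLevel_iff hu hq hp,
          surgeryChart_mem_vanishingCycle_iff hu hq hp, ← or_and_right] at h1
        obtain ⟨h3, rfl⟩ := h1
        have hε : 0 < ε := hγ.pos.trans hγ.lt
        have hv : ε ≤ ‖v‖ := not_lt.1 fun h => h2 (Set.mem_image_of_mem _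
          ((mem_modelTube_core hu).2 ⟨h, hq, hp, by simpa using hε⟩))
        obtain ⟨s, e, he, hn, rfl⟩ := exists_smul_eq_of_le hγ hv h3
        exact Or.inr ⟨s, e, q, he, hn, hq, rfl⟩
    · simp only at hp hv
      subst hp hv
      exact Or.inr ⟨s, e, q, he, hn, hx.2.1, rfl⟩

end Surgery

end

theorem lemmal (n k : ℕ) (hk : k ≤ n) (u : ℝ) (hu : 0 < u) :
    ∃ τ : CSpace n → CSpace n,
      -- parallel transport from the fiber over `-u` to the fiber over `u` is the map `τ`
      (∀ z ∈ quadFiber n ((-u : ℝ) : ℂ), ∀ z' : CSpace n,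
        ParallelTransports Real.pi z z' ↔ z' = τ z) ∧
      IsExactLagrangian (quadFiber n (u : ℂ)) (τ '' realLevel n k (-u)) ∧
      ∃ (ε : ℝ) (Φ : CSpace k × CSpace n × CSpace n → CSpace n),
        IsSurgeryChart k (quadFiber n (u : ℂ)) (realLevel n k u) (vanishingCycle n u) ε Φ ∧
        (∃ S, IsRightHandedSurgery k (realLevel n k u) (vanishingCycle n u) ε Φ S) ∧
        ∀ S, IsRightHandedSurgery k (realLevel n k u) (vanishingCycle n u) ε Φ S →
          LagrangianIsotopic (quadFiber n (u : ℂ)) (τ '' realLevel n k (-u)) S := by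
  obtain ⟨m, rfl⟩ := Nat.exists_eq_add_of_le hk
  refine ⟨halfTransport u, fun z hz z' => parallelTransports_iff hu hz z', ?_⟩
  rw [image_realLevel]
  refine ⟨isExactLagrangian_transportLag hu, 1, surgeryChart u, isSurgeryChart hu one_pos, ?_, ?_⟩
  · obtain ⟨δ, γ, hγ⟩ := exists_rightHandedProfile one_pos
    exact ⟨_, δ, γ, hγ, rfl⟩
  · rintro S ⟨δ, γ, hγ, rfl⟩
    rw [realLevel_inter_vanishingCycle, ← image_transportIsotopy hu hγ]
    exact ⟨_, isLagrangianIsotopy_transportIsotopy hu hγ⟩
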